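/- **Setting.** Let $F$ be a non-archimedean local field of characteristic zero with ring of integers $\mathfrak o$, maximal ideal $\mathfrak p$, uniformizer $\varpi$, residue field of cardinality $q$, and normalized absolute value $|\cdot|$. Let $\mathbf a,\mathbf b\in\mathfrak o$, $\mathbf c\in\mathfrak o^\times$, $\mathbf d=\mathbf b^2-4\mathbf a\mathbf c\neq 0$. Put $L=F(\sqrt{\mathbf d})$ if $\mathbf d\notin F^{\times 2}$, and $L=F\oplus F$ (with $\sqrt{\mathbf d}$ meaning $(\sqrt{\mathbf d},-\sqrt{\mathbf d})$) otherwise. Assume that $\mathbf d$ generates the discriminant of $L/F$ if $L$ is a field, and that $\mathbf d\in\mathfrak o^\times$ if $L=F\oplus F$. Let $\mathfrak o_L$ be the integral closure of $\mathfrak o$ in $L$, $z\mapsto\bar z$ the involution of $L/F$, $|z|_L=|z\bar z|$, and let $\varpi_L$ be a uniformizer of $L$ if $L$ is a field, $\varpi_L=(\varpi,1)$ otherwise. Put $\left(\frac{L}{\mathfrak p}\right)=-1,0,1$ according as $L/F$ is an unramified field extension, a ramified field extension, or $L=F\oplus F$. Let $S=\begin{pmatrix}\mathbf a&\mathbf b/2\\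 \mathbf b/2&\mathbf c\end{pmatrix}$, $\xi=\begin{pmatrix}\mathbf b/2&\mathbf c\\-\mathbf a&-\mathbf b/2\end{pmatrix}$, $T(F)=\{g\in \mathrm{GL}_2(F): {}^tgSg=\det(g)S\}$; identify $L^\times$ with $T(F)$ by $x+y\sqrt{\mathbf d}/2\mapsto x+y\xi$. Let $\beta=(\mathbf b+\sqrt{\mathbf d})/(2\mathbf c)\in L$, $\eta=\begin{pmatrix}1&0\\ \beta&1\end{pmatrix}$, and $K=\mathrm{GL}_2(\mathfrak o)$. Let $\pi=\chi_1\times\chi_2$ (normalized induction) with unramified characters $\chi_1,\chi_2$ of $F^\times$ and $\chi_1\chi_2^{-1}\neq|\cdot|^{\pm1}$. Let $\Omega_1,\Omega_2$ be unramified characters of $L^\times$ (trivial on $\mathfrak o_L^\times$) with $\Omega_1\Omega_2|_{F^\times}=\omega_\pi^{-1}=(\chi_1\chi_2)^{-1}$, and put $\Omega(z)=\Omega_1(\bar z)^{-1}\Omega_2(z)^{-1}$. Let $\mathcal W$ be an $(S,\Omega)$-Waldspurger model of $\pi$: a space of locally constant functions $B$ on $\mathrm{GL}_2(F)$ with $B(tg)=\Omega(t)B(g)$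 for $t\in T(F)$, stable under right translation and isomorphic to $\pi$. For $s\in\mathbb C$ let $f(\cdot,s)$ be the function on $\mathrm{GL}_2(L)$ with $$f\Big(\begin{pmatrix}u&v\\0&w\end{pmatrix}k,s\Big)=\Omega_1(u)\Omega_2(w)\,|u/w|_L^{s+1/2},\qquad u,w\in L^\times,\ v\in L,\ k\in\mathrm{GL}_2(\mathfrak o_L).$$ Fix the right $\mathrm{GL}_2(F)$-invariant Borel measure on $T(F)\backslash \mathrm{GL}_2(F)$ for which $T(F)\backslash T(F)K$ has volume $1$. **Theorem.** There is exactly one right $K$-invariant $B_0\in\mathcal W$ with $B_0(1)=1$. For every $s\in\mathbb C$ the function $h\mapsto f(\eta h,s)B_0(h)$ is left $T(F)$-invariant; let $$Z(s)=\int_{T(F)\backslash \mathrm{GL}_2(F)}f(\eta h,s)B_0(h)\,dh .$$ The integral converges absolutely whenever $|\chi_i(\varpi)\Omega_1(\varpi)q^{-2s-1/2}|<1$ for $i=1,2$ (in particular for $\mathrm{Re}(s)$ large). Whenever it converges absolutely and $\chi_i(\varpi)\Omega_1(\varpi)q^{-2s-1/2}\neq1$ for $i=1,2$, $$Z(s)=\frac{L(2s+\tfrac12,\pi\times\Omega_1|_{F^\times})}{L(2s+1,\Omega_1\Omega_2^{-1})},$$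 where $L(s,\pi\times\Omega_1|_{F^\times})=\prod_{i=1,2}\big(1-\chi_i(\varpi)\Omega_1(\varpi)q^{-s}\big)^{-1}$ and $$L(s,\Omega_1\Omega_2^{-1})=\begin{cases}\big(1-\Omega_1\Omega_2^{-1}(\varpi)q^{-2s}\big)^{-1}&\text{if }\left(\frac{L}{\mathfrak p}\right)=-1,\\ \big(1-\Omega_1\Omega_2^{-1}(\varpi_L)q^{-s}\big)^{-1}&\text{if }\left(\frac{L}{\mathfrak p}\right)=0,\\ \big(1-\Omega_1\Omega_2^{-1}(\varpi,1)q^{-s}\big)^{-1}\big(1-\Omega_1\Omega_2^{-1}(1,\varpi)q^{-s}\big)^{-1}&\text{if }\left(\frac{L}{\mathfrak p}\right)=1.\end{cases}$$ (If $L(s,\Omega_1\Omega_2^{-1})$ has a pole at $2s+1$, its reciprocal is read as $0$.) -/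

import Mathlib

open ValuativeRel MeasureTheory
open scoped MatrixGroups

namespace WaldspurgerZeta

noncomputable section

/-! ### Characters, uniformizers, the normalized absolute value -/

/-- A character of `Rˣ` is unramified (with respect to the subring of integers `O`) if it is trivial
on `Oˣ`.  -/
def IsUnramified (O : Type*) {R : Type*} [CommRing O] [CommRing R] [Algebra O R]
    (χ : Rˣ →* ℂˣ) : Prop :=
  ∀ u : Oˣ, χ (Units.map (algebraMap O R : O →* R) u) = 1

/-- `x` is (the image of) an irreducible element of `O`. When `O` is a discrete valuation ring, this
says that `x` is a uniformizer. -/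
def IsUniformizer (O : Type*) {R : Type*} [CommRing O] [CommRing R] [Algebra O R]
    (x : Rˣ) : Prop :=
  ∃ p : O, Irreducible p ∧ algebraMap O R p = (x : R)

/-- `GL₂(O)` as a subgroup of `GL₂(R)`. -/
def integralGL (O R : Type*) [CommRing O] [CommRing R] [Algebra O R] : Subgroup (GL (Fin 2) R) :=
  (Matrix.GeneralLinearGroup.map (n := Fin 2) (algebraMap O R)).range

/-- The upper triangular matrix `[u, v; 0, w]`. -/
def upperTri {R : Type*} [CommRing R] (u : Rˣ) (v : R) (w : Rˣ) : GL (Fin 2) R :=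
  Matrix.GeneralLinearGroup.mk'' !![(u : R), v; 0, (w : R)]
    (by simp [Matrix.det_fin_two_of])

/-- The lower triangular unipotent matrix `[1, 0; β, 1]`. -/
def lowerUnip {R : Type*} [CommRing R] (β : R) : GL (Fin 2) R :=
  Matrix.GeneralLinearGroup.mk'' !![1, 0; β, 1] (by simp [Matrix.det_fin_two_of])

section LocalField

variable (F : Type*) [Field F] [ValuativeRel F] [TopologicalSpace F] [IsNonarchimedeanLocalField F]

/-- The cardinality `q` of the residue field. -/
def resCard : ℕ := Nat.card 𝓀[F]

variable {F}

open Classical in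
/-- The normalized absolute value `|x| = q ^ (-v(x))` on `F`. The group of values of `F` is
identified with the integers, written multiplicatively; a uniformizer goes to `exp (-1)`. -/
def absF (x : F) : ℝ :=
  if x = 0 then 0
  else (resCard F : ℝ) ^
    WithZero.log (IsNonarchimedeanLocalField.valueGroupWithZeroIsoInt F (valuation F x))

/-! ### Unramified principal series -/

/-- Right translation of functions on a group: `(translate g φ) h = φ (h * g)`. -/
def translate {G : Type*} [Group G] (g : G) (φ : G → ℂ) : G → ℂ := fun h => φ (h * g)

/-- The space of the normalized induced representation `χ₁ × χ₂` of `GL₂(F)`: smooth functions with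
`φ([u, v; 0, w] g) = χ₁(u) χ₂(w) |u / w|^{1/2} φ(g)`. The group acts by right translation. -/
def principalSeries (χ₁ χ₂ : Fˣ →* ℂˣ) : Submodule ℂ (GL (Fin 2) F → ℂ) where
  carrier := {φ |
    (∀ (u w : Fˣ) (v : F) (g : GL (Fin 2) F),
      φ (upperTri u v w * g)
        = (χ₁ u : ℂ) * (χ₂ w : ℂ) * (Real.sqrt (absF ((u : F) / (w : F))) : ℂ) * φ g) ∧
    ∃ U : Subgroup (GL (Fin 2) F), IsOpen (U : Set (GL (Fin 2) F)) ∧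
      ∀ k ∈ U, ∀ g, φ (g * k) = φ g}
  zero_mem' := ⟨by simp, ⊤, by simp, by simp⟩
  add_mem' := by
    rintro φ ψ ⟨h1, U, hU, h2⟩ ⟨h3, V, hV, h4⟩
    refine ⟨fun u w v g => ?_, U ⊓ V, hU.inter hV, fun k hk g => ?_⟩
    · simp only [Pi.add_apply, h1, h3]; ring
    · simp only [Pi.add_apply, h2 k hk.1, h4 k hk.2]
  smul_mem' := by
    rintro c φ ⟨h1, U, hU, h2⟩
    refine ⟨fun u w v g => ?_, U, hU, fun k hk g => ?_⟩
    · simp only [Pi.smul_apply, smul_eq_mul, h1]; ring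
    · simp only [Pi.smul_apply, h2 k hk]

theorem translate_mem_principalSeries {χ₁ χ₂ : Fˣ →* ℂˣ}
    {φ : GL (Fin 2) F → ℂ} (hφ : φ ∈ principalSeries χ₁ χ₂) (g : GL (Fin 2) F) :
    translate g φ ∈ principalSeries χ₁ χ₂ := by
  obtain ⟨h1, U, hU, h2⟩ := hφ
  refine ⟨fun u w v h => ?_, U.comap (MulAut.conj g⁻¹).toMonoidHom, ?_, fun k hk h => ?_⟩
  · simp only [translate, mul_assoc]
    rw [h1]; ring
  · refine hU.preimage (f := fun x => g⁻¹ * x * g⁻¹⁻¹) ?_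
    fun_prop
  · have := h2 _ hk (h * g)
    simp only [translate]
    rw [← this]
    congr 1
    simp [mul_assoc]

/-! ### The quadratic algebra `L`, its integers, and the torus -/

/-- `d = b² - 4ac`. -/
abbrev disc (a b c : 𝒪[F]) : 𝒪[F] := b ^ 2 - 4 * a * c

theorem coe_disc (a b c : 𝒪[F]) : (disc a b c : F) = (b : F) ^ 2 - 4 * (a : F) * (c : F) := by
  have : (disc a b c : F) = algebraMap 𝒪[F] F (b ^ 2 - 4 * a * c) := rfl
  rw [this, map_sub, map_mul, map_mul, map_pow, map_ofNat]
  rfl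

/-- The quadratic `F`-algebra `L = F[√d]`, `d = b² - 4ac`, with elements `x + y √d` written `⟨x, y⟩`.
It is the field `F(√d)` if `d` is not a square in `F`. If `d = r²` with `r ≠ 0` it is isomorphic to
`F ⊕ F` by `x + y √d ↦ (x + y r, x - y r)`. The involution `z ↦ z̄` is `star`. -/
abbrev QuadL (a b c : 𝒪[F]) : Type _ := QuadraticAlgebra F (disc a b c : F) 0

/-- The ring of integers of `L`: the integral closure of `𝒪[F]` in `L` (this is `𝒪[F] ⊕ 𝒪[F]` if
`L = F ⊕ F`). -/
abbrev intL (a b c : 𝒪[F]) : Subalgebra 𝒪[F] (QuadL a b c) := integralClosure 𝒪[F] (QuadL a b c)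

/-- The discriminant ideal of `L/F`: the ideal generated by the discriminants of all pairs
of elements of the ring of integers of `L`. -/
def discrIdeal (a b c : 𝒪[F]) : Ideal 𝒪[F] :=
  Ideal.span {δ | ∃ v : Fin 2 → intL a b c,
    (δ : F) = Algebra.discr F (fun i => (v i : QuadL a b c))}

/-- The standing assumptions on `a, b, c`. -/
structure Admissible (a b c : 𝒪[F]) : Prop where
  isUnit_c : IsUnit c
  discr_of_field : ¬ IsSquare (disc a b c : F) → discrIdeal a b c = Ideal.span {disc a b c}
  isUnit_of_split : IsSquare (disc a b c : F) → IsUnit (disc a b c)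

open Classical in
/-- The symbol `(L/𝔭)`: it is `1` if `L = F ⊕ F`, `-1` if `L/F` is an unramified field extension
(`𝔭` generates a prime ideal in the integers of `L`), and `0` if `L/F` is a ramified field
extension. -/
def splitSymbol (a b c : 𝒪[F]) : ℤ :=
  if IsSquare (disc a b c : F) then 1
  else if ((𝓂[F]).map (algebraMap 𝒪[F] (intL a b c))).IsPrime then -1
  else 0

/-- The element `ϖ_L` of `L`: a uniformizer if `L` is a field, and `(ϖ, 1)` if `L = F ⊕ F`
(identified with `F[√d]` through one of the two square roots `r` of `d`). -/
def IsUniformizerL {a b c : 𝒪[F]} (ϖ : Fˣ) (ϖL : (QuadL a b c)ˣ) : Prop :=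
  (¬ IsSquare (disc a b c : F) → IsUniformizer (intL a b c) ϖL) ∧
  (IsSquare (disc a b c : F) → ∃ r : F, r ^ 2 = (disc a b c : F) ∧
    (ϖL : QuadL a b c).re + (ϖL : QuadL a b c).im * r = (ϖ : F) ∧
    (ϖL : QuadL a b c).re - (ϖL : QuadL a b c).im * r = 1)

/-- The normalized absolute value `|z|_L = |N_{L/F}(z)|`, where `N_{L/F}(z) = z z̄`. For `L = F ⊕ F`
it is `|(z₁, z₂)|_L = |z₁| |z₂|`. -/
def absL {a b c : 𝒪[F]} (z : QuadL a b c) : ℝ := absF (QuadraticAlgebra.norm z)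

/-- The symmetric matrix `S = [a, b/2; b/2, c]`. -/
def matS (a b c : 𝒪[F]) : Matrix (Fin 2) (Fin 2) F :=
  !![(a : F), (b : F) / 2; (b : F) / 2, (c : F)]

/-- The matrix `ξ = [b/2, c; -a, -b/2]`. -/
def matXi (a b c : 𝒪[F]) : Matrix (Fin 2) (Fin 2) F :=
  !![(b : F) / 2, (c : F); -(a : F), -(b : F) / 2]

/-- The torus `T(F) = {g | ᵗg S g = det(g) S}`. -/
def torus (a b c : 𝒪[F]) : Subgroup (GL (Fin 2) F) where
  carrier := {g | (g : Matrix (Fin 2) (Fin 2) F).transpose * matS a b c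
    * (g : Matrix (Fin 2) (Fin 2) F)
      = (g : Matrix (Fin 2) (Fin 2) F).det • matS a b c}
  one_mem' := by simp
  mul_mem' := by
    intro g h hg hh
    simp only [Set.mem_ofPred_eq] at hg hh ⊢
    rw [Units.val_mul, Matrix.transpose_mul, Matrix.det_mul]
    calc _ = (h : Matrix (Fin 2) (Fin 2) F).transpose *
          ((g : Matrix (Fin 2) (Fin 2) F).transpose * matS a b c
            * (g : Matrix (Fin 2) (Fin 2) F)) * (h : Matrix (Fin 2) (Fin 2) F) := by
          simp only [Matrix.mul_assoc]
      _ = _ := by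
          rw [hg, Matrix.mul_smul, Matrix.smul_mul, hh, smul_smul]
  inv_mem' := by
    intro g hg
    simp only [Set.mem_ofPred_eq] at hg ⊢
    have h1 : (g : Matrix (Fin 2) (Fin 2) F) * ((g⁻¹ : GL (Fin 2) F) : Matrix _ _ F) = 1 :=
      Units.mul_inv g
    have h2 : ((g⁻¹ : GL (Fin 2) F) : Matrix (Fin 2) (Fin 2) F).transpose
        * (g : Matrix (Fin 2) (Fin 2) F).transpose = 1 := by
      rw [← Matrix.transpose_mul, h1, Matrix.transpose_one]
    have h3 : (g : Matrix (Fin 2) (Fin 2) F).det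
        * ((g⁻¹ : GL (Fin 2) F) : Matrix (Fin 2) (Fin 2) F).det = 1 := by
      rw [← Matrix.det_mul, h1, Matrix.det_one]
    set X : Matrix (Fin 2) (Fin 2) F := (g : Matrix (Fin 2) (Fin 2) F) with hX
    set Y : Matrix (Fin 2) (Fin 2) F := ((g⁻¹ : GL (Fin 2) F) : Matrix (Fin 2) (Fin 2) F) with hY
    have h4 : X.det • (Y.transpose * matS a b c * Y) = matS a b c := by
      calc X.det • (Y.transpose * matS a b c * Y)
          = Y.transpose * (X.det • matS a b c) * Y := by
            rw [Matrix.mul_smul, Matrix.smul_mul]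
        _ = (Y.transpose * X.transpose) * matS a b c * (X * Y) := by
            rw [← hg]; simp only [Matrix.mul_assoc]
        _ = matS a b c := by rw [h1, h2]; simp
    calc Y.transpose * matS a b c * Y
        = (X.det * Y.det) • (Y.transpose * matS a b c * Y) := by rw [h3, one_smul]
      _ = Y.det • matS a b c := by rw [mul_comm, mul_smul, h4]

theorem two_xi_sq [CharZero F] (a b c : 𝒪[F]) :
    ((2 : F) • matXi a b c) * ((2 : F) • matXi a b c)
      = (disc a b c : F) • 1 + (0 : F) • ((2 : F) • matXi a b c) := by
  rw [coe_disc]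
  ext i j
  fin_cases i <;> fin_cases j <;>
    simp [matXi, Matrix.mul_apply, Fin.sum_univ_two] <;> ring

/-- The isomorphism of `Lˣ` with the torus: `x + y √d / 2 ↦ x + y ξ`, as a homomorphism to
`GL₂(F)`. -/
def torusHom [CharZero F] (a b c : 𝒪[F]) : (QuadL a b c)ˣ →* GL (Fin 2) F :=
  Units.map (QuadraticAlgebra.lift ⟨(2 : F) • matXi a b c, two_xi_sq a b c⟩ :
    QuadL a b c →ₐ[F] Matrix (Fin 2) (Fin 2) F)

theorem torusHom_val [CharZero F] (a b c : 𝒪[F]) (z : (QuadL a b c)ˣ) :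
    (torusHom a b c z : Matrix (Fin 2) (Fin 2) F)
      = (z : QuadL a b c).re • 1 + (2 * (z : QuadL a b c).im) • matXi a b c := by
  have : (torusHom a b c z : Matrix (Fin 2) (Fin 2) F)
      = algebraMap F _ (z : QuadL a b c).re
        + (z : QuadL a b c).im • ((2 : F) • matXi a b c) := by
    simp [torusHom, QuadraticAlgebra.lift, Algebra.algebraMap_eq_smul_one]
  rw [this, Algebra.algebraMap_eq_smul_one, smul_smul, mul_comm (2 : F)]

/-- The homomorphism `torusHom` identifies `Lˣ` with the torus. -/
theorem range_torusHom [CharZero F] (a b c : 𝒪[F]) (hc : IsUnit c) :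
    (torusHom a b c).range = torus a b c := by
  have hc0 : (c : F) ≠ 0 := by
    have := hc.ne_zero
    exact fun h => this (Subtype.ext h)
  ext g
  constructor
  · rintro ⟨z, rfl⟩
    change _ = _
    rw [torusHom_val]
    generalize (z : QuadL a b c).re = x
    generalize (z : QuadL a b c).im = y
    ext i j
    fin_cases i <;> fin_cases j <;>
      simp [matXi, matS, Matrix.mul_apply, Fin.sum_univ_two, Matrix.det_fin_two] <;> field_simp <;>
      ring
  · intro hg
    have hg' : (g : Matrix (Fin 2) (Fin 2) F).transpose * matS a b c
      * (g : Matrix (Fin 2) (Fin 2) F)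
        = (g : Matrix (Fin 2) (Fin 2) F).det • matS a b c := hg
    have hdet : (g : Matrix (Fin 2) (Fin 2) F).det ≠ 0 :=
      ((Matrix.isUnit_iff_isUnit_det _).mp g.isUnit).ne_zero
    have hadj : matS a b c * (g : Matrix (Fin 2) (Fin 2) F)
        = (g : Matrix (Fin 2) (Fin 2) F).transpose.adjugate * matS a b c := by
      have h := congrArg (fun X => (g : Matrix (Fin 2) (Fin 2) F).transpose.adjugate * X) hg'
      simp only [← Matrix.mul_assoc, Matrix.adjugate_mul, Matrix.det_transpose, Matrix.smul_mul,
        Matrix.one_mul, Matrix.mul_smul] at h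
      exact smul_right_injective _ hdet h
    set p := (g : Matrix (Fin 2) (Fin 2) F) 0 0 with hp
    set q := (g : Matrix (Fin 2) (Fin 2) F) 0 1 with hq
    set r := (g : Matrix (Fin 2) (Fin 2) F) 1 0 with hr
    set t := (g : Matrix (Fin 2) (Fin 2) F) 1 1 with ht
    have hgm : (g : Matrix (Fin 2) (Fin 2) F) = !![p, q; r, t] := Matrix.eta_fin_two _
    rw [hgm] at hadj hdet
    have e1 : (a : F) * q + b / 2 * t = t * (b / 2) + -(r * c) := by
      simpa [matS, Matrix.mul_apply, Fin.sum_univ_two, Matrix.adjugate_fin_two] using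
        congrFun (congrFun hadj 0) 1
    have e2 : (b : F) / 2 * q + c * t = -(q * (b / 2)) + p * c := by
      simpa [matS, Matrix.mul_apply, Fin.sum_univ_two, Matrix.adjugate_fin_two] using
        congrFun (congrFun hadj 1) 1
    have hr' : r = -(a * (q / c)) := by field_simp; linear_combination e1
    have ht' : t = p - b * (q / c) := by field_simp; linear_combination e2
    have hdet' : p * t - q * r ≠ 0 := by simpa [Matrix.det_fin_two] using hdet
    let z : QuadL a b c := ⟨p - b * (q / c) / 2, q / c / 2⟩
    have hz : IsUnit z := by
      rw [QuadraticAlgebra.isUnit_iff_norm_isUnit, isUnit_iff_ne_zero]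
      convert hdet' using 1
      rw [QuadraticAlgebra.norm_def]
      simp only [z]
      rw [hr', ht', coe_disc]
      field_simp
      ring
    refine ⟨hz.unit, Units.ext ?_⟩
    rw [torusHom_val, hgm, hr', ht']
    ext i j
    fin_cases i <;> fin_cases j <;> simp [matXi, z] <;> field_simp <;> ring

theorem torusHom_injective [CharZero F] (a b c : 𝒪[F]) (hc : IsUnit c) :
    Function.Injective (torusHom a b c) := by
  have hc0 : (c : F) ≠ 0 := by
    have := hc.ne_zero
    exact fun h => this (Subtype.ext h)
  intro z w h
  have h' := congrArg (fun g : GL (Fin 2) F => (g : Matrix (Fin 2) (Fin 2) F)) h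
  simp only [torusHom_val] at h'
  have h01 := congrFun (congrFun h' 0) 1
  have h00 := congrFun (congrFun h' 0) 0
  have him : (z : QuadL a b c).im = (w : QuadL a b c).im := by
    simpa [matXi, hc0] using h01
  have hre : (z : QuadL a b c).re = (w : QuadL a b c).re := by
    simpa [matXi, him] using h00
  exact Units.ext (QuadraticAlgebra.ext hre him)

/-- The character `Ω(z) = Ω₁(z̄)⁻¹ Ω₂(z)⁻¹` of `Lˣ`. -/
def charOmega {a b c : 𝒪[F]} (Ω₁ Ω₂ : (QuadL a b c)ˣ →* ℂˣ) : (QuadL a b c)ˣ →* ℂˣ :=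
  (Ω₁.comp (Units.map (starRingEnd (QuadL a b c) : QuadL a b c →* QuadL a b c)))⁻¹ * Ω₂⁻¹

/-- The restriction of a character of `Lˣ` to `Fˣ`. -/
def restrictF {a b c : 𝒪[F]} (Ω : (QuadL a b c)ˣ →* ℂˣ) : Fˣ →* ℂˣ :=
  Ω.comp (Units.map (algebraMap F (QuadL a b c) : F →* QuadL a b c))

/-! ### Waldspurger models -/

/-- `W` is an `(S, Ω)`-Waldspurger model of `χ₁ × χ₂`: a space of locally constant functions `B` on
`GL₂(F)` with `B(t g) = Ω(t) B(g)` for `t` in the torus, stable under right translation, and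
isomorphic to `χ₁ × χ₂` as a representation of `GL₂(F)`. -/
structure IsWaldspurgerModel [CharZero F] {a b c : 𝒪[F]} (χ₁ χ₂ : Fˣ →* ℂˣ)
    (Ω : (QuadL a b c)ˣ →* ℂˣ) (W : Submodule ℂ (GL (Fin 2) F → ℂ)) : Prop where
  locConst : ∀ B ∈ W, IsLocallyConstant B
  equivariant : ∀ B ∈ W, ∀ (z : (QuadL a b c)ˣ) (g : GL (Fin 2) F),
    B (torusHom a b c z * g) = (Ω z : ℂ) * B g
  translate_mem : ∀ B ∈ W, ∀ g : GL (Fin 2) F, translate g B ∈ W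
  exists_equiv : ∃ e : principalSeries χ₁ χ₂ ≃ₗ[ℂ] W,
    ∀ (φ : principalSeries χ₁ χ₂) (g : GL (Fin 2) F),
      (e ⟨translate g φ, translate_mem_principalSeries φ.2 g⟩ : GL (Fin 2) F → ℂ)
        = translate g (e φ)

/-- Right invariance under `K = GL₂(𝒪[F])`. -/
def IsSpherical (B : GL (Fin 2) F → ℂ) : Prop :=
  ∀ k ∈ integralGL 𝒪[F] F, ∀ g, B (g * k) = B g

/-! ### The unramified section -/

/-- `g = [u, v; 0, w] k` with `p = (u, v, w)` and `k ∈ GL₂(𝒪_L)`. -/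
def IsIwasawa {a b c : 𝒪[F]} (g : GL (Fin 2) (QuadL a b c))
    (p : (QuadL a b c)ˣ × QuadL a b c × (QuadL a b c)ˣ) : Prop :=
  ∃ k ∈ integralGL (intL a b c) (QuadL a b c), g = upperTri p.1 p.2.1 p.2.2 * k

/-- The value `Ω₁(u) Ω₂(w) |u / w|_L^{s + 1/2}`. -/
def borelChar {a b c : 𝒪[F]} (Ω₁ Ω₂ : (QuadL a b c)ˣ →* ℂˣ) (s : ℂ) (u w : (QuadL a b c)ˣ) : ℂ :=
  (Ω₁ u : ℂ) * (Ω₂ w : ℂ) * (absL ((u / w : (QuadL a b c)ˣ) : QuadL a b c) : ℂ) ^ (s + 1 / 2)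

open Classical in
/-- The unramified section
`f([u, v; 0, w] k, s) = Ω₁(u) Ω₂(w) |u / w|_L^{s + 1/2}`, `k ∈ GL₂(𝒪_L)`. For unramified
characters the value does not depend on the decomposition, see `sphericalSection_apply`. -/
def sphericalSection {a b c : 𝒪[F]} (Ω₁ Ω₂ : (QuadL a b c)ˣ →* ℂˣ) (s : ℂ)
    (g : GL (Fin 2) (QuadL a b c)) : ℂ :=
  if h : ∃ p, IsIwasawa g p then borelChar Ω₁ Ω₂ s h.choose.1 h.choose.2.2 else 0

theorem isIntegral_norm {a b c : 𝒪[F]} {z : QuadL a b c} (hz : z ∈ intL a b c) :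
    ∃ n : 𝒪[F], (n : F) = QuadraticAlgebra.norm z := by
  have hstar : IsIntegral 𝒪[F] (star z) := by
    let σ : QuadL a b c →ₐ[𝒪[F]] QuadL a b c :=
      { starRingEnd (QuadL a b c) with
        commutes' := fun r => by
          change star (algebraMap 𝒪[F] (QuadL a b c) r) = _
          rw [IsScalarTower.algebraMap_apply 𝒪[F] F (QuadL a b c)]
          ext <;> simp }
    exact IsIntegral.map σ hz
  have h : IsIntegral 𝒪[F] (algebraMap F (QuadL a b c) (QuadraticAlgebra.norm z)) := by
    rw [QuadraticAlgebra.algebraMap_norm_eq_mul_star]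
    exact IsIntegral.mul hz hstar
  rw [isIntegral_algebraMap_iff QuadraticAlgebra.algebraMap_injective] at h
  exact IsIntegrallyClosed.isIntegral_iff.mp h

theorem absL_unit {a b c : 𝒪[F]} (e : (intL a b c)ˣ) :
    absL ((e : intL a b c) : QuadL a b c) = 1 := by
  obtain ⟨n, hn⟩ := isIntegral_norm (e : intL a b c).2
  obtain ⟨m, hm⟩ := isIntegral_norm ((e⁻¹ : (intL a b c)ˣ) : intL a b c).2
  have hnm : (n : F) * (m : F) = 1 := by
    rw [hn, hm, ← map_mul]
    have : ((e : intL a b c) : QuadL a b c) * ((e⁻¹ : (intL a b c)ˣ) : intL a b c) = 1 := by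
      rw [← MulMemClass.coe_mul, Units.mul_inv]; rfl
    rw [this, map_one]
  have hv : valuation F (n : F) = 1 := by
    have h1 : valuation F (n : F) ≤ 1 := n.2
    have h2 : valuation F (m : F) ≤ 1 := m.2
    have h3 : valuation F (n : F) * valuation F (m : F) = 1 := by rw [← map_mul, hnm, map_one]
    refine le_antisymm h1 ?_
    calc (1 : ValueGroupWithZero F) = valuation F (n : F) * valuation F (m : F) := h3.symm
      _ ≤ valuation F (n : F) * 1 := by gcongr
      _ = _ := mul_one _
  have hn0 : (n : F) ≠ 0 := left_ne_zero_of_mul_eq_one hnm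
  rw [absL, ← hn, absF, if_neg hn0, hv]
  simp

theorem absF_mul (x y : F) : absF (x * y) = absF x * absF y := by
  by_cases hx : x = 0
  · simp [absF, hx]
  by_cases hy : y = 0
  · simp [absF, hy]
  have hq : (resCard F : ℝ) ≠ 0 := by
    have : Nat.card 𝓀[F] ≠ 0 := Nat.card_pos.ne'
    exact_mod_cast this
  rw [absF, absF, absF, if_neg hx, if_neg hy, if_neg (mul_ne_zero hx hy), map_mul, map_mul,
    WithZero.log_mul (by simpa using hx) (by simpa using hy), zpow_add₀ hq]

theorem absL_mul {a b c : 𝒪[F]} (x y : QuadL a b c) : absL (x * y) = absL x * absL y := by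
  rw [absL, map_mul, absF_mul]; rfl

theorem borelChar_mul_unit {a b c : 𝒪[F]} {Ω₁ Ω₂ : (QuadL a b c)ˣ →* ℂˣ}
    (h₁ : IsUnramified (intL a b c) Ω₁) (h₂ : IsUnramified (intL a b c) Ω₂) (s : ℂ)
    (u w : (QuadL a b c)ˣ) (e e' : (intL a b c)ˣ) :
    borelChar Ω₁ Ω₂ s
      (u * Units.map (algebraMap (intL a b c) (QuadL a b c) : intL a b c →* QuadL a b c) e)
      (w * Units.map (algebraMap (intL a b c) (QuadL a b c) : intL a b c →* QuadL a b c) e')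
      = borelChar Ω₁ Ω₂ s u w := by
  have key : absL (((u * Units.map
        (algebraMap (intL a b c) (QuadL a b c) : intL a b c →* QuadL a b c) e) /
      (w * Units.map (algebraMap (intL a b c) (QuadL a b c) : intL a b c →* QuadL a b c) e') :
        (QuadL a b c)ˣ) : QuadL a b c) = absL ((u / w : (QuadL a b c)ˣ) : QuadL a b c) := by
    rw [mul_div_mul_comm, ← map_div, Units.val_mul, absL_mul]
    have := absL_unit (e / e')
    rw [Units.coe_map]
    erw [this]
    rw [mul_one]
  rw [borelChar, borelChar, key, map_mul, map_mul, h₁ e, h₂ e', mul_one, mul_one]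

theorem sphericalSection_apply {a b c : 𝒪[F]} {Ω₁ Ω₂ : (QuadL a b c)ˣ →* ℂˣ}
    (h₁ : IsUnramified (intL a b c) Ω₁) (h₂ : IsUnramified (intL a b c) Ω₂) (s : ℂ)
    (u w : (QuadL a b c)ˣ) (v : QuadL a b c)
    {k : GL (Fin 2) (QuadL a b c)} (hk : k ∈ integralGL (intL a b c) (QuadL a b c)) :
    sphericalSection Ω₁ Ω₂ s (upperTri u v w * k) = borelChar Ω₁ Ω₂ s u w := by
  have hex : ∃ p, IsIwasawa (upperTri u v w * k) p := ⟨(u, v, w), k, hk, rfl⟩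
  rw [sphericalSection, dif_pos hex]
  obtain ⟨k', hk', h⟩ := hex.choose_spec
  generalize hex.choose = p at *
  obtain ⟨u', v', w'⟩ := p
  obtain ⟨κ, hκ⟩ := mul_mem hk (inv_mem hk')
  have h' : upperTri u v w * Matrix.GeneralLinearGroup.map (algebraMap (intL a b c) (QuadL a b c)) κ
      = upperTri u' v' w' := by
    rw [hκ, ← mul_assoc, h, mul_assoc, mul_inv_cancel, mul_one]
  have hm := congrArg (fun g : GL (Fin 2) (QuadL a b c) => (g : Matrix (Fin 2) (Fin 2) (QuadL a b c))) h'
  have h10 := congrFun (congrFun hm 1) 0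
  have h11 := congrFun (congrFun hm 1) 1
  have h00 := congrFun (congrFun hm 0) 0
  simp [upperTri, Matrix.mul_apply, Fin.sum_univ_two] at h10 h11 h00
  have hdet := (Matrix.isUnit_iff_isUnit_det _).mp κ.isUnit
  rw [Matrix.det_fin_two, h10, mul_zero, sub_zero] at hdet
  obtain ⟨e, he⟩ := isUnit_of_mul_isUnit_left hdet
  obtain ⟨e', he'⟩ := isUnit_of_mul_isUnit_right hdet
  have hu : u' = u * Units.map
      (algebraMap (intL a b c) (QuadL a b c) : intL a b c →* QuadL a b c) e := by
    ext1
    rw [← h00, h10]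
    simp [← he]
  have hw : w' = w * Units.map
      (algebraMap (intL a b c) (QuadL a b c) : intL a b c →* QuadL a b c) e' := by
    ext1
    rw [← h11]
    simp [← he']
  simp only
  rw [hu, hw, borelChar_mul_unit h₁ h₂]

/-! ### The zeta integral -/

/-- `β = (b + √d) / (2c)`; for `L = F ⊕ F` this is `((b + √d)/(2c), (b - √d)/(2c))`. -/
def beta (a b c : 𝒪[F]) : QuadL a b c := ⟨(b : F) / (2 * (c : F)), 1 / (2 * (c : F))⟩

/-- The function `h ↦ f(η h, s) B(h)` on `GL₂(F)`, with `η = [1, 0; β, 1]`. -/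
def zetaFun {a b c : 𝒪[F]} (Ω₁ Ω₂ : (QuadL a b c)ˣ →* ℂˣ) (B : GL (Fin 2) F → ℂ) (s : ℂ)
    (h : GL (Fin 2) F) : ℂ :=
  sphericalSection Ω₁ Ω₂ s
    (lowerUnip (beta a b c) * Matrix.GeneralLinearGroup.map (algebraMap F (QuadL a b c)) h) * B h

/-- The space `T(F) \ GL₂(F)` of cosets `T(F) g`, with the quotient topology. -/
abbrev TorusQuot (a b c : 𝒪[F]) : Type _ := Quotient (QuotientGroup.rightRel (torus a b c))

/-- The right translation `T(F) h ↦ T(F) h g` of `T(F) \ GL₂(F)`. -/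
def quotTranslate (a b c : 𝒪[F]) (g : GL (Fin 2) F) : TorusQuot a b c → TorusQuot a b c :=
  Quotient.map (· * g) (by
    intro x y hxy
    have h : y * x⁻¹ ∈ torus a b c := QuotientGroup.rightRel_apply.mp hxy
    exact QuotientGroup.rightRel_apply.mpr (by simpa [mul_assoc] using h))

/-- A right `GL₂(F)`-invariant Borel measure on `T(F) \ GL₂(F)`, normalized such that
`T(F) \ T(F) K` has volume `1`. -/
structure IsNormalizedInvariant {a b c : 𝒪[F]} [MeasurableSpace (TorusQuot a b c)]
    (μ : Measure (TorusQuot a b c)) : Prop where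
  measurePreserving : ∀ g : GL (Fin 2) F, MeasurePreserving (quotTranslate a b c g) μ μ
  measure_image_K :
    μ ((fun k : GL (Fin 2) F => (Quotient.mk _ k : TorusQuot a b c)) ''
      (integralGL 𝒪[F] F : Set (GL (Fin 2) F))) = 1

/-- A function on `GL₂(F)` that is left invariant under the torus, viewed as a function on
`T(F) \ GL₂(F)` (evaluate it at any representative of the coset). -/
def onTorusQuot {a b c : 𝒪[F]} (Φ : GL (Fin 2) F → ℂ) (x : TorusQuot a b c) : ℂ := Φ x.out

/-- The local zeta integral `Z(s) = ∫_{T(F) \ GL₂(F)} f(η h, s) B(h) dh`. -/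
def zetaIntegral {a b c : 𝒪[F]} [MeasurableSpace (TorusQuot a b c)]
    (μ : Measure (TorusQuot a b c)) (Ω₁ Ω₂ : (QuadL a b c)ˣ →* ℂˣ) (B : GL (Fin 2) F → ℂ)
    (s : ℂ) : ℂ :=
  ∫ x, onTorusQuot (zetaFun Ω₁ Ω₂ B s) x ∂μ

/-! ### L-factors -/

/-- `χ(ϖ) ν(ϖ) q^{-s}`. -/
def satakeTerm (ϖ : Fˣ) (χ ν : Fˣ →* ℂˣ) (s : ℂ) : ℂ :=
  (χ ϖ : ℂ) * (ν ϖ : ℂ) * (resCard F : ℂ) ^ (-s)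

/-- `L(s, π × ν)` for `π = χ₁ × χ₂` and unramified `χ₁, χ₂, ν`. -/
def lFactorPi (ϖ : Fˣ) (χ₁ χ₂ ν : Fˣ →* ℂˣ) (s : ℂ) : ℂ :=
  (1 - satakeTerm ϖ χ₁ ν s)⁻¹ * (1 - satakeTerm ϖ χ₂ ν s)⁻¹

/-- `L(s, ν)` for an unramified character `ν` of `Lˣ`. If `L = F ⊕ F` then `ϖ_L = (ϖ, 1)` and
`star ϖ_L = (1, ϖ)`. -/
def lFactorL {a b c : 𝒪[F]} (ϖ : Fˣ) (ϖL : (QuadL a b c)ˣ) (ν : (QuadL a b c)ˣ →* ℂˣ)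
    (s : ℂ) : ℂ :=
  if splitSymbol a b c = -1 then
    (1 - (restrictF ν ϖ : ℂ) * (resCard F : ℂ) ^ (-(2 * s)))⁻¹
  else if splitSymbol a b c = 0 then
    (1 - (ν ϖL : ℂ) * (resCard F : ℂ) ^ (-s))⁻¹
  else
    (1 - (ν ϖL : ℂ) * (resCard F : ℂ) ^ (-s))⁻¹ * (1 - (ν (star ϖL) : ℂ) * (resCard F : ℂ) ^ (-s))⁻¹

end LocalField

end

end WaldspurgerZeta

namespace WaldspurgerZeta

noncomputable section
set_option linter.unusedSectionVars false

/-! ### Valuations, uniformizers and the absolute value of `F` -/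

section Valuation

variable {F : Type*} [Field F] [ValuativeRel F]

/-! Send a column (x, y) of F² to y + xβ in L. Then T(F) acts by multiplication, and the assumptions
on d make 𝔬² correspond to 𝔬_L (`Admissible.betaComb_mem_iff`). A coset gK becomes the lattice
spanned by the columns of g, and every lattice in L is t(𝔬 + ϖᵐ𝔬_L) for exactly one m ≥ 0. Hence
GL₂(F) is the disjoint union of the double cosets T(F) diag(ϖᵐ, 1) K
(`exists_torus_mul_diagPow_mul`, `diagPow_index_unique`), and the theorem becomes a statement about
sequences indexed by the level m.

Put b_m = B(diag(ϖᵐ, 1)), ω = Ω(ϖ) and λ = √q(χ₁(ϖ) + χ₂(ϖ)), the eigenvalue of the Hecke operator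
of K diag(ϖ, 1) K on spherical vectors. Sorting the q + 1 neighbours of a lattice by level gives q
b_{m+2} + ω b_m = λ b_{m+1} (`heckeSum_diagPow_succ`) and N b_1 + σ b_0 = λ b_0
(`exists_heckeSum_one`). Here N = q + 1 - r, where r = 0, 1, 2 in the inert, ramified and split
cases counts the neighbours p𝔬_L of 𝔬_L that have level 0 again, and σ is the sum of the Ω(p). So B
is determined by B(1), which yields existence and uniqueness of B₀.

The same count, applied to indicator functions of levels, gives the volumes: adjacency is symmetric
for the invariant measure (`measure_balance`), so v_0 = 1 and v_m = N q^{m-1} for m ≥ 1.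

Since η makes the torus upper triangular with diagonal (z̄, z), the integrand is T(F)-invariant; on
level m it equals Xᵐ b_m with X = Ω₁(ϖ) q^{-(2s+1)} (`zetaFun_eq_level`). Thus Z(s) = ∑ v_m Xᵐ b_m.
From m = 1 on, the terms obey a recurrence with characteristic roots γ_i = √q χ_i(ϖ) X, the Satake
terms at 2s + 1/2. Summing it gives (1 - γ₁)(1 - γ₂) Z(s) = 1 - σX + (r - 1)ωX², and the right side
is 1/L(2s + 1, Ω₁/Ω₂) in each of the three cases (`inv_lFactorL_eq`). -/

theorem isUnit_integer_iff {x : 𝒪[F]} : IsUnit x ↔ valuation F (x : F) = 1 :=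
  (Valuation.integer.integers (valuation F)).isUnit_iff_valuation_eq_one

theorem val_natCast_le_one (n : ℕ) : valuation F (n : F) ≤ 1 :=
  (n : 𝒪[F]).2

theorem val_mul_le_one {x y : F} (hx : valuation F x ≤ 1) (hy : valuation F y ≤ 1) :
    valuation F (x * y) ≤ 1 := by
  rw [map_mul]; exact mul_le_one' hx hy

theorem val_pow_le_one {x : F} (hx : valuation F x ≤ 1) {n : ℕ} : valuation F (x ^ n) ≤ 1 := by
  rw [map_pow]; exact pow_le_one' hx n

theorem val_add_le_one {x y : F} (hx : valuation F x ≤ 1) (hy : valuation F y ≤ 1) :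
    valuation F (x + y) ≤ 1 := (valuation F).map_add_le hx hy

theorem val_sub_le_one {x y : F} (hx : valuation F x ≤ 1) (hy : valuation F y ≤ 1) :
    valuation F (x - y) ≤ 1 := (valuation F).map_sub_le hx hy

theorem val_le_one_of_sq {x : F} (hx : valuation F (x ^ 2) ≤ 1) : valuation F x ≤ 1 := by
  rw [map_pow] at hx
  exact (pow_le_one_iff (by norm_num)).mp hx

/-- Two elements of equal valuation differ by a unit of the ring of integers. -/
theorem map_eq_of_val_eq {χ : Fˣ →* ℂˣ} (hχ : IsUnramified 𝒪[F] χ) {x y : Fˣ}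
    (h : valuation F (x : F) = valuation F (y : F)) : χ x = χ y := by
  have hv : valuation F ((x / y : Fˣ) : F) = 1 := by
    rw [Units.val_div_eq_div_val, map_div₀, h, div_self]
    exact (valuation F).ne_zero_iff.mpr y.ne_zero
  have hu : IsUnit (⟨((x / y : Fˣ) : F), hv.le⟩ : 𝒪[F]) := isUnit_integer_iff.mpr hv
  have := hχ hu.unit
  have h2 : Units.map (algebraMap 𝒪[F] F : 𝒪[F] →* F) hu.unit = x / y := Units.ext rfl
  rw [h2, map_div, div_eq_one] at this
  exact this

variable [TopologicalSpace F] [IsNonarchimedeanLocalField F]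

theorem IsUniformizer.val_lt_one {ϖ : Fˣ} (hϖ : IsUniformizer 𝒪[F] ϖ) :
    valuation F (ϖ : F) < 1 := by
  obtain ⟨p, hp, hpe⟩ := hϖ
  have h1 : valuation F (p : F) ≤ 1 := p.2
  have h2 : valuation F (p : F) ≠ 1 := fun h => hp.not_isUnit (isUnit_integer_iff.mpr h)
  have : (ϖ : F) = p := hpe.symm
  rw [this]
  exact lt_of_le_of_ne h1 h2

theorem IsUniformizer.val_le_iff {ϖ : Fˣ} (hϖ : IsUniformizer 𝒪[F] ϖ) {x : F} :
    valuation F x ≤ valuation F (ϖ : F) ↔ valuation F x < 1 := by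
  refine ⟨fun h => h.trans_lt hϖ.val_lt_one, fun h => ?_⟩
  obtain ⟨p, hp, hpe⟩ := hϖ
  have hx : (⟨x, h.le⟩ : 𝒪[F]) ∈ IsLocalRing.maximalIdeal 𝒪[F] := by
    rw [IsLocalRing.mem_maximalIdeal, mem_nonunits_iff, isUnit_integer_iff]
    exact h.ne
  rw [hp.maximalIdeal_eq, Ideal.mem_span_singleton] at hx
  obtain ⟨y, hy⟩ := hx
  have : x = (p : F) * y := congrArg Subtype.val hy
  have e : (ϖ : F) = p := hpe.symm
  rw [this, e, map_mul]
  exact mul_le_of_le_one_right' y.2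

theorem IsUniformizer.div_val_le_one {ϖ : Fˣ} (hϖ : IsUniformizer 𝒪[F] ϖ) {x : F}
    (hx : valuation F x < 1) : valuation F (x / ϖ) ≤ 1 := by
  rw [map_div₀]
  exact div_le_one_of_le₀ (hϖ.val_le_iff.mpr hx) zero_le

theorem IsUniformizer.exists_pow {ϖ : Fˣ} (hϖ : IsUniformizer 𝒪[F] ϖ) {x : F}
    (hx : valuation F x ≤ 1) (h0 : x ≠ 0) :
    ∃ (n : ℕ) (u : F), valuation F u = 1 ∧ x = (ϖ : F) ^ n * u := by
  obtain ⟨p, hp, hpe⟩ := hϖ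
  have h0' : (⟨x, hx⟩ : 𝒪[F]) ≠ 0 := fun h => h0 (congrArg Subtype.val h)
  obtain ⟨n, u, hu⟩ := IsDiscreteValuationRing.eq_unit_mul_pow_irreducible h0' hp
  refine ⟨n, ((u : 𝒪[F]) : F), isUnit_integer_iff.mp u.isUnit, ?_⟩
  have : x = ((u : 𝒪[F]) : F) * (p : F) ^ n := congrArg Subtype.val hu
  rw [this, mul_comm]
  congr 2

theorem resCard_pos : 0 < resCard F := Nat.card_pos

theorem one_lt_resCard : 1 < resCard F := Finite.one_lt_card

theorem absF_eq_of_val_eq {x y : F} (h : valuation F x = valuation F y) : absF x = absF y := by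
  have : x = 0 ↔ y = 0 := by
    rw [← (valuation F).zero_iff (x := x), h, (valuation F).zero_iff]
  rw [absF, absF, h]
  by_cases hx : x = 0
  · rw [if_pos hx, if_pos (this.mp hx)]
  · rw [if_neg hx, if_neg (mt this.mpr hx)]

theorem absF_one : absF (1 : F) = 1 := by simp [absF]

theorem absF_nonneg (x : F) : 0 ≤ absF x := by
  rw [absF]; split_ifs <;> positivity

theorem absF_pos {x : F} (hx : x ≠ 0) : 0 < absF x := by
  rw [absF, if_neg hx]
  have := resCard_pos (F := F)
  positivity

/-- A uniformizer has the largest valuation below 1, and the order isomorphism onto the integers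
must send that element to `exp (-1)`. -/
theorem IsUniformizer.absF_eq {ϖ : Fˣ} (hϖ : IsUniformizer 𝒪[F] ϖ) :
    absF (ϖ : F) = (resCard F : ℝ)⁻¹ := by
  set e := IsNonarchimedeanLocalField.valueGroupWithZeroIsoInt F with he
  have key : e (valuation F (ϖ : F)) = WithZero.exp (-1) := by
    apply le_antisymm
    · have h1 : e (valuation F (ϖ : F)) < 1 := by
        rw [← map_one e]
        exact e.strictMono hϖ.val_lt_one
      have h0 : e (valuation F (ϖ : F)) ≠ 0 := by simp
      rw [← WithZero.exp_log h0, ← WithZero.exp_zero, WithZero.exp_lt_exp] at h1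
      rw [← WithZero.exp_log h0, WithZero.exp_le_exp]
      omega
    · obtain ⟨x, hx⟩ := ValuativeRel.valuation_surjective (e.symm (WithZero.exp (-1)))
      have h1 : valuation F x < 1 := by
        rw [hx, ← map_one e.symm]
        apply e.symm.strictMono
        rw [← WithZero.exp_zero, WithZero.exp_lt_exp]; omega
      have h2 := hϖ.val_le_iff.mpr h1
      rw [hx] at h2
      have h3 := e.strictMono.monotone h2
      simpa using h3
  rw [absF, if_neg ϖ.ne_zero, ← he, key, WithZero.log_exp]
  simp

end Valuation

/-! ### Integers of L in the basis 1, β -/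

section Quadratic

variable {F : Type*} [Field F] [ValuativeRel F] [TopologicalSpace F] [IsNonarchimedeanLocalField F]
  {a b c : 𝒪[F]}

theorem Admissible.val_c (h : Admissible a b c) : valuation F (c : F) = 1 :=
  isUnit_integer_iff.mp h.isUnit_c

theorem Admissible.c_ne_zero (h : Admissible a b c) : (c : F) ≠ 0 := by
  intro h0
  have := h.val_c
  simp [h0] at this

theorem Admissible.disc_ne_zero (h : Admissible a b c) : (disc a b c : F) ≠ 0 := by
  intro h0
  have := isUnit_integer_iff.mp (h.isUnit_of_split ⟨0, by simp [h0]⟩)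
  simp [h0] at this

theorem trace_eq (z : QuadL a b c) : QuadraticAlgebra.trace z = 2 * z.re := by
  simp [QuadraticAlgebra.trace_def]

theorem norm_eq (z : QuadL a b c) :
    QuadraticAlgebra.norm z = z.re ^ 2 - (disc a b c : F) * z.im ^ 2 := by
  rw [QuadraticAlgebra.norm_def]; ring

theorem star_mem_intL {z : QuadL a b c} (hz : z ∈ intL a b c) : star z ∈ intL a b c := by
  let σ : QuadL a b c →ₐ[𝒪[F]] QuadL a b c :=
    { starRingEnd (QuadL a b c) with
      commutes' := fun r => by
        change star (algebraMap 𝒪[F] (QuadL a b c) r) = _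
        rw [IsScalarTower.algebraMap_apply 𝒪[F] F (QuadL a b c)]
        ext <;> simp }
  exact IsIntegral.map σ hz

theorem val_le_one_of_algebraMap_mem_intL {x : F}
    (hx : algebraMap F (QuadL a b c) x ∈ intL a b c) : valuation F x ≤ 1 := by
  have h : IsIntegral 𝒪[F] (algebraMap F (QuadL a b c) x) := hx
  rw [isIntegral_algebraMap_iff QuadraticAlgebra.algebraMap_injective] at h
  obtain ⟨n, hn⟩ := IsIntegrallyClosed.isIntegral_iff.mp h
  rw [← hn]
  exact n.2

theorem algebraMap_mem_intL {x : F} (hx : valuation F x ≤ 1) :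
    algebraMap F (QuadL a b c) x ∈ intL a b c :=
  (intL a b c).algebraMap_mem (⟨x, hx⟩ : 𝒪[F])

/-- An element of `L` is integral if and only if its norm and its trace are. -/
theorem mem_intL_iff {z : QuadL a b c} :
    z ∈ intL a b c ↔ valuation F (QuadraticAlgebra.norm z) ≤ 1 ∧
      valuation F (QuadraticAlgebra.trace z) ≤ 1 := by
  constructor
  · intro hz
    obtain ⟨n, hn⟩ := isIntegral_norm hz
    refine ⟨hn ▸ n.2, val_le_one_of_algebraMap_mem_intL (a := a) (b := b) (c := c) ?_⟩
    rw [QuadraticAlgebra.algebraMap_trace_eq_add_star]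
    exact add_mem hz (star_mem_intL hz)
  · rintro ⟨hn, ht⟩
    refine ⟨Polynomial.X ^ 2 - (Polynomial.C (⟨_, ht⟩ : 𝒪[F]) * Polynomial.X
      - Polynomial.C (⟨_, hn⟩ : 𝒪[F])), ?_, ?_⟩
    · refine Polynomial.monic_X_pow_sub (n := 2) ?_
      refine (Polynomial.degree_sub_le _ _).trans_lt (max_lt ?_ ?_)
      · exact (Polynomial.degree_C_mul_X_le _).trans_lt (by norm_num)
      · exact Polynomial.degree_C_le.trans_lt (by norm_num)
    · simp only [Polynomial.eval₂_sub, Polynomial.eval₂_pow, Polynomial.eval₂_X,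
        Polynomial.eval₂_mul, Polynomial.eval₂_C]
      have h := QuadraticAlgebra.sq_sub_trace_smul_add_norm_eq_zero (z := z)
      rw [IsScalarTower.algebraMap_apply 𝒪[F] F (QuadL a b c),
        IsScalarTower.algebraMap_apply 𝒪[F] F (QuadL a b c)]
      rw [Algebra.smul_def] at h
      rw [← h]
      change _ - (algebraMap F _ (QuadraticAlgebra.trace z) * z
        - algebraMap F _ (QuadraticAlgebra.norm z)) = _
      ring

/-- The inverse is z̄ / N(z), which is integral because z̄ is and N(z) is a unit of 𝔬. -/
theorem isUnit_intL_of_norm {z : QuadL a b c} (hz : z ∈ intL a b c)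
    (hn : valuation F (QuadraticAlgebra.norm z) = 1) : IsUnit (⟨z, hz⟩ : intL a b c) := by
  have hN : QuadraticAlgebra.norm z ≠ 0 := by
    intro h0; simp [h0] at hn
  have hmem : algebraMap F _ (QuadraticAlgebra.norm z)⁻¹ * star z ∈ intL a b c :=
    mul_mem (algebraMap_mem_intL (by rw [map_inv₀, hn, inv_one])) (star_mem_intL hz)
  refine IsUnit.of_mul_eq_one ⟨_, hmem⟩ (Subtype.ext ?_)
  change z * (algebraMap F _ (QuadraticAlgebra.norm z)⁻¹ * star z) = 1
  rw [mul_left_comm, ← QuadraticAlgebra.algebraMap_norm_eq_mul_star, ← map_mul,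
    inv_mul_cancel₀ hN, map_one]

theorem val_norm_unit (u : (intL a b c)ˣ) :
    valuation F (QuadraticAlgebra.norm ((u : intL a b c) : QuadL a b c)) = 1 := by
  have hm : QuadraticAlgebra.norm ((u : intL a b c) : QuadL a b c) *
      QuadraticAlgebra.norm (((u⁻¹ : (intL a b c)ˣ) : intL a b c) : QuadL a b c) = 1 := by
    rw [← map_mul, ← MulMemClass.coe_mul, Units.mul_inv, OneMemClass.coe_one, map_one]
  have h1 := (mem_intL_iff.mp (u : intL a b c).2).1
  have h2 := (mem_intL_iff.mp ((u⁻¹ : (intL a b c)ˣ) : intL a b c).2).1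
  have h3 := congrArg (valuation F) hm
  rw [map_mul, map_one] at h3
  refine le_antisymm h1 ?_
  rw [← h3]
  exact mul_le_of_le_one_right' h2

/-- An unramified character is trivial on integral elements whose norm is a unit. -/
theorem map_eq_one_of_norm {Ω : (QuadL a b c)ˣ →* ℂˣ} (hΩ : IsUnramified (intL a b c) Ω)
    {z : (QuadL a b c)ˣ} (hz : (z : QuadL a b c) ∈ intL a b c)
    (hn : valuation F (QuadraticAlgebra.norm (z : QuadL a b c)) = 1) : Ω z = 1 := by
  have hu := isUnit_intL_of_norm hz hn
  have h2 : Units.map (algebraMap (intL a b c) (QuadL a b c) : intL a b c →* QuadL a b c) hu.unit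
      = z := Units.ext rfl
  rw [← h2]
  exact hΩ hu.unit

theorem restrictF_isUnramified {Ω : (QuadL a b c)ˣ →* ℂˣ} (hΩ : IsUnramified (intL a b c) Ω) :
    IsUnramified 𝒪[F] (restrictF Ω) := by
  intro u
  have hu := isUnit_integer_iff.mp u.isUnit
  refine map_eq_one_of_norm hΩ ?_ ?_
  · exact (intL a b c).algebraMap_mem (u : 𝒪[F])
  · change valuation F (QuadraticAlgebra.norm (algebraMap F (QuadL a b c) (u : 𝒪[F]))) = 1
    rw [QuadraticAlgebra.norm_algebraMap, map_pow, hu, one_pow]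

theorem charOmega_isUnramified {Ω₁ Ω₂ : (QuadL a b c)ˣ →* ℂˣ}
    (h₁ : IsUnramified (intL a b c) Ω₁) (h₂ : IsUnramified (intL a b c) Ω₂) :
    IsUnramified (intL a b c) (charOmega Ω₁ Ω₂) := by
  intro u
  have key : Ω₁ (Units.map (starRingEnd (QuadL a b c) : QuadL a b c →* QuadL a b c)
      (Units.map (algebraMap (intL a b c) (QuadL a b c) : intL a b c →* QuadL a b c) u)) = 1 := by
    refine map_eq_one_of_norm h₁ (star_mem_intL (u : intL a b c).2) ?_
    change valuation F (QuadraticAlgebra.norm (star ((u : intL a b c) : QuadL a b c))) = 1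
    rw [QuadraticAlgebra.norm_star, val_norm_unit]
  rw [charOmega, MonoidHom.mul_apply, MonoidHom.inv_apply, MonoidHom.inv_apply,
    MonoidHom.comp_apply, key, h₂ u]
  simp

variable [CharZero F]

/-- `x + y β`. -/
def betaComb (a b c : 𝒪[F]) (x y : F) : QuadL a b c :=
  ⟨x + y * ((b : F) / (2 * (c : F))), y / (2 * (c : F))⟩

theorem betaComb_eq (x y : F) : betaComb a b c x y =
    algebraMap F _ x + algebraMap F _ y * beta a b c := by
  ext <;> simp [betaComb, beta]; ring

theorem exists_betaComb (hc : (c : F) ≠ 0) (z : QuadL a b c) :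
    ∃ x y : F, z = betaComb a b c x y := by
  refine ⟨z.re - z.im * b, 2 * c * z.im, ?_⟩
  ext <;> simp [betaComb] <;> field_simp
  ring

theorem norm_betaComb (hc : (c : F) ≠ 0) (x y : F) :
    QuadraticAlgebra.norm (betaComb a b c x y) = (c * x ^ 2 + b * x * y + a * y ^ 2) / c := by
  rw [norm_eq, betaComb, coe_disc]
  field_simp
  ring

theorem trace_betaComb (hc : (c : F) ≠ 0) (x y : F) :
    QuadraticAlgebra.trace (betaComb a b c x y) = 2 * x + b / c * y := by
  rw [trace_eq, betaComb]
  field_simp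

theorem betaComb_injective (hc : (c : F) ≠ 0) {x y x' y' : F}
    (h : betaComb a b c x y = betaComb a b c x' y') : x = x' ∧ y = y' := by
  have h2 := congrArg QuadraticAlgebra.im h
  have h1 := congrArg QuadraticAlgebra.re h
  simp only [betaComb] at h1 h2
  have hy : y = y' := by field_simp at h2; exact h2
  subst hy
  exact ⟨add_right_cancel h1, rfl⟩

theorem Admissible.val_div_c (h : Admissible a b c) {x : F} (hx : valuation F x ≤ 1) :
    valuation F (x / c) ≤ 1 := by
  rw [map_div₀, h.val_c, div_one]; exact hx

theorem Admissible.betaComb_mem (h : Admissible a b c) {x y : F} (hx : valuation F x ≤ 1)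
    (hy : valuation F y ≤ 1) : betaComb a b c x y ∈ intL a b c := by
  rw [mem_intL_iff, norm_betaComb h.c_ne_zero, trace_betaComb h.c_ne_zero]
  constructor
  · refine h.val_div_c (val_add_le_one (val_add_le_one (val_mul_le_one c.2 (val_pow_le_one hx))
      (val_mul_le_one (val_mul_le_one b.2 hx) hy)) (val_mul_le_one a.2 (val_pow_le_one hy)))
  · exact val_add_le_one (val_mul_le_one (by exact_mod_cast val_natCast_le_one (F := F) 2) hx)
      (val_mul_le_one (h.val_div_c b.2) hy)

theorem algebra_trace_eq (z : QuadL a b c) :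
    Algebra.trace F (QuadL a b c) z = 2 * z.re := by
  rw [Algebra.trace_eq_matrix_trace (QuadraticAlgebra.basis _ _), Matrix.trace_fin_two,
    Algebra.leftMulMatrix_eq_repr_mul, Algebra.leftMulMatrix_eq_repr_mul]
  have h0 : QuadraticAlgebra.basis (disc a b c : F) 0 0 = ⟨1, 0⟩ := by
    apply (QuadraticAlgebra.basis (disc a b c : F) 0).repr.injective
    ext i
    fin_cases i <;> simp [QuadraticAlgebra.basis_repr_apply]
  have h1 : QuadraticAlgebra.basis (disc a b c : F) 0 1 = ⟨0, 1⟩ := by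
    apply (QuadraticAlgebra.basis (disc a b c : F) 0).repr.injective
    ext i
    fin_cases i <;> simp [QuadraticAlgebra.basis_repr_apply]
  rw [h0, h1]
  simp [QuadraticAlgebra.basis_repr_apply]
  ring

theorem discr_one_pair (z : QuadL a b c) :
    Algebra.discr F ![1, z] = 4 * z.im ^ 2 * (disc a b c : F) := by
  rw [Algebra.discr_def, Matrix.det_fin_two]
  simp only [Algebra.traceMatrix_apply, Algebra.traceForm_apply, algebra_trace_eq]
  simp [QuadraticAlgebra.re_one]
  ring

/-- Integrality of N(z - z̄) bounds 4 im(z)² d. In the split case d is a unit and can be cancelled.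
In the field case 4 im(z)² d is the discriminant of the pair (1, z), hence a multiple of the
generator d of the discriminant ideal. This is how the hypothesis on d forces 𝔬_L to be no larger
than 𝔬 + 𝔬β. -/
theorem Admissible.val_sq_im (h : Admissible a b c) {z : QuadL a b c} (hz : z ∈ intL a b c) :
    valuation F (4 * z.im ^ 2) ≤ 1 := by
  by_cases hs : IsSquare (disc a b c : F)
  · have h1 := isUnit_integer_iff.mp (h.isUnit_of_split hs)
    have h2 : valuation F (QuadraticAlgebra.norm (z - star z)) ≤ 1 :=
      (mem_intL_iff.mp (sub_mem hz (star_mem_intL hz))).1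
    have h3 : QuadraticAlgebra.norm (z - star z) = -(4 * z.im ^ 2) * (disc a b c : F) := by
      rw [norm_eq]
      simp only [QuadraticAlgebra.re_sub, QuadraticAlgebra.im_sub, QuadraticAlgebra.re_star,
        QuadraticAlgebra.im_star]
      ring
    rw [h3, map_mul, h1, mul_one, Valuation.map_neg] at h2
    exact h2
  · have hd : valuation F (Algebra.discr F ![(1 : QuadL a b c), z]) ≤ 1 := by
      rw [discr_one_pair]
      have h2 : valuation F (QuadraticAlgebra.norm (z - star z)) ≤ 1 :=
        (mem_intL_iff.mp (sub_mem hz (star_mem_intL hz))).1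
      have h3 : QuadraticAlgebra.norm (z - star z) = -(4 * z.im ^ 2 * (disc a b c : F)) := by
        rw [norm_eq]
        simp only [QuadraticAlgebra.re_sub, QuadraticAlgebra.im_sub, QuadraticAlgebra.re_star,
          QuadraticAlgebra.im_star]
        ring
      rw [h3, Valuation.map_neg] at h2
      exact h2
    have hmem : (⟨_, hd⟩ : 𝒪[F]) ∈ discrIdeal a b c := by
      refine Ideal.subset_span ⟨![1, ⟨z, hz⟩], ?_⟩
      change Algebra.discr F ![(1 : QuadL a b c), z] = _
      congr 1
      ext i : 1
      fin_cases i <;> rfl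
    rw [h.discr_of_field hs, Ideal.mem_span_singleton] at hmem
    obtain ⟨r, hr⟩ := hmem
    have hr' : Algebra.discr F ![(1 : QuadL a b c), z] = (disc a b c : F) * r :=
      congrArg Subtype.val hr
    rw [discr_one_pair, mul_comm] at hr'
    rw [mul_left_cancel₀ h.disc_ne_zero hr']
    exact r.2

/-- The ring of integers of `L` is `𝒪 + 𝒪 β`. -/
theorem Admissible.betaComb_mem_iff (h : Admissible a b c) {x y : F} :
    betaComb a b c x y ∈ intL a b c ↔ valuation F x ≤ 1 ∧ valuation F y ≤ 1 := by
  refine ⟨fun hz => ?_, fun hxy => h.betaComb_mem hxy.1 hxy.2⟩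
  have hy : valuation F y ≤ 1 := by
    apply val_le_one_of_sq
    have h1 := h.val_sq_im hz
    have h2 : 4 * (betaComb a b c x y).im ^ 2 = (y / c) ^ 2 := by
      have := h.c_ne_zero
      rw [betaComb]; field_simp; ring
    rw [h2, map_pow, map_div₀, h.val_c, div_one] at h1
    rwa [map_pow]
  refine ⟨?_, hy⟩
  have h2 : algebraMap F (QuadL a b c) x = betaComb a b c x y - betaComb a b c 0 y := by
    ext <;> simp [betaComb]
  apply val_le_one_of_algebraMap_mem_intL (a := a) (b := b) (c := c)
  rw [h2]
  exact sub_mem hz (h.betaComb_mem (by simp) hy)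

end Quadratic

/-! ### Double cosets of the torus and GL₂(𝔬): lattices in L -/

section Decomposition

variable {F : Type*} [Field F] [ValuativeRel F] [TopologicalSpace F] [IsNonarchimedeanLocalField F]

/-- The invertible matrix `[p, q; r, s]`. -/
def mkGL {R : Type*} [Field R] (p q r s : R) (h : p * s - q * r ≠ 0) : GL (Fin 2) R :=
  Matrix.GeneralLinearGroup.mkOfDetNeZero !![p, q; r, s] (by rwa [Matrix.det_fin_two_of])

theorem det_coe_ne_zero {R : Type*} [Field R] (g : GL (Fin 2) R) :
    g 0 0 * g 1 1 - g 0 1 * g 1 0 ≠ 0 := by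
  rw [← Matrix.det_fin_two]
  exact ((Matrix.isUnit_iff_isUnit_det _).mp g.isUnit).ne_zero

theorem mkGL_coe {R : Type*} [Field R] (p q r s : R) (h : p * s - q * r ≠ 0) :
    (mkGL p q r s h : Matrix (Fin 2) (Fin 2) R) = !![p, q; r, s] := rfl

theorem upperTri_coe {R : Type*} [CommRing R] (u : Rˣ) (v : R) (w : Rˣ) :
    (upperTri u v w : Matrix (Fin 2) (Fin 2) R) = !![(u : R), v; 0, (w : R)] := rfl

theorem GL_ext {R : Type*} [CommRing R] {g h : GL (Fin 2) R} (h00 : g 0 0 = h 0 0)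
    (h01 : g 0 1 = h 0 1) (h10 : g 1 0 = h 1 0) (h11 : g 1 1 = h 1 1) : g = h := by
  apply Units.ext
  ext i j
  fin_cases i <;> fin_cases j <;> assumption

theorem GL_mul_apply {R : Type*} [CommRing R] (g h : GL (Fin 2) R) (i j : Fin 2) :
    (g * h) i j = g i 0 * h 0 j + g i 1 * h 1 j := by
  rw [Units.val_mul, Matrix.mul_apply, Fin.sum_univ_two]

/-- `GL₂(𝒪)` consists of the integral matrices whose determinant is a unit. -/
theorem mem_integralGL_iff {k : GL (Fin 2) F} : k ∈ integralGL 𝒪[F] F ↔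
    (∀ i j, valuation F (k i j) ≤ 1) ∧ valuation F (k 0 0 * k 1 1 - k 0 1 * k 1 0) = 1 := by
  constructor
  · rintro ⟨κ, rfl⟩
    refine ⟨fun i j => (κ i j).2, ?_⟩
    have h := isUnit_integer_iff.mp ((Matrix.isUnit_iff_isUnit_det _).mp κ.isUnit)
    rw [Matrix.det_fin_two] at h
    exact h
  · rintro ⟨h1, h2⟩
    let A : Matrix (Fin 2) (Fin 2) 𝒪[F] := fun i j => ⟨k i j, h1 i j⟩
    have hA : IsUnit A.det := by
      rw [isUnit_integer_iff, Matrix.det_fin_two]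
      exact h2
    refine ⟨Matrix.GeneralLinearGroup.mk'' A hA, ?_⟩
    exact GL_ext rfl rfl rfl rfl

theorem mkGL_mem_integralGL {p q r s : F} {h : p * s - q * r ≠ 0} (hp : valuation F p ≤ 1)
    (hq : valuation F q ≤ 1) (hr : valuation F r ≤ 1) (hs : valuation F s ≤ 1)
    (hd : valuation F (p * s - q * r) = 1) : mkGL p q r s h ∈ integralGL 𝒪[F] F := by
  rw [mem_integralGL_iff]
  refine ⟨fun i j => ?_, hd⟩
  fin_cases i <;> fin_cases j <;> assumption

theorem isUnit_of_norm_ne_zero {a b c : 𝒪[F]} {z : QuadL a b c}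
    (h : QuadraticAlgebra.norm z ≠ 0) : IsUnit z :=
  QuadraticAlgebra.isUnit_iff_norm_isUnit.mpr h.isUnit

theorem norm_unit_ne_zero {a b c : 𝒪[F]} (z : (QuadL a b c)ˣ) :
    QuadraticAlgebra.norm (z : QuadL a b c) ≠ 0 :=
  (QuadraticAlgebra.isUnit_iff_norm_isUnit.mp z.isUnit).ne_zero

variable [CharZero F]

/-- The image of the `j`-th column of `g` under the identification `(x, y) ↦ y + x β` of `F²`
with `L`, which is equivariant for the torus. -/
def colL (a b c : 𝒪[F]) (g : GL (Fin 2) F) (j : Fin 2) : QuadL a b c :=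
  betaComb a b c (g 1 j) (g 0 j)

/-- The matrix `diag(ϖ ^ m, 1)`. -/
def diagPow (ϖ : Fˣ) (m : ℕ) : GL (Fin 2) F := upperTri (ϖ ^ m) 0 1

theorem diagPow_zero (ϖ : Fˣ) : diagPow ϖ 0 = 1 := by
  apply GL_ext <;> simp [diagPow, upperTri_coe]

variable {a b c : 𝒪[F]}

theorem colL_torus (hc : (c : F) ≠ 0) (z : (QuadL a b c)ˣ) (g : GL (Fin 2) F) (j : Fin 2) :
    colL a b c (torusHom a b c z * g) j = z * colL a b c g j := by
  simp only [colL, GL_mul_apply, torusHom_val]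
  ext
  · simp only [QuadraticAlgebra.re_mul, betaComb, matXi]
    simp [-AddSubgroupClass.coe_sub]
    field_simp
    linear_combination -g 0 j * (z : QuadL a b c).im * coe_disc a b c
  · simp only [QuadraticAlgebra.im_mul, betaComb, matXi]
    simp
    field_simp
    ring

theorem colL_mul (g k : GL (Fin 2) F) (j : Fin 2) :
    colL a b c (g * k) j = algebraMap F _ (k 0 j) * colL a b c g 0
      + algebraMap F _ (k 1 j) * colL a b c g 1 := by
  simp only [colL, GL_mul_apply, betaComb_eq]
  simp only [map_add, map_mul]
  ring

theorem colL_injective (hc : (c : F) ≠ 0) {g h : GL (Fin 2) F}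
    (h0 : colL a b c g 0 = colL a b c h 0) (h1 : colL a b c g 1 = colL a b c h 1) : g = h := by
  obtain ⟨e1, e2⟩ := betaComb_injective hc h0
  obtain ⟨e3, e4⟩ := betaComb_injective hc h1
  exact GL_ext e2 e4 e1 e3

theorem norm_add_smul (z w : QuadL a b c) (x y : F) :
    QuadraticAlgebra.norm (algebraMap F _ x * z + algebraMap F _ y * w)
      = x ^ 2 * QuadraticAlgebra.norm z + x * y * QuadraticAlgebra.trace (z * star w)
        + y ^ 2 * QuadraticAlgebra.norm w := by
  simp only [norm_eq, trace_eq, QuadraticAlgebra.re_add, QuadraticAlgebra.im_add,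
    QuadraticAlgebra.re_mul, QuadraticAlgebra.im_mul, QuadraticAlgebra.re_star,
    QuadraticAlgebra.im_star, QuadraticAlgebra.algebraMap_re, QuadraticAlgebra.algebraMap_im]
  ring

/-- The form (x, y) ↦ N(x z₀ + y z₁) in the columns z₀, z₁ of g is the norm form after the change of
variables g, so its discriminant picks up det(g)². In particular it does not vanish. -/
theorem trace_sq_sub_norm (hc : (c : F) ≠ 0) (g : GL (Fin 2) F) :
    QuadraticAlgebra.trace (colL a b c g 0 * star (colL a b c g 1)) ^ 2
      - 4 * QuadraticAlgebra.norm (colL a b c g 0) * QuadraticAlgebra.norm (colL a b c g 1)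
    = (g 0 0 * g 1 1 - g 0 1 * g 1 0) ^ 2 * (disc a b c : F) / c ^ 2 := by
  simp only [norm_eq, trace_eq, colL, betaComb, QuadraticAlgebra.re_mul, QuadraticAlgebra.re_star,
    QuadraticAlgebra.im_star]
  field_simp
  ring

/-- Divide both columns z₀, z₁ by t = z₁. The hypotheses say that z₀/z₁ has integral norm and trace,
so it equals y + xβ with x, y ∈ 𝔬. Writing x = ϖᵐu, the columns ϖᵐuβ + y and 1 are those of diag(ϖᵐ,
1)·[u, 0; y, 1]. -/
theorem exists_torus_mul_of_dominant (habc : Admissible a b c) {ϖ : Fˣ}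
    (hϖ : IsUniformizer 𝒪[F] ϖ) (g : GL (Fin 2) F)
    (hC : QuadraticAlgebra.norm (colL a b c g 1) ≠ 0)
    (hA : valuation F (QuadraticAlgebra.norm (colL a b c g 0))
      ≤ valuation F (QuadraticAlgebra.norm (colL a b c g 1)))
    (hB : valuation F (QuadraticAlgebra.trace (colL a b c g 0 * star (colL a b c g 1)))
      ≤ valuation F (QuadraticAlgebra.norm (colL a b c g 1))) :
    ∃ (t : (QuadL a b c)ˣ) (m : ℕ), (t : QuadL a b c) = colL a b c g 1 ∧
      ∃ k ∈ integralGL 𝒪[F] F, g = torusHom a b c t * diagPow ϖ m * k := by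
  have hc := habc.c_ne_zero
  obtain ⟨t, ht⟩ := isUnit_of_norm_ne_zero hC
  have hv : valuation F (QuadraticAlgebra.norm (colL a b c g 1)) ≠ 0 :=
    (valuation F).ne_zero_iff.mpr hC
  obtain ⟨y, x, hyx⟩ := exists_betaComb hc (((t⁻¹ : (QuadL a b c)ˣ) : QuadL a b c) * colL a b c g 0)
  have h0 : colL a b c g 0 = t * betaComb a b c y x := by
    rw [← hyx, Units.mul_inv_cancel_left]
  have hint : betaComb a b c y x ∈ intL a b c := by
    rw [mem_intL_iff]
    constructor
    · rw [h0, map_mul, ← ht, map_mul] at hA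
      rw [← ht] at hv
      exact le_of_mul_le_mul_left (by rwa [mul_one]) (zero_lt_iff.mpr hv)
    · have : QuadraticAlgebra.trace (colL a b c g 0 * star (colL a b c g 1))
          = QuadraticAlgebra.norm (colL a b c g 1)
            * QuadraticAlgebra.trace (betaComb a b c y x) := by
        rw [h0, ← ht]
        simp only [norm_eq, trace_eq, QuadraticAlgebra.re_mul, QuadraticAlgebra.im_mul,
          QuadraticAlgebra.re_star, QuadraticAlgebra.im_star]
        ring
      rw [this, map_mul] at hB
      exact le_of_mul_le_mul_left (by rwa [mul_one]) (zero_lt_iff.mpr hv)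
  obtain ⟨hy, hx⟩ := habc.betaComb_mem_iff.mp hint
  -- If x = 0 the two columns are proportional over F, and the discriminant of the form they define
  -- is zero.
  have hx0 : x ≠ 0 := by
    rintro rfl
    have h1 := trace_sq_sub_norm (a := a) (b := b) hc g
    have h2 : colL a b c g 0 = algebraMap F _ y * t := by
      rw [h0, betaComb_eq]; simp [mul_comm]
    rw [h2, ← ht] at h1
    have h3 : QuadraticAlgebra.trace (algebraMap F _ y * (t : QuadL a b c) * star (t : QuadL a b c))
        ^ 2 - 4 * QuadraticAlgebra.norm (algebraMap F _ y * (t : QuadL a b c))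
          * QuadraticAlgebra.norm (t : QuadL a b c) = 0 := by
      simp only [norm_eq, trace_eq, QuadraticAlgebra.re_mul, QuadraticAlgebra.im_mul,
        QuadraticAlgebra.re_star, QuadraticAlgebra.im_star, QuadraticAlgebra.algebraMap_re,
        QuadraticAlgebra.algebraMap_im]
      ring
    rw [h3] at h1
    have := habc.disc_ne_zero
    have := det_coe_ne_zero g
    field_simp at h1
    simp_all
  obtain ⟨m, u, hu, rfl⟩ := hϖ.exists_pow hx hx0
  have hu0 : u ≠ 0 := by rintro rfl; simp at hu
  refine ⟨t, m, ht, mkGL u 0 y 1 (by simpa), mkGL_mem_integralGL hu.le (by simp) hy (by simp)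
    (by simpa), ?_⟩
  rw [mul_assoc]
  apply colL_injective (a := a) (b := b) hc
  · rw [colL_torus hc, h0]
    congr 1
    simp [colL, GL_mul_apply, diagPow, upperTri_coe, mkGL_coe]
  · rw [colL_torus hc, ← ht]
    conv_lhs => rw [← mul_one (t : QuadL a b c)]
    congr 1
    simp [colL, GL_mul_apply, diagPow, upperTri_coe, mkGL_coe, betaComb_eq]

/-- `GL₂(F)` is the union of the double cosets of `diag(ϖ ^ m, 1)`, `m ≥ 0`. -/
theorem exists_torus_mul_diagPow_mul (habc : Admissible a b c) {ϖ : Fˣ}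
    (hϖ : IsUniformizer 𝒪[F] ϖ) (g : GL (Fin 2) F) :
    ∃ (t : (QuadL a b c)ˣ) (m : ℕ), ∃ k ∈ integralGL 𝒪[F] F,
      g = torusHom a b c t * diagPow ϖ m * k := by
  have hc := habc.c_ne_zero
  set A := QuadraticAlgebra.norm (colL a b c g 0) with hA
  set B := QuadraticAlgebra.trace (colL a b c g 0 * star (colL a b c g 1)) with hB
  set C := QuadraticAlgebra.norm (colL a b c g 1) with hC
  have hdisc : B ^ 2 - 4 * A * C ≠ 0 := by
    rw [trace_sq_sub_norm hc]
    have := det_coe_ne_zero g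
    have := habc.disc_ne_zero
    positivity
  have h2 : valuation F (2 : F) ≤ 1 := by exact_mod_cast val_natCast_le_one (F := F) 2
  -- It suffices to reach the dominant situation after a change of basis κ ∈ K of the lattice. Three
  -- choices are enough: the identity, the swap of the columns, and replacing the second column by
  -- the sum.
  have key : ∀ κ ∈ integralGL 𝒪[F] F,
      QuadraticAlgebra.norm (colL a b c (g * κ) 1) ≠ 0 →
      valuation F (QuadraticAlgebra.norm (colL a b c (g * κ) 0))
        ≤ valuation F (QuadraticAlgebra.norm (colL a b c (g * κ) 1)) →
      valuation F (QuadraticAlgebra.trace (colL a b c (g * κ) 0 * star (colL a b c (g * κ) 1)))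
        ≤ valuation F (QuadraticAlgebra.norm (colL a b c (g * κ) 1)) →
      ∃ (t : (QuadL a b c)ˣ) (m : ℕ), ∃ k ∈ integralGL 𝒪[F] F,
        g = torusHom a b c t * diagPow ϖ m * k := by
    intro κ hκ h1 h2 h3
    obtain ⟨t, m, -, k, hk, h⟩ := exists_torus_mul_of_dominant habc hϖ (g * κ) h1 h2 h3
    exact ⟨t, m, k * κ⁻¹, mul_mem hk (inv_mem hκ), by rw [← mul_assoc, ← h, mul_inv_cancel_right]⟩
  by_cases h1 : valuation F A ≤ valuation F C ∧ valuation F B ≤ valuation F C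
  · refine key 1 (one_mem _) ?_ ?_ ?_
    · rw [mul_one]
      intro h0
      rw [← hC] at h0
      rw [h0] at h1 hdisc
      simp only [map_zero, le_zero_iff, map_eq_zero] at h1
      simp [h1] at hdisc
    · rw [mul_one]; exact h1.1
    · rw [mul_one]; exact h1.2
  by_cases h3 : valuation F C ≤ valuation F A ∧ valuation F B ≤ valuation F A
  · have e0 : colL a b c (g * mkGL 0 1 1 0 (by simp)) 0 = colL a b c g 1 := by
      simp [colL_mul, mkGL_coe]
    have e1 : colL a b c (g * mkGL 0 1 1 0 (by simp)) 1 = colL a b c g 0 := by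
      simp [colL_mul, mkGL_coe]
    refine key (mkGL 0 1 1 0 (by simp)) (mkGL_mem_integralGL ?_ ?_ ?_ ?_ ?_) ?_ ?_ ?_
    iterate 4 simp
    · simp
    · rw [e1]
      intro h0
      rw [← hA] at h0
      rw [h0] at h3 hdisc
      simp only [map_zero, le_zero_iff, map_eq_zero] at h3
      simp [h3] at hdisc
    · rw [e0, e1]; exact h3.1
    · rw [e0, e1]
      refine le_trans (le_of_eq ?_) h3.2
      rw [hB]
      congr 1
      simp only [trace_eq, QuadraticAlgebra.re_mul, QuadraticAlgebra.re_star,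
        QuadraticAlgebra.im_star]
      ring
  -- What remains is the case where the middle coefficient strictly dominates. Then N(z₀ + z₁) = A +
  -- B + C has the valuation of B, and z₀ + z₁ serves as the dominant column.
  have hBC : valuation F C < valuation F B := by
    by_contra! h
    rcases le_total (valuation F A) (valuation F C) with h5 | h5
    · exact h1 ⟨h5, h⟩
    · exact h3 ⟨h5, h.trans h5⟩
  have hBA : valuation F A < valuation F B := by
    by_contra! h
    rcases le_total (valuation F A) (valuation F C) with h5 | h5
    · exact h1 ⟨h5, h.trans h5⟩
    · exact h3 ⟨h5, h⟩
  have e0 : colL a b c (g * mkGL 1 1 0 1 (by simp)) 0 = colL a b c g 0 := by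
    simp [colL_mul, mkGL_coe]
  have e1 : colL a b c (g * mkGL 1 1 0 1 (by simp)) 1 = colL a b c g 0 + colL a b c g 1 := by
    simp [colL_mul, mkGL_coe]
  have hN : QuadraticAlgebra.norm (colL a b c g 0 + colL a b c g 1) = B + (A + C) := by
    have := norm_add_smul (colL a b c g 0) (colL a b c g 1) 1 1
    simp only [map_one, one_mul, one_pow] at this
    rw [this]; ring
  have hT : QuadraticAlgebra.trace (colL a b c g 0 * star (colL a b c g 0 + colL a b c g 1))
      = 2 * A + B := by
    rw [hA, hB]
    simp only [norm_eq, trace_eq, QuadraticAlgebra.re_mul, QuadraticAlgebra.re_star,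
      QuadraticAlgebra.im_star, QuadraticAlgebra.re_add, QuadraticAlgebra.im_add]
    ring
  have hv : valuation F (B + (A + C)) = valuation F B :=
    Valuation.map_add_eq_of_lt_left _ ((valuation F).map_add_lt hBA hBC)
  refine key (mkGL 1 1 0 1 (by simp)) (mkGL_mem_integralGL ?_ ?_ ?_ ?_ ?_) ?_ ?_ ?_
  iterate 4 simp
  · simp
  · rw [e1, hN, ← (valuation F).ne_zero_iff, hv]
    exact (zero_le.trans_lt hBC).ne'
  · rw [e0, e1, hN, hv]; exact hBA.le
  · rw [e0, e1, hN, hT, hv]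
    refine (valuation F).map_add_le ?_ le_rfl
    rw [map_mul]
    exact (mul_le_of_le_one_left' h2).trans hBA.le

theorem det_torusHom (z : (QuadL a b c)ˣ) :
    (torusHom a b c z : Matrix (Fin 2) (Fin 2) F).det
      = QuadraticAlgebra.norm (z : QuadL a b c) := by
  rw [torusHom_val, norm_eq, Matrix.det_fin_two]
  simp only [matXi]
  simp [-AddSubgroupClass.coe_sub]
  linear_combination (z : QuadL a b c).im ^ 2 * coe_disc a b c

theorem diagPow_mem_intL (habc : Admissible a b c) {ϖ : Fˣ} (hϖ : IsUniformizer 𝒪[F] ϖ) (n : ℕ)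
    {k : GL (Fin 2) F} (hk : k ∈ integralGL 𝒪[F] F) (j : Fin 2) :
    colL a b c (diagPow ϖ n * k) j ∈ intL a b c := by
  rw [mem_integralGL_iff] at hk
  rw [colL, habc.betaComb_mem_iff]
  simp only [GL_mul_apply, diagPow, upperTri_coe]
  simp
  exact ⟨hk.1 1 j, mul_le_one' (pow_le_one' hϖ.val_lt_one.le n) (hk.1 0 j)⟩

/-- The double cosets of the matrices `diag(ϖ ^ m, 1)` are disjoint. -/
theorem diagPow_index_unique (habc : Admissible a b c) {ϖ : Fˣ} (hϖ : IsUniformizer 𝒪[F] ϖ)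
    {t t' : (QuadL a b c)ˣ} {m n : ℕ} {k k' : GL (Fin 2) F} (hk : k ∈ integralGL 𝒪[F] F)
    (hk' : k' ∈ integralGL 𝒪[F] F)
    (h : torusHom a b c t * diagPow ϖ m * k = torusHom a b c t' * diagPow ϖ n * k') : m = n := by
  have hc := habc.c_ne_zero
  -- The second column of diag(ϖᵐ, 1) is 1, so 1 is z times an integral element and |N(z)| ≥ 1. The
  -- same for z⁻¹ gives |N(z)| = 1, and then determinants determine the exponent.
  have aux : ∀ (z : (QuadL a b c)ˣ) (m n : ℕ), ∀ κ ∈ integralGL 𝒪[F] F,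
      diagPow ϖ m = torusHom a b c z * diagPow ϖ n * κ →
      1 ≤ valuation F (QuadraticAlgebra.norm (z : QuadL a b c)) := by
    intro z m n κ hκ h
    have h1 : colL a b c (diagPow ϖ m) 1 = 1 := by
      simp [colL, diagPow, upperTri_coe, betaComb_eq]
    rw [h, mul_assoc, colL_torus hc] at h1
    have h2 := congrArg (valuation F ∘ QuadraticAlgebra.norm) h1
    simp only [Function.comp, map_mul, map_one] at h2
    rw [← h2]
    exact mul_le_of_le_one_right' (mem_intL_iff.mp (diagPow_mem_intL habc hϖ n hκ 1)).1
  have h1 : diagPow ϖ m = torusHom a b c (t⁻¹ * t') * diagPow ϖ n * (k' * k⁻¹) := by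
    rw [map_mul, map_inv]
    calc _ = (torusHom a b c t)⁻¹ * (torusHom a b c t * diagPow ϖ m * k) * k⁻¹ := by group
      _ = _ := by rw [h]; group
  have h2 : diagPow ϖ n = torusHom a b c (t⁻¹ * t')⁻¹ * diagPow ϖ m * (k' * k⁻¹)⁻¹ := by
    rw [h1, map_inv]; group
  have hκ := mul_mem hk' (inv_mem hk)
  have h3 := aux _ _ _ _ hκ h1
  have h4 := aux _ _ _ _ (inv_mem hκ) h2
  have h5 : valuation F (QuadraticAlgebra.norm ((t⁻¹ * t' : (QuadL a b c)ˣ) : QuadL a b c)) *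
      valuation F (QuadraticAlgebra.norm (((t⁻¹ * t')⁻¹ : (QuadL a b c)ˣ) : QuadL a b c)) = 1 := by
    rw [← map_mul, ← map_mul, Units.mul_inv, map_one, map_one]
  have h6 : valuation F (QuadraticAlgebra.norm ((t⁻¹ * t' : (QuadL a b c)ˣ) : QuadL a b c)) = 1 := by
    refine le_antisymm ?_ h3
    rw [← h5]
    exact le_mul_of_one_le_right' h4
  have h7 := congrArg (fun g : GL (Fin 2) F =>
    valuation F (g : Matrix (Fin 2) (Fin 2) F).det) h1
  have h8 := (mem_integralGL_iff.mp hκ).2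
  rw [← Matrix.det_fin_two] at h8
  rw [Units.val_mul, Matrix.det_mul, map_mul, h8, mul_one, Units.val_mul, Matrix.det_mul, map_mul,
    det_torusHom, h6, one_mul] at h7
  simp only [diagPow, upperTri_coe, Matrix.det_fin_two_of] at h7
  simp only [Units.val_pow_eq_pow_val, Units.val_one, mul_one, mul_zero, sub_zero, map_pow] at h7
  exact pow_right_injective₀ (zero_lt_iff.mpr ((valuation F).ne_zero_iff.mpr ϖ.ne_zero))
    hϖ.val_lt_one.ne h7

end Decomposition

/-! ### The Hecke operator of K diag(ϖ, 1) K -/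

section Hecke

variable {F : Type*} [Field F] [ValuativeRel F] [TopologicalSpace F] [IsNonarchimedeanLocalField F]

theorem residue_eq_zero_iff {x : 𝒪[F]} :
    IsLocalRing.residue 𝒪[F] x = 0 ↔ valuation F (x : F) < 1 := by
  rw [IsLocalRing.residue_eq_zero_iff, IsLocalRing.mem_maximalIdeal, mem_nonunits_iff,
    isUnit_integer_iff]
  exact ⟨fun h => lt_of_le_of_ne x.2 h, fun h => h.ne⟩

/-- A representative in `𝒪` of an element of the residue field. -/
def residueLift (y : 𝓀[F]) : 𝒪[F] := Function.surjInv IsLocalRing.residue_surjective y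

theorem residue_residueLift (y : 𝓀[F]) : IsLocalRing.residue 𝒪[F] (residueLift y) = y :=
  Function.surjInv_eq _ y

/-- Representatives of the `q + 1` cosets `g K` in the double coset `K diag(ϖ, 1) K`. -/
def heckeRep (ϖ : Fˣ) : Option 𝓀[F] → GL (Fin 2) F
  | none => upperTri ϖ 0 1
  | some y => mkGL 0 1 ϖ (residueLift y) (by simp)

/-- The matrix `[0, 1; 1, 0]`. -/
def weyl (F : Type*) [Field F] : GL (Fin 2) F := mkGL 0 1 1 0 (by simp)

theorem weyl_mem : weyl F ∈ integralGL 𝒪[F] F :=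
  mkGL_mem_integralGL (by simp) (by simp) (by simp) (by simp) (by simp)

variable {ϖ : Fˣ}

theorem heckeRep_integral (hϖ : IsUniformizer 𝒪[F] ϖ) (i : Option 𝓀[F]) :
    (∀ j l, valuation F (heckeRep ϖ i j l) ≤ 1) ∧
      valuation F (heckeRep ϖ i : Matrix (Fin 2) (Fin 2) F).det = valuation F (ϖ : F) := by
  have h := hϖ.val_lt_one.le
  cases i with
  | none =>
    refine ⟨fun j l => ?_, ?_⟩
    · fin_cases j <;> fin_cases l <;> simp [heckeRep, upperTri_coe, h]
    · simp [heckeRep, upperTri_coe]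
  | some y =>
    refine ⟨fun j l => ?_, ?_⟩
    · have := (residueLift y).2
      fin_cases j <;> fin_cases l <;> simp [heckeRep, mkGL_coe, h]
      exact this
    · simp [heckeRep, mkGL_coe]

theorem val_det_of_mem_integralGL {k : GL (Fin 2) F} (hk : k ∈ integralGL 𝒪[F] F) :
    valuation F (k : Matrix (Fin 2) (Fin 2) F).det = 1 := by
  rw [Matrix.det_fin_two]; exact (mem_integralGL_iff.mp hk).2

theorem val_entries_mul_le_one {g h : GL (Fin 2) F} (hg : ∀ i j, valuation F (g i j) ≤ 1)
    (hh : ∀ i j, valuation F (h i j) ≤ 1) (i j : Fin 2) : valuation F ((g * h) i j) ≤ 1 := by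
  rw [GL_mul_apply]
  exact val_add_le_one (val_mul_le_one (hg _ _) (hh _ _)) (val_mul_le_one (hg _ _) (hh _ _))

/-- Every integral matrix whose determinant is a uniformizer lies in one of the cosets of the
`heckeRep`. -/
theorem exists_heckeRep_mul (hϖ : IsUniformizer 𝒪[F] ϖ) {h : GL (Fin 2) F}
    (hint : ∀ i j, valuation F (h i j) ≤ 1)
    (hdet : valuation F (h : Matrix (Fin 2) (Fin 2) F).det = valuation F (ϖ : F)) :
    ∃ i, ∃ κ ∈ integralGL 𝒪[F] F, h = heckeRep ϖ i * κ := by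
  have hw : (ϖ : F) ≠ 0 := ϖ.ne_zero
  have hvw : valuation F (ϖ : F) ≠ 0 := (valuation F).ne_zero_iff.mpr hw
  have hmem : ∀ i, (∀ j l, valuation F (((heckeRep ϖ i)⁻¹ * h) j l) ≤ 1) →
      ∃ i, ∃ κ ∈ integralGL 𝒪[F] F, h = heckeRep ϖ i * κ := by
    intro i hi
    refine ⟨i, (heckeRep ϖ i)⁻¹ * h, ?_, by rw [mul_inv_cancel_left]⟩
    rw [mem_integralGL_iff, ← Matrix.det_fin_two]
    refine ⟨hi, ?_⟩
    have h1 : heckeRep ϖ i * ((heckeRep ϖ i)⁻¹ * h) = h := mul_inv_cancel_left _ _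
    have h2 := congrArg (fun g : GL (Fin 2) F =>
      valuation F (g : Matrix (Fin 2) (Fin 2) F).det) h1
    rw [Units.val_mul, Matrix.det_mul, map_mul, (heckeRep_integral hϖ i).2, hdet] at h2
    exact mul_left_cancel₀ hvw (by rw [h2, mul_one])
  -- Modulo 𝔭 the matrix has rank one. Either its top row vanishes, which is the coset of `none`, or
  -- the bottom row is a multiple y of the top row, which is the coset of `some y`.
  by_cases htop : valuation F (h 0 0) < 1 ∧ valuation F (h 0 1) < 1
  · refine hmem none fun j l => ?_
    have e : (heckeRep ϖ none)⁻¹ * h = mkGL (h 0 0 / ϖ) (h 0 1 / ϖ) (h 1 0) (h 1 1) (by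
        have := det_coe_ne_zero h
        contrapose! this
        field_simp at this
        simpa using this) := by
      rw [inv_mul_eq_iff_eq_mul]
      apply GL_ext <;> simp [GL_mul_apply, heckeRep, upperTri_coe, mkGL_coe] <;> field_simp
    rw [e]
    have h1 := hϖ.div_val_le_one htop.1
    have h2 := hϖ.div_val_le_one htop.2
    fin_cases j <;> fin_cases l
    · exact h1
    · exact h2
    · exact hint 1 0
    · exact hint 1 1
  · have hy : ∃ y : 𝓀[F], valuation F (h 1 0 - residueLift y * h 0 0) < 1 ∧
        valuation F (h 1 1 - residueLift y * h 0 1) < 1 := by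
      have aux : ∀ p q r s : F, valuation F p = 1 → valuation F q ≤ 1 → valuation F r ≤ 1 →
          valuation F s ≤ 1 → valuation F (p * s - q * r) < 1 →
          ∃ y : 𝓀[F], valuation F (r - residueLift y * p) < 1 ∧
            valuation F (s - residueLift y * q) < 1 := by
        intro p q r s hp hq hr hs hd
        have hp0 : p ≠ 0 := by rintro rfl; simp at hp
        have hrp : valuation F (r / p) ≤ 1 := by rw [map_div₀, hp, div_one]; exact hr
        refine ⟨IsLocalRing.residue 𝒪[F] ⟨r / p, hrp⟩, ?_⟩
        set y := residueLift (IsLocalRing.residue 𝒪[F] ⟨r / p, hrp⟩) with hy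
        have h1 : valuation F (r / p - y) < 1 := by
          have : IsLocalRing.residue 𝒪[F] (⟨r / p, hrp⟩ - y) = 0 := by
            rw [map_sub, hy, residue_residueLift, sub_self]
          exact residue_eq_zero_iff.mp this
        have h2 : valuation F (r - y * p) < 1 := by
          have : r - y * p = (r / p - y) * p := by field_simp
          rw [this, map_mul, hp, mul_one]; exact h1
        refine ⟨h2, ?_⟩
        have h3 : p * (s - y * q) = (p * s - q * r) + q * (r - y * p) := by ring
        have h4 : valuation F (p * (s - y * q)) < 1 := by
          rw [h3]
          refine (valuation F).map_add_lt hd ?_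
          rw [map_mul]
          exact (mul_le_of_le_one_left' hq).trans_lt h2
        rwa [map_mul, hp, one_mul] at h4
      rw [Matrix.det_fin_two] at hdet
      have hd := hϖ.val_lt_one
      rw [← hdet] at hd
      by_cases h0 : valuation F (h 0 0) = 1
      · exact aux _ _ _ _ h0 (hint 0 1) (hint 1 0) (hint 1 1) hd
      · have h1 : valuation F (h 0 1) = 1 := by
          by_contra h1
          exact htop ⟨lt_of_le_of_ne (hint _ _) h0, lt_of_le_of_ne (hint _ _) h1⟩
        rw [Valuation.map_sub_swap] at hd
        obtain ⟨y, hy1, hy2⟩ := aux _ _ _ _ h1 (hint 0 0) (hint 1 1) (hint 1 0) hd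
        exact ⟨y, hy2, hy1⟩
    obtain ⟨y, hy1, hy2⟩ := hy
    refine hmem (some y) fun j l => ?_
    have e : (heckeRep ϖ (some y))⁻¹ * h = mkGL ((h 1 0 - residueLift y * h 0 0) / ϖ)
        ((h 1 1 - residueLift y * h 0 1) / ϖ) (h 0 0) (h 0 1) (by
        have := det_coe_ne_zero h
        contrapose! this
        field_simp at this
        linear_combination -this) := by
      rw [inv_mul_eq_iff_eq_mul]
      apply GL_ext <;> simp [GL_mul_apply, heckeRep, mkGL_coe] <;> field_simp <;> ring
    rw [e]
    have h1 := hϖ.div_val_le_one hy1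
    have h2 := hϖ.div_val_le_one hy2
    fin_cases j <;> fin_cases l
    · exact h1
    · exact h2
    · exact hint 0 0
    · exact hint 0 1

/-- The top row vanishes modulo 𝔭 for `none` and not for `some y`, a property unaffected by K. For
two indices y, y' the entries force the lifts to differ by ϖ times an integral entry of κ. -/
theorem heckeRep_injective_mod (hϖ : IsUniformizer 𝒪[F] ϖ) {i j : Option 𝓀[F]}
    {κ : GL (Fin 2) F} (hκ : κ ∈ integralGL 𝒪[F] F) (h : heckeRep ϖ i = heckeRep ϖ j * κ) :
    i = j := by
  have aux : ∀ (y : 𝓀[F]), ∀ κ ∈ integralGL 𝒪[F] F,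
      heckeRep ϖ (some y) ≠ heckeRep ϖ none * κ := by
    intro y κ hκ h
    have h1 := congrArg (fun g : GL (Fin 2) F => valuation F (g 0 1)) h
    simp only [GL_mul_apply] at h1
    simp [heckeRep, mkGL_coe, upperTri_coe] at h1
    have h2 := (mem_integralGL_iff.mp hκ).1 0 1
    have h3 : valuation F (ϖ : F) * valuation F (κ 0 1) < 1 :=
      (mul_le_of_le_one_right' h2).trans_lt hϖ.val_lt_one
    exact h3.ne h1.symm
  cases i with
  | none =>
    cases j with
    | none => rfl
    | some y => exact (aux y κ⁻¹ (inv_mem hκ) (by rw [h, mul_inv_cancel_right])).elim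
  | some y =>
    cases j with
    | none => exact (aux y κ hκ h).elim
    | some y' =>
      have h01 := congrArg (fun g : GL (Fin 2) F => g 0 1) h
      have h11 := congrArg (fun g : GL (Fin 2) F => g 1 1) h
      simp only [GL_mul_apply] at h01 h11
      simp [heckeRep, mkGL_coe] at h01 h11
      rw [← h01, mul_one] at h11
      have h2 := (mem_integralGL_iff.mp hκ).1 0 1
      congr 1
      rw [← residue_residueLift y, ← residue_residueLift y', ← sub_eq_zero, ← map_sub,
        residue_eq_zero_iff]
      have : ((residueLift y - residueLift y' : 𝒪[F]) : F) = ϖ * κ 0 1 := by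
        change (residueLift y : F) - residueLift y' = _
        rw [h11]; ring
      rw [this, map_mul]
      exact (mul_le_of_le_one_right' h2).trans_lt hϖ.val_lt_one

variable [Fintype 𝓀[F]] {M : Type*} [AddCommMonoid M]

theorem card_residueField : Fintype.card 𝓀[F] = resCard F := by
  rw [resCard, Nat.card_eq_fintype_card]

/-- The Hecke operator attached to `K diag(ϖ, 1) K`. -/
def heckeSum (ϖ : Fˣ) (φ : GL (Fin 2) F → M) (h : GL (Fin 2) F) : M :=
  ∑ i, φ (h * heckeRep ϖ i)

/-- Left multiplication by k permutes the cosets in K diag(ϖ, 1) K: the induced map σ on the finite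
index set is injective, hence bijective. -/
theorem heckeSum_mul (hϖ : IsUniformizer 𝒪[F] ϖ) {φ : GL (Fin 2) F → M}
    (hφ : ∀ k ∈ integralGL 𝒪[F] F, ∀ g, φ (g * k) = φ g) (h : GL (Fin 2) F)
    {k : GL (Fin 2) F} (hk : k ∈ integralGL 𝒪[F] F) :
    heckeSum ϖ φ (h * k) = heckeSum ϖ φ h := by
  have hex : ∀ i, ∃ i', ∃ κ ∈ integralGL 𝒪[F] F, k * heckeRep ϖ i = heckeRep ϖ i' * κ := by
    intro i
    obtain ⟨h1, h2⟩ := heckeRep_integral hϖ i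
    refine exists_heckeRep_mul hϖ (val_entries_mul_le_one (mem_integralGL_iff.mp hk).1 h1) ?_
    rw [Units.val_mul, Matrix.det_mul, map_mul, val_det_of_mem_integralGL hk, one_mul, h2]
  choose σ κ hκ hσ using hex
  have hinj : Function.Injective σ := by
    intro i j hij
    refine heckeRep_injective_mod hϖ (κ := (κ j)⁻¹ * κ i) (mul_mem (inv_mem (hκ j)) (hκ i)) ?_
    have h1 := hσ i
    have h2 := hσ j
    rw [hij] at h1
    rw [← mul_left_cancel_iff (a := k), h1, ← mul_assoc, h2]
    group
  rw [heckeSum, heckeSum, 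
    ← (Equiv.ofBijective σ (Finite.injective_iff_bijective.mp hinj)).sum_comp
      fun i => φ (h * heckeRep ϖ i)]
  refine Finset.sum_congr rfl fun i _ => ?_
  rw [mul_assoc, hσ, ← mul_assoc, hφ _ (hκ i)]
  rfl

/-- Multiplying the representatives on the left by [0, 1; 1, 0] turns them, modulo K, into upper
triangular ones, which suit the matrices diag(ϖᵐ, 1) with m ≥ 1 and the principal series. -/
theorem heckeSum_eq_of_weyl (hϖ : IsUniformizer 𝒪[F] ϖ) {φ : GL (Fin 2) F → M}
    (hφ : ∀ k ∈ integralGL 𝒪[F] F, ∀ g, φ (g * k) = φ g) (h : GL (Fin 2) F) :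
    heckeSum ϖ φ h = φ (h * upperTri 1 0 ϖ)
      + ∑ y : 𝓀[F], φ (h * upperTri ϖ (residueLift y : F) 1) := by
  rw [← heckeSum_mul hϖ hφ h weyl_mem, heckeSum, Fintype.sum_option]
  congr 1
  · rw [← hφ _ weyl_mem (h * upperTri 1 0 ϖ), mul_assoc, mul_assoc]
    congr 2
    apply GL_ext <;> simp [GL_mul_apply, heckeRep, weyl, mkGL_coe, upperTri_coe]
  · refine Finset.sum_congr rfl fun y _ => ?_
    rw [mul_assoc]
    congr 2
    apply GL_ext <;> simp [GL_mul_apply, heckeRep, weyl, mkGL_coe, upperTri_coe]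

end Hecke

/-! ### Neighbours of diag(ϖᵐ, 1) sorted by level -/

section Relations

variable {F : Type*} [Field F] [ValuativeRel F] [TopologicalSpace F] [IsNonarchimedeanLocalField F]
  [CharZero F] {a b c : 𝒪[F]} {ϖ : Fˣ}

theorem colL_mem_intL (habc : Admissible a b c) {g : GL (Fin 2) F}
    (hg : ∀ i j, valuation F (g i j) ≤ 1) (j : Fin 2) : colL a b c g j ∈ intL a b c :=
  habc.betaComb_mem (hg _ _) (hg _ _)

theorem val_det_decomposition {g : GL (Fin 2) F} {t : (QuadL a b c)ˣ} {m : ℕ} {k : GL (Fin 2) F}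
    (hk : k ∈ integralGL 𝒪[F] F) (h : g = torusHom a b c t * diagPow ϖ m * k) :
    valuation F (g : Matrix (Fin 2) (Fin 2) F).det
      = valuation F (QuadraticAlgebra.norm (t : QuadL a b c)) * valuation F (ϖ : F) ^ m := by
  rw [h, Units.val_mul, Matrix.det_mul, map_mul, val_det_of_mem_integralGL hk, mul_one,
    Units.val_mul, Matrix.det_mul, map_mul, det_torusHom]
  congr 1
  simp [diagPow, upperTri_coe]

theorem val_pow_injective (hϖ : IsUniformizer 𝒪[F] ϖ) {m n : ℕ}
    (h : valuation F (ϖ : F) ^ m = valuation F (ϖ : F) ^ n) : m = n :=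
  pow_right_injective₀ (zero_lt_iff.mpr ((valuation F).ne_zero_iff.mpr ϖ.ne_zero))
    hϖ.val_lt_one.ne h

/-- An integral matrix `g` whose second column corresponds to a unit of the ring of integers of `L`
lies in `t diag(ϖ ^ m, 1) K` with a unit `t`. -/
theorem exists_unit_mul_diagPow_mul (habc : Admissible a b c) (hϖ : IsUniformizer 𝒪[F] ϖ)
    {g : GL (Fin 2) F} (hg : ∀ i j, valuation F (g i j) ≤ 1)
    (h1 : valuation F (QuadraticAlgebra.norm (colL a b c g 1)) = 1) {m : ℕ}
    (hm : valuation F (g : Matrix (Fin 2) (Fin 2) F).det = valuation F (ϖ : F) ^ m) :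
    ∃ t : (QuadL a b c)ˣ, (t : QuadL a b c) ∈ intL a b c ∧
      valuation F (QuadraticAlgebra.norm (t : QuadL a b c)) = 1 ∧
      ∃ k ∈ integralGL 𝒪[F] F, g = torusHom a b c t * diagPow ϖ m * k := by
  have i0 := colL_mem_intL habc hg 0
  have i1 := colL_mem_intL habc hg 1
  obtain ⟨t, n, ht, k, hk, h⟩ := exists_torus_mul_of_dominant habc hϖ g
    (by intro h0; simp [h0] at h1)
    (by rw [h1]; exact (mem_intL_iff.mp i0).1)
    (by rw [h1]; exact (mem_intL_iff.mp (mul_mem i0 (star_mem_intL i1))).2)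
  have hn := val_det_decomposition hk h
  rw [hm, ht, h1, one_mul] at hn
  obtain rfl := val_pow_injective hϖ hn
  exact ⟨t, ht ▸ i1, ht ▸ h1, k, hk, h⟩

/-- Left invariance under the units of the ring of integers of `L`. -/
def UnitInvariant (a b c : 𝒪[F]) {M : Type*} (φ : GL (Fin 2) F → M) : Prop :=
  ∀ t : (QuadL a b c)ˣ, (t : QuadL a b c) ∈ intL a b c →
    valuation F (QuadraticAlgebra.norm (t : QuadL a b c)) = 1 →
    ∀ g, φ (torusHom a b c t * g) = φ g

/-- This locates the generic neighbours: once the second column is a unit of 𝔬_L, the determinant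
alone decides the level. -/
theorem apply_eq_diagPow (habc : Admissible a b c) (hϖ : IsUniformizer 𝒪[F] ϖ) {M : Type*}
    {φ : GL (Fin 2) F → M} (hφ : ∀ k ∈ integralGL 𝒪[F] F, ∀ g, φ (g * k) = φ g)
    (hφ' : UnitInvariant a b c φ) {g : GL (Fin 2) F} (hg : ∀ i j, valuation F (g i j) ≤ 1)
    (h1 : valuation F (QuadraticAlgebra.norm (colL a b c g 1)) = 1) {m : ℕ}
    (hm : valuation F (g : Matrix (Fin 2) (Fin 2) F).det = valuation F (ϖ : F) ^ m) :
    φ g = φ (diagPow ϖ m) := by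
  obtain ⟨t, ht, hn, k, hk, rfl⟩ := exists_unit_mul_diagPow_mul habc hϖ hg h1 hm
  rw [hφ k hk, hφ' t ht hn]

/-- The image of `Fˣ` in `Lˣ`. -/
abbrev scalarL (a b c : 𝒪[F]) (x : Fˣ) : (QuadL a b c)ˣ :=
  Units.map (algebraMap F (QuadL a b c) : F →* QuadL a b c) x

theorem torusHom_scalarL (x : Fˣ) : torusHom a b c (scalarL a b c x) = upperTri x 0 x := by
  apply Units.ext
  rw [torusHom_val, upperTri_coe]
  ext i j
  fin_cases i <;> fin_cases j <;> simp

/-- `c y² + b y + a`, the value of the quadratic form at the column `(1, y)`. -/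
def formAt (a b c y : 𝒪[F]) : 𝒪[F] := c * y ^ 2 + b * y + a

/-- The columns of `heckeRep ϖ (some y)` are ϖ and y + β. When y is a zero of the form modulo 𝔭,
every element of their 𝔬-span has norm in 𝔭. The torus part t is such an element, so comparing
determinants leaves level 0. Thus the span is t𝔬_L; the coordinates of t and the divisibility of
both columns by t are recorded for identifying t later. -/
theorem heckeRep_some_eq (habc : Admissible a b c) (hϖ : IsUniformizer 𝒪[F] ϖ) {y : 𝓀[F]}
    (hy : valuation F (formAt a b c (residueLift y) : F) < 1) :
    ∃ (t : (QuadL a b c)ˣ) (x z : F), valuation F x ≤ 1 ∧ valuation F z ≤ 1 ∧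
      (t : QuadL a b c) = betaComb a b c (x * ϖ + z * residueLift y) z ∧
      (∃ w ∈ intL a b c, algebraMap F _ (ϖ : F) = (t : QuadL a b c) * w) ∧
      (∃ w ∈ intL a b c, betaComb a b c (residueLift y : F) 1 = (t : QuadL a b c) * w) ∧
      valuation F (QuadraticAlgebra.norm (t : QuadL a b c)) = valuation F (ϖ : F) ∧
      ∃ k ∈ integralGL 𝒪[F] F, heckeRep ϖ (some y) = torusHom a b c t * k := by
  have hc := habc.c_ne_zero
  have hvϖ := hϖ.val_lt_one
  have hyv : valuation F (residueLift y : F) ≤ 1 := (residueLift y).2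
  obtain ⟨t, m, k, hk, h⟩ := exists_torus_mul_diagPow_mul habc hϖ (heckeRep ϖ (some y))
  have hk1 := inv_mem hk
  set x := k⁻¹ 0 1 with hx
  set z := k⁻¹ 1 1 with hz
  have hxv : valuation F x ≤ 1 := (mem_integralGL_iff.mp hk1).1 _ _
  have hzv : valuation F z ≤ 1 := (mem_integralGL_iff.mp hk1).1 _ _
  have ht : (t : QuadL a b c) = betaComb a b c (x * ϖ + z * residueLift y) z := by
    have h2 : heckeRep ϖ (some y) * k⁻¹ = torusHom a b c t * diagPow ϖ m := by
      rw [h, mul_inv_cancel_right]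
    have h3 : colL a b c (torusHom a b c t * diagPow ϖ m) 1 = t := by
      rw [colL_torus hc]
      conv_rhs => rw [← mul_one (t : QuadL a b c)]
      congr 1
      simp [colL, diagPow, upperTri_coe, betaComb_eq]
    rw [← h3, ← h2, colL_mul]
    simp only [colL, heckeRep, mkGL_coe, betaComb_eq, ← hx, ← hz]
    simp
    ring
  have hN : valuation F (QuadraticAlgebra.norm (t : QuadL a b c)) < 1 := by
    rw [ht, norm_betaComb hc, map_div₀, habc.val_c, div_one]
    have e : (c : F) * (x * ϖ + z * residueLift y) ^ 2 + b * (x * ϖ + z * residueLift y) * z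
        + a * z ^ 2 = ϖ * (x * (c * (x * ϖ + 2 * (z * residueLift y)) + b * z))
        + z ^ 2 * (c * (residueLift y) ^ 2 + b * residueLift y + a) := by ring
    rw [e]
    refine (valuation F).map_add_lt ?_ ?_
    · rw [map_mul]
      refine (mul_le_of_le_one_right' (val_mul_le_one hxv (val_add_le_one (val_mul_le_one c.2
        (val_add_le_one (val_mul_le_one hxv hvϖ.le) (val_mul_le_one
          (by exact_mod_cast val_natCast_le_one (F := F) 2) (val_mul_le_one hzv hyv))))
        (val_mul_le_one b.2 hzv)))).trans_lt hvϖ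
    · rw [map_mul]
      exact (mul_le_of_le_one_left' (val_pow_le_one hzv)).trans_lt hy
  have hdet := val_det_decomposition hk h
  rw [(heckeRep_integral hϖ _).2] at hdet
  have hv0 : 0 < valuation F (ϖ : F) := zero_lt_iff.mpr ((valuation F).ne_zero_iff.mpr ϖ.ne_zero)
  -- The determinant gives |N(t)| |ϖ|ᵐ = |ϖ| while already |N(t)| ≤ |ϖ|.
  have hm : m = 0 := by
    by_contra hm
    have h1 := hϖ.val_le_iff.mpr hN
    have h2 : valuation F (ϖ : F) ^ m < 1 := pow_lt_one₀ zero_le hvϖ hm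
    have h3 : valuation F (ϖ : F) ≤ valuation F (ϖ : F) * valuation F (ϖ : F) ^ m := by
      conv_lhs => rw [hdet]
      gcongr
    exact absurd h2 (not_lt.mpr (le_of_mul_le_mul_left (by rwa [mul_one]) hv0))
  subst hm
  rw [pow_zero, mul_one] at hdet
  rw [diagPow_zero, mul_one] at h
  refine ⟨t, x, z, hxv, hzv, ht, ⟨colL a b c k 0, colL_mem_intL habc
    (mem_integralGL_iff.mp hk).1 0, ?_⟩, ⟨colL a b c k 1, colL_mem_intL habc
    (mem_integralGL_iff.mp hk).1 1, ?_⟩, hdet.symm, k, hk, h⟩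
  · rw [← colL_torus hc, ← h]
    simp [colL, heckeRep, mkGL_coe, betaComb_eq]
  · rw [← colL_torus hc, ← h]
    simp [colL, heckeRep, mkGL_coe]

theorem apply_torusHom_eq {M : Type*} {φ : GL (Fin 2) F → M} (hφ' : UnitInvariant a b c φ)
    {t p : (QuadL a b c)ˣ} {w : QuadL a b c} (hw : w ∈ intL a b c)
    (hw' : valuation F (QuadraticAlgebra.norm w) = 1) (h : (t : QuadL a b c) = p * w) :
    φ (torusHom a b c t) = φ (torusHom a b c p) := by
  obtain ⟨u, rfl⟩ := isUnit_of_norm_ne_zero (z := w) (by rintro h0; simp [h0] at hw')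
  have : t = u * p := Units.ext (by rw [h, Units.val_mul, mul_comm])
  rw [this, map_mul, hφ' u hw hw']

variable [Fintype 𝓀[F]] {M : Type*} [AddCommMonoid M]

/-- Of the q + 1 neighbours of the order of level n + 1, the q matrices [ϖ, y; 0, 1] lead to level n
+ 2, since their second column 1 + xβ with x ∈ 𝔭 is a unit. The remaining one gives diag(ϖⁿ⁺¹, ϖ),
which is the scalar ϖ times level n. -/
theorem heckeSum_diagPow_succ (habc : Admissible a b c) (hϖ : IsUniformizer 𝒪[F] ϖ)
    {φ : GL (Fin 2) F → M} (hφ : ∀ k ∈ integralGL 𝒪[F] F, ∀ g, φ (g * k) = φ g)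
    (hφ' : UnitInvariant a b c φ) (n : ℕ) :
    heckeSum ϖ φ (diagPow ϖ (n + 1)) = resCard F • φ (diagPow ϖ (n + 2))
      + φ (torusHom a b c (scalarL a b c ϖ) * diagPow ϖ n) := by
  rw [heckeSum_eq_of_weyl hϖ hφ, add_comm]
  have hvϖ := hϖ.val_lt_one.le
  congr 1
  · rw [Finset.sum_eq_card_nsmul (b := φ (diagPow ϖ (n + 2))), Finset.card_univ, card_residueField]
    intro y _
    have hy : valuation F (residueLift y : F) ≤ 1 := (residueLift y).2
    have e : diagPow ϖ (n + 1) * upperTri ϖ (residueLift y : F) 1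
        = upperTri (ϖ ^ (n + 2)) ((ϖ : F) ^ (n + 1) * residueLift y) 1 := by
      apply GL_ext <;> simp [GL_mul_apply, diagPow, upperTri_coe]
      ring
    rw [e]
    refine apply_eq_diagPow habc hϖ hφ hφ' ?_ ?_ ?_
    · intro i j
      fin_cases i <;> fin_cases j <;> simp [upperTri_coe]
      · exact pow_le_one' hvϖ _
      · exact mul_le_one' (pow_le_one' hvϖ _) hy
    · have hx : valuation F ((ϖ : F) ^ (n + 1) * residueLift y) < 1 := by
        rw [map_mul, map_pow]
        exact (mul_le_of_le_one_right' hy).trans_lt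
          (pow_lt_one₀ zero_le hϖ.val_lt_one (Nat.succ_ne_zero n))
      set x := (ϖ : F) ^ (n + 1) * residueLift y
      have : colL a b c (upperTri (ϖ ^ (n + 2)) x 1) 1 = betaComb a b c 1 x := by
        simp [colL, upperTri_coe]
      rw [this, norm_betaComb habc.c_ne_zero, map_div₀, habc.val_c, div_one]
      have h2 : (c : F) * 1 ^ 2 + b * 1 * x + a * x ^ 2 = c + x * (b + a * x) := by ring
      rw [h2, Valuation.map_add_eq_of_lt_left, habc.val_c]
      rw [map_mul, habc.val_c]
      exact (mul_le_of_le_one_right' (val_add_le_one b.2 (val_mul_le_one a.2 hx.le))).trans_lt hx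
    · simp [upperTri_coe]
  · rw [← hφ _ weyl_mem, torusHom_scalarL, ← hφ _ weyl_mem (upperTri ϖ 0 ϖ * _)]
    congr 1
    apply GL_ext <;> simp [GL_mul_apply, diagPow, weyl, mkGL_coe, upperTri_coe]
    ring

open Classical in
/-- The Hecke operator at the identity, in terms of the zeros of the quadratic form modulo `𝔭`. -/
theorem heckeSum_one (habc : Admissible a b c) (hϖ : IsUniformizer 𝒪[F] ϖ)
    {φ : GL (Fin 2) F → M} (hφ : ∀ k ∈ integralGL 𝒪[F] F, ∀ g, φ (g * k) = φ g)
    (hφ' : UnitInvariant a b c φ) (Z : Finset 𝓀[F])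
    (hZ : ∀ y, y ∈ Z ↔ valuation F (formAt a b c (residueLift y) : F) < 1) :
    heckeSum ϖ φ 1 = (resCard F + 1 - Z.card) • φ (diagPow ϖ 1)
      + ∑ y ∈ Z, φ (heckeRep ϖ (some y)) := by
  -- The representative `none` is diag(ϖ, 1) itself and accounts for the 1 in the count q + 1 - #Z;
  -- the rest comes from the y that are not zeros.
  have hd : heckeRep ϖ (none : Option 𝓀[F]) = diagPow ϖ 1 := by simp [heckeRep, diagPow]
  rw [heckeSum, Fintype.sum_option, one_mul, hd,
    ← Finset.sum_compl_add_sum Z, ← add_assoc]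
  congr 1
  · rw [Finset.sum_eq_card_nsmul (b := φ (diagPow ϖ 1)), Finset.card_compl, card_residueField]
    · have : Z.card ≤ resCard F := card_residueField (F := F) ▸ Finset.card_le_univ Z
      rw [Nat.sub_add_comm this, add_smul, one_smul, add_comm]
    · intro y hy
      rw [one_mul]
      refine apply_eq_diagPow habc hϖ hφ hφ' (heckeRep_integral hϖ _).1 ?_
        (by rw [(heckeRep_integral hϖ _).2, pow_one])
      have h1 : valuation F (formAt a b c (residueLift y) : F) = 1 := by
        rw [Finset.mem_compl, hZ] at hy
        exact le_antisymm (formAt a b c (residueLift y)).2 (not_lt.mp hy)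
      have h2 : colL a b c (heckeRep ϖ (some y)) 1 = betaComb a b c (residueLift y : F) 1 := by
        simp [colL, heckeRep, mkGL_coe]
      rw [h2, norm_betaComb habc.c_ne_zero, map_div₀, habc.val_c, div_one, ← h1]
      congr 1
      simp [formAt]
  · simp

end Relations

/-! ### Zeros of the form modulo 𝔭: inert and ramified cases -/

section Classification

variable {F : Type*} [Field F] [ValuativeRel F] [TopologicalSpace F] [IsNonarchimedeanLocalField F]
  {a b c : 𝒪[F]} {ϖ : Fˣ}

/-- Hensel's lemma: if the quadratic form has a simple zero modulo `𝔭` then its discriminant is a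
square. -/
theorem isSquare_disc_of_simple_zero (hc : IsUnit c) {y : 𝒪[F]}
    (h0 : valuation F (formAt a b c y : F) < 1)
    (h1 : IsUnit (2 * c * y + b)) : IsSquare (disc a b c : F) := by
  let := IsTopologicalAddGroup.rightUniformSpace F
  have := isUniformAddGroup_of_addCommGroup (G := F)
  have hens : HenselianRing 𝒪[F] (IsLocalRing.maximalIdeal 𝒪[F]) :=
    IsAdicComplete.henselianRing _ _
  obtain ⟨u, rfl⟩ := hc
  -- The form is divided by its unit leading coefficient because Hensel's lemma is applied to a
  -- monic polynomial. A root r then gives (2cr + b)² = d.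
  let f : Polynomial 𝒪[F] := Polynomial.X ^ 2 + (Polynomial.C (↑u⁻¹ * b) * Polynomial.X
    + Polynomial.C (↑u⁻¹ * a))
  have hf : f.Monic := by
    refine Polynomial.monic_X_pow_add (n := 2) ?_
    refine (Polynomial.degree_add_le _ _).trans_lt (max_lt ?_ ?_)
    · exact (Polynomial.degree_C_mul_X_le _).trans_lt (by norm_num)
    · exact Polynomial.degree_C_le.trans_lt (by norm_num)
  have he : ∀ x, (u : 𝒪[F]) * f.eval x = formAt a b u x := by
    intro x
    simp only [f, formAt, Polynomial.eval_add, Polynomial.eval_pow, Polynomial.eval_X,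
      Polynomial.eval_mul, Polynomial.eval_C]
    linear_combination (b * x + a) * u.mul_inv
  have he' : (u : 𝒪[F]) * (Polynomial.derivative f).eval y = 2 * u * y + b := by
    simp only [f, Polynomial.derivative_add, Polynomial.derivative_pow, Polynomial.derivative_X,
      Polynomial.derivative_mul, Polynomial.derivative_C, Polynomial.eval_add,
      Polynomial.eval_mul, Polynomial.eval_C, Polynomial.eval_X, Polynomial.eval_pow,
      Polynomial.eval_zero, Polynomial.eval_one]
    push_cast
    simp only [pow_one]
    linear_combination b * u.mul_inv
  obtain ⟨r, hr, -⟩ := hens.is_henselian f hf y (by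
    rw [← Ideal.unit_mul_mem_iff_mem _ u.isUnit, he, ← IsLocalRing.residue_eq_zero_iff]
    exact residue_eq_zero_iff.mpr h0) (by
    refine IsUnit.map _ ?_
    rw [← he'] at h1
    exact isUnit_of_mul_isUnit_right h1)
  have hr' := he r
  rw [show f.eval r = 0 from hr, mul_zero] at hr'
  refine ⟨((2 * u * r + b : 𝒪[F]) : F), ?_⟩
  rw [← Subring.coe_mul]
  congr 1
  rw [formAt] at hr'
  linear_combination 4 * (u : 𝒪[F]) * hr'

theorem formAt_val_lt_iff {y : 𝓀[F]} : valuation F (formAt a b c (residueLift y) : F) < 1 ↔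
    IsLocalRing.residue 𝒪[F] c * y ^ 2 + IsLocalRing.residue 𝒪[F] b * y
      + IsLocalRing.residue 𝒪[F] a = 0 := by
  rw [← residue_eq_zero_iff, formAt, map_add, map_add, map_mul, map_mul, map_pow,
    residue_residueLift]

theorem residue_unit_ne_zero {x : 𝒪[F]} (hx : IsUnit x) : IsLocalRing.residue 𝒪[F] x ≠ 0 :=
  (hx.map _).ne_zero

/-- By Hensel's lemma a simple zero would make d a square, so y is a double zero and the form is c(Y
- y)² modulo 𝔭. -/
theorem eq_of_double_zero (habc : Admissible a b c) (hs : ¬ IsSquare (disc a b c : F)) {y y' : 𝓀[F]}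
    (hy : valuation F (formAt a b c (residueLift y) : F) < 1)
    (hy' : valuation F (formAt a b c (residueLift y') : F) < 1) : y' = y := by
  have h1 : ¬ IsUnit (2 * c * residueLift y + b) :=
    fun h => hs (isSquare_disc_of_simple_zero habc.isUnit_c hy h)
  rw [← mem_nonunits_iff, ← IsLocalRing.mem_maximalIdeal, ← IsLocalRing.residue_eq_zero_iff,
    map_add, map_mul, map_mul, residue_residueLift, map_ofNat] at h1
  rw [formAt_val_lt_iff] at hy hy'
  have h2 : IsLocalRing.residue 𝒪[F] c * (y' - y) ^ 2 = 0 := by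
    linear_combination hy' - hy - (y' - y) * h1
  rw [mul_eq_zero, or_iff_right (residue_unit_ne_zero habc.isUnit_c), sq_eq_zero_iff,
    sub_eq_zero] at h2
  exact h2

theorem IsUniformizer.maximalIdeal_map (hϖ : IsUniformizer 𝒪[F] ϖ) {z : intL a b c} :
    z ∈ (𝓂[F]).map (algebraMap 𝒪[F] (intL a b c)) ↔
      ∃ w : intL a b c, (z : QuadL a b c) = algebraMap F _ (ϖ : F) * w := by
  obtain ⟨p, hp, hpe⟩ := hϖ
  rw [show (𝓂[F]) = Ideal.span {p} from hp.maximalIdeal_eq, Ideal.map_span, Set.image_singleton,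
    Ideal.mem_span_singleton]
  have e : algebraMap F (QuadL a b c) (ϖ : F) = (algebraMap 𝒪[F] (intL a b c) p : QuadL a b c) := by
    rw [← hpe]; rfl
  rw [e]
  exact exists_congr fun w => Subtype.ext_iff

variable [CharZero F]

theorem IsUniformizer.betaComb_mem_map (habc : Admissible a b c) (hϖ : IsUniformizer 𝒪[F] ϖ)
    {x y : F} (h : betaComb a b c x y ∈ intL a b c) :
    (⟨_, h⟩ : intL a b c) ∈ (𝓂[F]).map (algebraMap 𝒪[F] (intL a b c)) ↔
      valuation F x < 1 ∧ valuation F y < 1 := by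
  have hc := habc.c_ne_zero
  rw [hϖ.maximalIdeal_map]
  constructor
  · rintro ⟨⟨w, hw⟩, e⟩
    obtain ⟨x', y', rfl⟩ := exists_betaComb hc w
    rw [habc.betaComb_mem_iff] at hw
    have e' : betaComb a b c x y = betaComb a b c (ϖ * x') (ϖ * y') := by
      refine e.trans ?_; simp only [betaComb_eq, map_mul]; ring
    obtain ⟨rfl, rfl⟩ := betaComb_injective hc e'
    rw [map_mul, map_mul]
    exact ⟨(mul_le_of_le_one_right' hw.1).trans_lt hϖ.val_lt_one,
      (mul_le_of_le_one_right' hw.2).trans_lt hϖ.val_lt_one⟩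
  · rintro ⟨hx, hy⟩
    refine ⟨⟨betaComb a b c (x / ϖ) (y / ϖ), habc.betaComb_mem (hϖ.div_val_le_one hx)
      (hϖ.div_val_le_one hy)⟩, ?_⟩
    simp only [betaComb_eq]
    rw [mul_add, ← mul_assoc, ← map_mul, ← map_mul, mul_div_cancel₀ _ ϖ.ne_zero,
      mul_div_cancel₀ _ ϖ.ne_zero]

/-- At a zero y, the product of y + β and its conjugate lies in 𝔭𝔬_L. Neither factor does, since
their coordinates at β are 1 and -1, so 𝔭𝔬_L would not be prime. -/
theorem not_zero_of_isPrime (habc : Admissible a b c) (hϖ : IsUniformizer 𝒪[F] ϖ)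
    (hp : ((𝓂[F]).map (algebraMap 𝒪[F] (intL a b c))).IsPrime) (y : 𝒪[F]) :
    ¬ valuation F (formAt a b c y : F) < 1 := by
  intro hy
  have hc := habc.c_ne_zero
  have h1 : betaComb a b c (y : F) 1 ∈ intL a b c := habc.betaComb_mem y.2 (by simp)
  have h2 : star (betaComb a b c (y : F) 1) = betaComb a b c (y + b / c) (-1) := by
    ext
    · simp [betaComb]; field_simp; ring
    · simp only [betaComb, QuadraticAlgebra.im_star]; ring
  have h3 : betaComb a b c (y + b / c : F) (-1) ∈ intL a b c := h2 ▸ star_mem_intL h1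
  have h4 : betaComb a b c ((formAt a b c y : F) / c) 0 ∈ intL a b c :=
    habc.betaComb_mem (habc.val_div_c (formAt a b c y).2) (by simp)
  have h5 : (⟨_, h1⟩ : intL a b c) * ⟨_, h3⟩ = ⟨_, h4⟩ := by
    apply Subtype.ext
    change betaComb a b c (y : F) 1 * betaComb a b c (y + b / c : F) (-1) = _
    rw [← h2, ← QuadraticAlgebra.algebraMap_norm_eq_mul_star, norm_betaComb hc]
    change _ = betaComb a b c _ 0
    rw [betaComb_eq, map_zero, zero_mul, add_zero, one_pow, mul_one, mul_one]
    rfl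
  have h6 : (⟨_, h4⟩ : intL a b c) ∈ (𝓂[F]).map (algebraMap 𝒪[F] (intL a b c)) := by
    rw [hϖ.betaComb_mem_map habc, map_div₀, habc.val_c, div_one]
    exact ⟨hy, by simp⟩
  rw [← h5] at h6
  rcases hp.mem_or_mem h6 with h | h <;> rw [hϖ.betaComb_mem_map habc] at h <;> simp at h

/-- Without zeros the norm form is anisotropic modulo 𝔭, so an integral element of norm in 𝔭 has
both coordinates in 𝔭. Membership in 𝔭𝔬_L can therefore be read off the norm, which is
multiplicative. -/
theorem isPrime_of_not_zero (habc : Admissible a b c) (hϖ : IsUniformizer 𝒪[F] ϖ)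
    (h : ∀ y : 𝒪[F], ¬ valuation F (formAt a b c y : F) < 1) :
    ((𝓂[F]).map (algebraMap 𝒪[F] (intL a b c))).IsPrime := by
  have hc := habc.c_ne_zero
  have key : ∀ z : intL a b c, valuation F (QuadraticAlgebra.norm (z : QuadL a b c)) < 1 →
      z ∈ (𝓂[F]).map (algebraMap 𝒪[F] (intL a b c)) := by
    rintro ⟨z, hz⟩ hN
    obtain ⟨x, y, rfl⟩ := exists_betaComb hc z
    rw [hϖ.betaComb_mem_map habc]
    obtain ⟨hx, hy⟩ := habc.betaComb_mem_iff.mp hz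
    rw [norm_betaComb hc, map_div₀, habc.val_c, div_one] at hN
    have hy1 : valuation F y < 1 := by
      by_contra hy1
      have hy1 : valuation F y = 1 := le_antisymm hy (not_lt.mp hy1)
      have hy0 : y ≠ 0 := by rintro rfl; simp at hy1
      have hxy : valuation F (x / y) ≤ 1 := by rw [map_div₀, hy1, div_one]; exact hx
      apply h ⟨x / y, hxy⟩
      have e : (formAt a b c ⟨x / y, hxy⟩ : F) = (c * x ^ 2 + b * x * y + a * y ^ 2) / y ^ 2 := by
        simp [formAt]; field_simp
      rw [e, map_div₀, map_pow, hy1, one_pow, div_one]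
      exact hN
    refine ⟨?_, hy1⟩
    by_contra hx1
    have hx1 : valuation F x = 1 := le_antisymm hx (not_lt.mp hx1)
    have e : (c : F) * x ^ 2 + b * x * y + a * y ^ 2 = c * x ^ 2 + y * (b * x + a * y) := by ring
    rw [e, Valuation.map_add_eq_of_lt_left, map_mul, habc.val_c, map_pow, hx1] at hN
    · simp at hN
    · rw [map_mul, map_mul, habc.val_c, map_pow, hx1]
      simpa using (mul_le_of_le_one_right' (val_add_le_one (val_mul_le_one b.2 hx)
        (val_mul_le_one a.2 hy))).trans_lt hy1
  refine ⟨?_, fun {z w} hzw => ?_⟩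
  · rw [Ideal.ne_top_iff_one]
    intro h1
    have h2 : betaComb a b c 1 0 ∈ intL a b c := habc.betaComb_mem (by simp) (by simp)
    have h3 : (1 : intL a b c) = ⟨_, h2⟩ := Subtype.ext (by simp [betaComb_eq])
    rw [h3, hϖ.betaComb_mem_map habc] at h1
    simp at h1
  · rw [hϖ.maximalIdeal_map] at hzw
    obtain ⟨v, hv⟩ := hzw
    have hN := congrArg (valuation F ∘ QuadraticAlgebra.norm) hv
    simp only [Function.comp, MulMemClass.coe_mul, map_mul, QuadraticAlgebra.norm_algebraMap,
      map_pow] at hN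
    by_contra! hcon
    have h1 : valuation F (QuadraticAlgebra.norm (z : QuadL a b c)) = 1 :=
      le_antisymm (mem_intL_iff.mp z.2).1 (not_lt.mp (mt (key z) hcon.1))
    have h2 : valuation F (QuadraticAlgebra.norm (w : QuadL a b c)) = 1 :=
      le_antisymm (mem_intL_iff.mp w.2).1 (not_lt.mp (mt (key w) hcon.2))
    rw [h1, h2, one_mul] at hN
    have h3 : valuation F (ϖ : F) ^ 2 * valuation F (QuadraticAlgebra.norm (v : QuadL a b c)) < 1 :=
      (mul_le_of_le_one_right' (mem_intL_iff.mp v.2).1).trans_lt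
        (pow_lt_one₀ zero_le hϖ.val_lt_one two_ne_zero)
    exact h3.ne hN.symm

/-- In the ramified case, the coset attached to the double zero is represented by a uniformizer of
`L`. -/
theorem ramified_coset (habc : Admissible a b c) (hϖ : IsUniformizer 𝒪[F] ϖ)
    (hs : ¬ IsSquare (disc a b c : F)) {ϖL : (QuadL a b c)ˣ} (hϖL : IsUniformizer (intL a b c) ϖL)
    {y : 𝓀[F]} (hy : valuation F (formAt a b c (residueLift y) : F) < 1) :
    valuation F (QuadraticAlgebra.norm (ϖL : QuadL a b c)) = valuation F (ϖ : F) ∧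
    ∀ {M : Type} (φ : GL (Fin 2) F → M), (∀ k ∈ integralGL 𝒪[F] F, ∀ g, φ (g * k) = φ g) →
      UnitInvariant a b c φ → φ (heckeRep ϖ (some y)) = φ (torusHom a b c ϖL) := by
  have hc := habc.c_ne_zero
  obtain ⟨t, -, -, -, -, -, ⟨w₁, hw₁, e₁⟩, ⟨w₂, hw₂, e₂⟩, hN, k, hk, h⟩ :=
    heckeRep_some_eq habc hϖ hy
  have hd : valuation F (2 * c * residueLift y + b : F) < 1 := by
    by_contra hd
    refine hs (isSquare_disc_of_simple_zero habc.isUnit_c hy ?_)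
    rw [isUnit_integer_iff]
    exact le_antisymm (2 * c * residueLift y + b : 𝒪[F]).2 (not_lt.mp hd)
  -- Compare with a generator t' whose integral coordinates are retained: t is t' times the second
  -- column of an element of K.
  have htint : (t : QuadL a b c) ∈ intL a b c := by
    obtain ⟨t', x, z, hx, hz, ht, -, -, -, k', hk', h'⟩ := heckeRep_some_eq habc hϖ hy
    have e1 : (t : QuadL a b c) = t' * colL a b c (k' * k⁻¹) 1 := by
      have h3 : torusHom a b c t = torusHom a b c t' * (k' * k⁻¹) := by
        rw [← mul_assoc, ← h', h, mul_inv_cancel_right]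
      rw [← colL_torus hc, ← h3]
      conv_rhs => rw [← mul_one (torusHom a b c t)]
      rw [colL_torus hc]
      simp [colL, betaComb_eq]
    rw [e1]
    refine mul_mem ?_ (colL_mem_intL habc (mem_integralGL_iff.mp (mul_mem hk' (inv_mem hk))).1 1)
    rw [ht]
    exact habc.betaComb_mem (val_add_le_one (val_mul_le_one hx hϖ.val_lt_one.le)
      (val_mul_le_one hz (residueLift y).2)) hz
  obtain ⟨⟨p, hpmem⟩, hp, hpe⟩ := hϖL
  have hpe : p = ϖL := hpe
  obtain ⟨x, z, hxz⟩ := exists_betaComb hc p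
  have hpN : valuation F (QuadraticAlgebra.norm p) < 1 :=
    lt_of_le_of_ne (mem_intL_iff.mp hpmem).1
      fun h1 => hp.not_isUnit (isUnit_intL_of_norm hpmem h1)
  obtain ⟨hx, hz⟩ := habc.betaComb_mem_iff.mp (hxz ▸ hpmem)
  -- Because y is a double zero, c(x - zy)² is congruent modulo 𝔭 to the form at (x, z), which is
  -- N(p) up to a unit. So the uniformizer p = x + zβ lies in the ideal generated by ϖ and y + β,
  -- that is, in t𝔬_L.
  have hx' : valuation F (x - z * residueLift y) < 1 := by
    rw [hxz, norm_betaComb hc, map_div₀, habc.val_c, div_one] at hpN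
    have hyv := (residueLift y).2
    have hxyv : valuation F (x - z * residueLift y) ≤ 1 :=
      val_sub_le_one hx (val_mul_le_one hz hyv)
    have e : (c : F) * (x - z * residueLift y) ^ 2 = (c * x ^ 2 + b * x * z + a * z ^ 2)
        - ((x - z * residueLift y) * z * (2 * c * residueLift y + b)
        + z ^ 2 * (formAt a b c (residueLift y) : F)) := by
      simp [formAt]; ring
    have h1 : valuation F ((c : F) * (x - z * residueLift y) ^ 2) < 1 := by
      rw [e]
      refine (valuation F).map_sub_lt hpN ((valuation F).map_add_lt ?_ ?_)
      · rw [map_mul]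
        exact (mul_le_of_le_one_left' (val_mul_le_one hxyv hz)).trans_lt hd
      · rw [map_mul]
        exact (mul_le_of_le_one_left' (val_pow_le_one hz)).trans_lt hy
    rw [map_mul, habc.val_c, one_mul, map_pow] at h1
    exact (pow_lt_one_iff two_ne_zero).mp h1
  set x' := (x - z * residueLift y) / ϖ with hx'def
  have hx'v : valuation F x' ≤ 1 := hϖ.div_val_le_one hx'
  have hw : algebraMap F _ x' * w₁ + algebraMap F _ z * w₂ ∈ intL a b c :=
    add_mem (mul_mem (algebraMap_mem_intL hx'v) hw₁) (mul_mem (algebraMap_mem_intL hz) hw₂)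
  have hpt : p = t * (algebraMap F _ x' * w₁ + algebraMap F _ z * w₂) := by
    have e3 : p = algebraMap F _ x' * algebraMap F _ (ϖ : F)
        + algebraMap F _ z * betaComb a b c (residueLift y : F) 1 := by
      rw [← map_mul, hx'def, div_mul_cancel₀ _ ϖ.ne_zero, hxz]
      simp only [betaComb_eq, map_sub, map_mul, map_one]
      ring
    rw [e3, e₁, e₂]; ring
  -- In the factorization p = tw of an irreducible element, t is not a unit since |N(t)| = |ϖ|;
  -- hence w is.
  have hwu : valuation F (QuadraticAlgebra.norm
      (algebraMap F _ x' * w₁ + algebraMap F _ z * w₂ : QuadL a b c)) = 1 := by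
    rcases hp.isUnit_or_isUnit (a := ⟨t, htint⟩) (b := ⟨_, hw⟩) (Subtype.ext hpt) with h1 | ⟨u, hu⟩
    · obtain ⟨u, hu⟩ := h1
      have := val_norm_unit u
      rw [hu] at this
      change valuation F (QuadraticAlgebra.norm (t : QuadL a b c)) = 1 at this
      rw [hN] at this
      exact absurd this hϖ.val_lt_one.ne
    · have := val_norm_unit u
      rw [hu] at this
      exact this
  refine ⟨?_, fun φ hφ hφ' => ?_⟩
  · rw [← hpe, hpt, map_mul, map_mul, hN, hwu, mul_one]
  · rw [h, hφ k hk]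
    exact (apply_torusHom_eq hφ' hw hwu (hpe ▸ hpt)).symm

end Classification

/-! ### The split case, and the Hecke operator at the identity -/

section Split

variable {F : Type*} [Field F] [ValuativeRel F] [TopologicalSpace F] [IsNonarchimedeanLocalField F]
  {a b c : 𝒪[F]} {ϖ : Fˣ}

/-- The projection `x + y √d ↦ x + y r` of `L = F ⊕ F` attached to a square root `r` of `d`. -/
def splitProj {r : F} (hr : r ^ 2 = (disc a b c : F)) : QuadL a b c →ₐ[F] F :=
  QuadraticAlgebra.lift ⟨r, by rw [← sq, hr]; simp⟩

theorem splitProj_apply {r : F} (hr : r ^ 2 = (disc a b c : F)) (z : QuadL a b c) :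
    splitProj hr z = z.re + z.im * r := by
  simp [splitProj, QuadraticAlgebra.lift]

theorem val_splitProj_le_one {r : F} (hr : r ^ 2 = (disc a b c : F)) {z : QuadL a b c}
    (hz : z ∈ intL a b c) : valuation F (splitProj hr z) ≤ 1 := by
  have h : IsIntegral 𝒪[F] (splitProj hr z) :=
    IsIntegral.map ((splitProj hr).restrictScalars 𝒪[F]) hz
  obtain ⟨n, hn⟩ := IsIntegrallyClosed.isIntegral_iff.mp h
  rw [← hn]
  exact n.2

theorem norm_eq_splitProj_mul {r : F} (hr : r ^ 2 = (disc a b c : F))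
    (hr' : (-r) ^ 2 = (disc a b c : F)) (z : QuadL a b c) :
    QuadraticAlgebra.norm z = splitProj hr z * splitProj hr' z := by
  rw [norm_eq, splitProj_apply, splitProj_apply]
  linear_combination z.im ^ 2 * hr

theorem mem_intL_of_splitProj {r : F} (hr : r ^ 2 = (disc a b c : F))
    (hr' : (-r) ^ 2 = (disc a b c : F)) {z : QuadL a b c} (h1 : valuation F (splitProj hr z) ≤ 1)
    (h2 : valuation F (splitProj hr' z) ≤ 1) : z ∈ intL a b c := by
  rw [mem_intL_iff, norm_eq_splitProj_mul hr hr']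
  refine ⟨val_mul_le_one h1 h2, ?_⟩
  have : QuadraticAlgebra.trace z = splitProj hr z + splitProj hr' z := by
    rw [trace_eq, splitProj_apply, splitProj_apply]; ring
  rw [this]
  exact val_add_le_one h1 h2

variable [CharZero F]

theorem splitProj_betaComb {r : F} (hr : r ^ 2 = (disc a b c : F)) (x y : F) :
    splitProj hr (betaComb a b c x y) = x + y * ((b + r) / (2 * c)) := by
  rw [splitProj_apply, betaComb]; ring

/-- In the split case, the coset attached to a zero is represented by `(ϖ, 1)` or `(1, ϖ)`. -/
theorem split_coset (habc : Admissible a b c) (hϖ : IsUniformizer 𝒪[F] ϖ)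
    {r : F} (hr : r ^ 2 = (disc a b c : F)) (hr' : (-r) ^ 2 = (disc a b c : F))
    {p : (QuadL a b c)ˣ} (hp : splitProj hr (p : QuadL a b c) = ϖ)
    (hp' : splitProj hr' (p : QuadL a b c) = 1)
    {y : 𝓀[F]} (hy : valuation F (formAt a b c (residueLift y) : F) < 1)
    (hy' : valuation F ((residueLift y : F) + (b + r) / (2 * c)) < 1)
    {M : Type} (φ : GL (Fin 2) F → M) (hφ : ∀ k ∈ integralGL 𝒪[F] F, ∀ g, φ (g * k) = φ g)
    (hφ' : UnitInvariant a b c φ) :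
    φ (heckeRep ϖ (some y)) = φ (torusHom a b c p) := by
  obtain ⟨t, x, z, hx, hz, ht, -, -, hN, k, hk, h⟩ := heckeRep_some_eq habc hϖ hy
  have hv0 : valuation F (ϖ : F) ≠ 0 := (valuation F).ne_zero_iff.mpr ϖ.ne_zero
  have htint : (t : QuadL a b c) ∈ intL a b c := by
    rw [ht]
    exact habc.betaComb_mem (val_add_le_one (val_mul_le_one hx hϖ.val_lt_one.le)
      (val_mul_le_one hz (residueLift y).2)) hz
  -- Both ϖ and y + β project into 𝔭 on the first factor, so t does too. Since |N(t)| = |ϖ|, the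
  -- quotient of t by p = (ϖ, 1) is integral with unit norm.
  have ht1 : valuation F (splitProj hr (t : QuadL a b c)) < 1 := by
    rw [ht, splitProj_betaComb]
    have e : x * ϖ + z * residueLift y + z * ((b + r) / (2 * c))
        = x * ϖ + z * ((residueLift y : F) + (b + r) / (2 * c)) := by ring
    rw [e]
    refine (valuation F).map_add_lt ?_ ?_
    · rw [map_mul]; exact (mul_le_of_le_one_left' hx).trans_lt hϖ.val_lt_one
    · rw [map_mul]; exact (mul_le_of_le_one_left' hz).trans_lt hy'
  set w : QuadL a b c := ((p⁻¹ : (QuadL a b c)ˣ) : QuadL a b c) * t with hw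
  have htw : (t : QuadL a b c) = p * w := by rw [hw, Units.mul_inv_cancel_left]
  have hw1 : splitProj hr (t : QuadL a b c) = ϖ * splitProj hr w := by rw [htw, map_mul, hp]
  have hw2 : splitProj hr' (t : QuadL a b c) = splitProj hr' w := by
    rw [htw, map_mul, hp', one_mul]
  have hwint : w ∈ intL a b c := by
    apply mem_intL_of_splitProj hr hr'
    · have := hϖ.val_le_iff.mpr ht1
      rw [hw1, map_mul] at this
      exact le_of_mul_le_mul_left (by rwa [mul_one]) (zero_lt_iff.mpr hv0)
    · rw [← hw2]; exact val_splitProj_le_one hr' htint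
  have hwN : valuation F (QuadraticAlgebra.norm w) = 1 := by
    rw [norm_eq_splitProj_mul hr hr', hw1, hw2, mul_assoc, map_mul,
      ← norm_eq_splitProj_mul hr hr'] at hN
    exact mul_left_cancel₀ hv0 (by rw [hN, mul_one])
  rw [h, hφ k hk]
  exact apply_torusHom_eq hφ' hwint hwN htw

variable [Fintype 𝓀[F]]

/-- The Hecke operator at the identity. -/
theorem exists_heckeSum_one (habc : Admissible a b c) (hϖ : IsUniformizer 𝒪[F] ϖ)
    {ϖL : (QuadL a b c)ˣ} (hϖL : IsUniformizerL ϖ ϖL) :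
    ∃ Ps : List (QuadL a b c)ˣ,
      (∀ {M : Type} [AddCommMonoid M] (φ : GL (Fin 2) F → M),
        (∀ k ∈ integralGL 𝒪[F] F, ∀ g, φ (g * k) = φ g) → UnitInvariant a b c φ →
        heckeSum ϖ φ 1 = (resCard F + 1 - Ps.length) • φ (diagPow ϖ 1)
          + (Ps.map fun p => φ (torusHom a b c p)).sum) ∧
      (splitSymbol a b c = -1 ∧ Ps = [] ∨
        splitSymbol a b c = 0 ∧ Ps = [ϖL] ∧
          valuation F (QuadraticAlgebra.norm (ϖL : QuadL a b c)) = valuation F (ϖ : F) ∨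
        splitSymbol a b c = 1 ∧ Ps = [ϖL, star ϖL] ∧
          valuation F (QuadraticAlgebra.norm (ϖL : QuadL a b c)) = valuation F (ϖ : F)) := by
  classical
  have hc := habc.c_ne_zero
  by_cases hs : IsSquare (disc a b c : F)
  · obtain ⟨r, hr, h1, h2⟩ := hϖL.2 hs
    have hr' : (-r) ^ 2 = (disc a b c : F) := by rw [neg_sq, hr]
    have hp1 : splitProj hr (ϖL : QuadL a b c) = ϖ := by rw [splitProj_apply, h1]
    have hp2 : splitProj hr' (ϖL : QuadL a b c) = 1 := by
      rw [splitProj_apply, ← h2]; ring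
    have hq1 : splitProj hr' ((star ϖL : (QuadL a b c)ˣ) : QuadL a b c) = ϖ := by
      rw [splitProj_apply, Units.coe_star, QuadraticAlgebra.re_star, QuadraticAlgebra.im_star,
        ← h1]; ring
    have hr'' : (-(-r)) ^ 2 = (disc a b c : F) := by rw [neg_sq, hr']
    have hq2 : splitProj hr'' ((star ϖL : (QuadL a b c)ˣ) : QuadL a b c) = 1 := by
      rw [splitProj_apply, Units.coe_star, QuadraticAlgebra.re_star, QuadraticAlgebra.im_star,
        ← h2]; ring
    have hrv : valuation F r = 1 := by
      have h3 := isUnit_integer_iff.mp (habc.isUnit_of_split hs)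
      rw [← hr, map_pow] at h3
      have h4 : valuation F r ≤ 1 := val_le_one_of_sq (by rw [map_pow]; exact h3.le)
      by_contra h5
      exact (pow_lt_one₀ zero_le (lt_of_le_of_ne h4 h5) two_ne_zero).ne h3
    have hβint : betaComb a b c 0 1 ∈ intL a b c := habc.betaComb_mem (by simp) (by simp)
    have hβ : valuation F ((b + r) / (2 * c) : F) ≤ 1 := by
      have := val_splitProj_le_one hr hβint
      rwa [splitProj_betaComb, zero_add, one_mul] at this
    have hβ' : valuation F ((b + -r) / (2 * c) : F) ≤ 1 := by
      have := val_splitProj_le_one hr' hβint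
      rwa [splitProj_betaComb, zero_add, one_mul] at this
    let β₁ : 𝒪[F] := ⟨_, hβ⟩
    let β₂ : 𝒪[F] := ⟨_, hβ'⟩
    -- Over F the form is c(Y + β₁)(Y + β₂) with β₁, β₂ the two projections of β, so its zeros
    -- modulo 𝔭 are -β₁ and -β₂.
    have hform : ∀ y : 𝓀[F], valuation F (formAt a b c (residueLift y) : F)
        = valuation F ((residueLift y : F) + (b + r) / (2 * c))
          * valuation F ((residueLift y : F) + (b + -r) / (2 * c)) := by
      intro y
      have e : (formAt a b c (residueLift y) : F) = c * (((residueLift y : F)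
          + (b + r) / (2 * c)) * ((residueLift y : F) + (b + -r) / (2 * c))) := by
        have h3 := hr.trans (coe_disc a b c)
        simp [formAt]
        field_simp
        linear_combination h3
      rw [e, map_mul, habc.val_c, one_mul, map_mul]
    have hres : ∀ (y : 𝓀[F]) (β : 𝒪[F]),
        valuation F ((residueLift y : F) + β) < 1 ↔ y = IsLocalRing.residue 𝒪[F] (-β) := by
      intro y β
      rw [show (residueLift y : F) + β = ((residueLift y + β : 𝒪[F]) : F) from rfl,
        ← residue_eq_zero_iff, map_add, residue_residueLift, map_neg, add_eq_zero_iff_eq_neg]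
    set y₁ := IsLocalRing.residue 𝒪[F] (-β₁) with hy₁
    set y₂ := IsLocalRing.residue 𝒪[F] (-β₂) with hy₂
    -- The zeros are distinct because β₁ - β₂ = r/c is a unit, r² = d being one.
    have hne : y₁ ≠ y₂ := by
      rw [hy₁, hy₂, ← sub_ne_zero, ← map_sub]
      apply residue_unit_ne_zero
      rw [isUnit_integer_iff]
      have : ((-β₁ - -β₂ : 𝒪[F]) : F) = -(r / c) := by
        change -((b + r) / (2 * c) : F) - -((b + -r) / (2 * c)) = _
        field_simp; ring
      rw [this, Valuation.map_neg, map_div₀, hrv, habc.val_c, div_one]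
    have hZ : ∀ y, y ∈ ({y₁, y₂} : Finset 𝓀[F]) ↔
        valuation F (formAt a b c (residueLift y) : F) < 1 := by
      intro y
      rw [Finset.mem_insert, Finset.mem_singleton, ← hres y β₁, ← hres y β₂, hform]
      have g1 : valuation F ((residueLift y : F) + (b + r) / (2 * c)) ≤ 1 :=
        val_add_le_one (residueLift y).2 hβ
      have g2 : valuation F ((residueLift y : F) + (b + -r) / (2 * c)) ≤ 1 :=
        val_add_le_one (residueLift y).2 hβ'
      constructor
      · rintro (h | h)
        · exact (mul_le_of_le_one_right' g2).trans_lt h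
        · exact (mul_le_of_le_one_left' g1).trans_lt h
      · intro h
        by_contra! hcon
        have e1 := le_antisymm g1 hcon.1
        have e2 := le_antisymm g2 hcon.2
        rw [e1, e2, one_mul] at h
        exact h.ne rfl
    refine ⟨[ϖL, star ϖL], fun φ hφ hφ' => ?_, Or.inr (Or.inr ⟨?_, rfl, ?_⟩)⟩
    · rw [heckeSum_one habc hϖ hφ hφ' {y₁, y₂} hZ, Finset.card_pair hne, Finset.sum_pair hne]
      have g1 := (hZ y₁).mp (by simp)
      have g2 := (hZ y₂).mp (by simp)
      rw [split_coset habc hϖ hr hr' hp1 hp2 g1 ((hres y₁ β₁).mpr rfl) φ hφ hφ',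
        split_coset habc hϖ hr' hr'' hq1 hq2 g2 ((hres y₂ β₂).mpr rfl) φ hφ hφ']
      simp
    · rw [splitSymbol, if_pos hs]
    · rw [norm_eq_splitProj_mul hr hr', hp1, hp2, mul_one]
  · have hϖL := hϖL.1 hs
    by_cases hp : ((𝓂[F]).map (algebraMap 𝒪[F] (intL a b c))).IsPrime
    · refine ⟨[], fun φ hφ hφ' => ?_, Or.inl ⟨?_, rfl⟩⟩
      · rw [heckeSum_one habc hϖ hφ hφ' ∅]
        · simp
        · intro y
          simpa using not_lt.mp (not_zero_of_isPrime habc hϖ hp (residueLift y))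
      · rw [splitSymbol, if_neg hs, if_pos hp]
    · have hex : ∃ y : 𝓀[F], valuation F (formAt a b c (residueLift y) : F) < 1 := by
        by_contra! hcon
        refine hp (isPrime_of_not_zero habc hϖ fun y hy => ?_)
        refine (hcon (IsLocalRing.residue 𝒪[F] y)).not_gt ?_
        rw [formAt_val_lt_iff, ← map_pow, ← map_mul, ← map_mul, ← map_add, ← map_add]
        exact residue_eq_zero_iff.mpr hy
      obtain ⟨y, hy⟩ := hex
      obtain ⟨hN, hcos⟩ := ramified_coset habc hϖ hs hϖL hy
      refine ⟨[ϖL], fun φ hφ hφ' => ?_, Or.inr (Or.inl ⟨?_, rfl, hN⟩)⟩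
      · rw [heckeSum_one habc hϖ hφ hφ' {y}]
        · simp [hcos φ hφ hφ']
        · intro y'
          rw [Finset.mem_singleton]
          exact ⟨fun h => h ▸ hy, fun h => eq_of_double_zero habc hs hy h⟩
      · rw [splitSymbol, if_neg hs, if_neg hp]

end Split

/-! ### The spherical vector of the principal series and its Hecke eigenvalue -/

section SphericalVector

variable {F : Type*} [Field F] [ValuativeRel F] [TopologicalSpace F] [IsNonarchimedeanLocalField F]

theorem isOpen_integer : IsOpen (𝒪[F] : Set F) := by
  refine AddSubgroup.isOpen_of_mem_nhds (G := F) (𝒪[F]).toAddSubgroup (g := 0) ?_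
  refine Filter.mem_of_superset
    ((IsValuativeTopology.hasBasis_nhds_zero' F).mem_of_mem (i := 1) one_ne_zero) ?_
  intro x hx
  exact le_of_lt (show valuation F x < 1 from hx)

/-- K consists of the g for which both g and g⁻¹ have integral entries. These are finitely many open
conditions. -/
theorem isOpen_integralGL : IsOpen (integralGL 𝒪[F] F : Set (GL (Fin 2) F)) := by
  have e : (integralGL 𝒪[F] F : Set (GL (Fin 2) F)) =
      (⋂ i, ⋂ j, (fun g : GL (Fin 2) F => g i j) ⁻¹' (𝒪[F] : Set F)) ∩
      (⋂ i, ⋂ j, (fun g : GL (Fin 2) F => g⁻¹ i j) ⁻¹' (𝒪[F] : Set F)) := by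
    ext g
    simp only [Set.mem_inter_iff, Set.mem_iInter, Set.mem_preimage, SetLike.mem_coe]
    constructor
    · intro hg
      exact ⟨(mem_integralGL_iff.mp hg).1, (mem_integralGL_iff.mp (inv_mem hg)).1⟩
    · rintro ⟨h1, h2⟩
      rw [mem_integralGL_iff]
      refine ⟨h1, ?_⟩
      have h3 : valuation F (g 0 0 * g 1 1 - g 0 1 * g 1 0) ≤ 1 :=
        val_sub_le_one (val_mul_le_one (h1 _ _) (h1 _ _)) (val_mul_le_one (h1 _ _) (h1 _ _))
      have h4 : valuation F (g⁻¹ 0 0 * g⁻¹ 1 1 - g⁻¹ 0 1 * g⁻¹ 1 0) ≤ 1 :=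
        val_sub_le_one (val_mul_le_one (h2 _ _) (h2 _ _)) (val_mul_le_one (h2 _ _) (h2 _ _))
      have h5 : valuation F (g 0 0 * g 1 1 - g 0 1 * g 1 0) *
          valuation F (g⁻¹ 0 0 * g⁻¹ 1 1 - g⁻¹ 0 1 * g⁻¹ 1 0) = 1 := by
        rw [← Matrix.det_fin_two, ← Matrix.det_fin_two, ← map_mul, ← Matrix.det_mul,
          ← Units.val_mul, mul_inv_cancel, Units.val_one, Matrix.det_one, map_one]
      refine le_antisymm h3 ?_
      rw [← h5]
      exact mul_le_of_le_one_right' h4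
  rw [e]
  have hcont : ∀ i j, Continuous fun g : GL (Fin 2) F => g i j := fun i j =>
    (Units.continuous_val (M := Matrix (Fin 2) (Fin 2) F)).matrix_elem i j
  refine IsOpen.inter ?_ ?_ <;>
    refine isOpen_iInter_of_finite fun i => isOpen_iInter_of_finite fun j => ?_
  · exact isOpen_integer.preimage (hcont i j)
  · exact isOpen_integer.preimage ((hcont i j).comp continuous_inv)

theorem exists_iwasawa (g : GL (Fin 2) F) :
    ∃ (u w : Fˣ) (v : F), ∃ k ∈ integralGL 𝒪[F] F, g = upperTri u v w * k := by
  have aux : ∀ g : GL (Fin 2) F, valuation F (g 1 0) ≤ valuation F (g 1 1) →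
      ∃ (u w : Fˣ) (v : F), ∃ k ∈ integralGL 𝒪[F] F, g = upperTri u v w * k := by
    intro g h
    have hd := det_coe_ne_zero g
    have h1 : g 1 1 ≠ 0 := by
      intro h0
      rw [h0, map_zero, le_zero_iff, map_eq_zero] at h
      rw [h0, h] at hd
      simp at hd
    have hr : valuation F (g 1 0 / g 1 1) ≤ 1 := by
      rw [map_div₀]; exact div_le_one_of_le₀ h zero_le
    have hu : g 0 0 - g 0 1 * (g 1 0 / g 1 1) ≠ 0 := by
      contrapose! hd
      field_simp at hd
      linear_combination hd
    refine ⟨Units.mk0 _ hu, Units.mk0 _ h1, g 0 1, mkGL 1 0 (g 1 0 / g 1 1) 1 (by simp),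
      mkGL_mem_integralGL (by simp) (by simp) hr (by simp) (by simp), ?_⟩
    apply GL_ext <;> simp [GL_mul_apply, upperTri_coe, mkGL_coe]
    field_simp
  rcases le_total (valuation F (g 1 0)) (valuation F (g 1 1)) with h | h
  · exact aux g h
  · obtain ⟨u, w, v, k, hk, e⟩ := aux (g * weyl F) (by
      simpa [GL_mul_apply, weyl, mkGL_coe] using h)
    exact ⟨u, w, v, k * (weyl F)⁻¹, mul_mem hk (inv_mem weyl_mem),
      by rw [← mul_assoc, ← e, mul_inv_cancel_right]⟩

theorem ofUnitHom_eq_of_val_eq {χ : Fˣ →* ℂˣ} (hχ : IsUnramified 𝒪[F] χ) {x y : F}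
    (h : valuation F x = valuation F y) : MulChar.ofUnitHom χ x = MulChar.ofUnitHom χ y := by
  by_cases hx : x = 0
  · have hy : y = 0 := by rw [← (valuation F).zero_iff, ← h, hx, map_zero]
    rw [hx, hy]
  · have hy : y ≠ 0 := by rw [← (valuation F).ne_zero_iff, ← h]; simpa
    lift x to Fˣ using isUnit_iff_ne_zero.mpr hx
    lift y to Fˣ using isUnit_iff_ne_zero.mpr hy
    rw [MulChar.ofUnitHom_coe, MulChar.ofUnitHom_coe, map_eq_of_val_eq hχ h]

open Classical in
/-- The entry of larger absolute value in the bottom row. -/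
def bottomMax (g : GL (Fin 2) F) : F :=
  if valuation F (g 1 0) ≤ valuation F (g 1 1) then g 1 1 else g 1 0

theorem val_bottomMax (g : GL (Fin 2) F) :
    valuation F (bottomMax g) = max (valuation F (g 1 0)) (valuation F (g 1 1)) := by
  rw [bottomMax]
  split_ifs with h
  · rw [max_eq_right h]
  · rw [max_eq_left (not_le.mp h).le]

theorem val_bottomMax_mul (g : GL (Fin 2) F) {k : GL (Fin 2) F} (hk : k ∈ integralGL 𝒪[F] F) :
    valuation F (bottomMax (g * k)) = valuation F (bottomMax g) := by
  have aux : ∀ g : GL (Fin 2) F, ∀ k ∈ integralGL 𝒪[F] F,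
      valuation F (bottomMax (g * k)) ≤ valuation F (bottomMax g) := by
    intro g k hk
    have hk' := (mem_integralGL_iff.mp hk).1
    rw [val_bottomMax, val_bottomMax]
    have : ∀ j, valuation F ((g * k) 1 j) ≤ max (valuation F (g 1 0)) (valuation F (g 1 1)) := by
      intro j
      rw [GL_mul_apply]
      refine (valuation F).map_add_le ?_ ?_
      · rw [map_mul]
        exact (mul_le_of_le_one_right' (hk' _ _)).trans (le_max_left _ _)
      · rw [map_mul]
        exact (mul_le_of_le_one_right' (hk' _ _)).trans (le_max_right _ _)
    exact max_le (this 0) (this 1)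
  refine le_antisymm (aux g k hk) ?_
  have := aux (g * k) k⁻¹ (inv_mem hk)
  rwa [mul_inv_cancel_right] at this

theorem bottomMax_upperTri_mul (u w : Fˣ) (v : F) (g : GL (Fin 2) F) :
    bottomMax (upperTri u v w * g) = w * bottomMax g := by
  have h : ∀ j, (upperTri u v w * g) 1 j = w * g 1 j := by
    intro j; simp [GL_mul_apply, upperTri_coe]
  have hw : 0 < valuation F (w : F) :=
    zero_lt_iff.mpr ((valuation F).ne_zero_iff.mpr w.ne_zero)
  rw [bottomMax, bottomMax, h, h, map_mul, map_mul]
  simp only [mul_le_mul_iff_of_pos_left hw]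
  split_ifs <;> rfl

variable (χ₁ χ₂ : Fˣ →* ℂˣ)

/-- The spherical vector in the principal series. -/
def sphericalVector (g : GL (Fin 2) F) : ℂ :=
  MulChar.ofUnitHom χ₁ ((g : Matrix (Fin 2) (Fin 2) F).det / bottomMax g)
    * MulChar.ofUnitHom χ₂ (bottomMax g)
    * (Real.sqrt (absF ((g : Matrix (Fin 2) (Fin 2) F).det / bottomMax g ^ 2)) : ℂ)

variable {χ₁ χ₂}

theorem sphericalVector_isSpherical (hχ₁ : IsUnramified 𝒪[F] χ₁) (hχ₂ : IsUnramified 𝒪[F] χ₂) :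
    IsSpherical (sphericalVector χ₁ χ₂) := by
  intro k hk g
  have h1 := val_bottomMax_mul g hk
  have h2 : valuation F ((g * k : GL (Fin 2) F) : Matrix (Fin 2) (Fin 2) F).det
      = valuation F (g : Matrix (Fin 2) (Fin 2) F).det := by
    rw [Units.val_mul, Matrix.det_mul, map_mul, val_det_of_mem_integralGL hk, mul_one]
  rw [sphericalVector, sphericalVector,
    ofUnitHom_eq_of_val_eq hχ₁ (y := (g : Matrix (Fin 2) (Fin 2) F).det / bottomMax g)
      (by rw [map_div₀, map_div₀, h1, h2]),
    ofUnitHom_eq_of_val_eq hχ₂ h1,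
    absF_eq_of_val_eq (y := (g : Matrix (Fin 2) (Fin 2) F).det / bottomMax g ^ 2)
      (by rw [map_div₀, map_div₀, map_pow, map_pow, h1, h2])]

theorem sphericalVector_mem (hχ₁ : IsUnramified 𝒪[F] χ₁) (hχ₂ : IsUnramified 𝒪[F] χ₂) :
    sphericalVector χ₁ χ₂ ∈ principalSeries χ₁ χ₂ := by
  refine ⟨fun u w v g => ?_, integralGL 𝒪[F] F, isOpen_integralGL,
    sphericalVector_isSpherical hχ₁ hχ₂⟩
  have hd : ((upperTri u v w * g : GL (Fin 2) F) : Matrix (Fin 2) (Fin 2) F).det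
      = u * w * (g : Matrix (Fin 2) (Fin 2) F).det := by
    rw [Units.val_mul, Matrix.det_mul, upperTri_coe, Matrix.det_fin_two_of]; ring
  have hw := w.ne_zero
  rw [sphericalVector, sphericalVector, hd, bottomMax_upperTri_mul]
  have e1 : (u : F) * w * (g : Matrix (Fin 2) (Fin 2) F).det / (w * bottomMax g)
      = u * ((g : Matrix (Fin 2) (Fin 2) F).det / bottomMax g) := by
    rw [mul_comm (u : F), mul_assoc, mul_div_mul_left _ _ hw, mul_div_assoc]
  have e2 : (u : F) * w * (g : Matrix (Fin 2) (Fin 2) F).det / (w * bottomMax g) ^ 2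
      = (u / w) * ((g : Matrix (Fin 2) (Fin 2) F).det / bottomMax g ^ 2) := by
    rw [mul_pow, div_mul_div_comm, sq (w : F), mul_assoc, mul_left_comm, mul_assoc,
      mul_div_mul_left _ _ hw]
  rw [e1, e2, map_mul, map_mul, MulChar.ofUnitHom_coe, MulChar.ofUnitHom_coe, absF_mul,
    Real.sqrt_mul (absF_nonneg _)]
  push_cast
  ring

theorem sphericalVector_one : sphericalVector χ₁ χ₂ 1 = 1 := by
  have : bottomMax (1 : GL (Fin 2) F) = 1 := by simp [bottomMax]
  rw [sphericalVector, this]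
  simp [absF_one]

variable [Fintype 𝓀[F]] {ϖ : Fˣ}

/-- The Hecke eigenvalue of the spherical vector. -/
def heckeEigenvalue (χ₁ χ₂ : Fˣ →* ℂˣ) (ϖ : Fˣ) : ℂ :=
  (Real.sqrt (resCard F) : ℂ) * ((χ₁ ϖ : ℂ) + χ₂ ϖ)

/-- At the identity, diag(1, ϖ) contributes √q χ₂(ϖ) and each of the q matrices [ϖ, y; 0, 1]
contributes χ₁(ϖ)/√q. The Iwasawa decomposition and left equivariance carry the relation to all g.
-/
theorem heckeSum_principalSeries (hϖ : IsUniformizer 𝒪[F] ϖ) {φ : GL (Fin 2) F → ℂ}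
    (hφ : φ ∈ principalSeries χ₁ χ₂) (hs : IsSpherical φ) (g : GL (Fin 2) F) :
    heckeSum ϖ φ g = heckeEigenvalue χ₁ χ₂ ϖ * φ g := by
  have hq : (0 : ℝ) < resCard F := by exact_mod_cast resCard_pos (F := F)
  have hone : heckeSum ϖ φ 1 = heckeEigenvalue χ₁ χ₂ ϖ * φ 1 := by
    rw [heckeSum_eq_of_weyl hϖ hs]
    have h1 : φ (1 * upperTri 1 0 ϖ) = (Real.sqrt (resCard F) : ℂ) * χ₂ ϖ * φ 1 := by
      rw [one_mul, ← mul_one (upperTri 1 0 ϖ), hφ.1]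
      have : absF (((1 : Fˣ) : F) / (ϖ : F)) = resCard F := by
        have h2 : absF (((1 : Fˣ) : F) / (ϖ : F)) * absF (ϖ : F) = 1 := by
          rw [← absF_mul, Units.val_one, one_div, inv_mul_cancel₀ ϖ.ne_zero, absF_one]
        rw [hϖ.absF_eq] at h2
        field_simp at h2
        exact h2
      rw [this, map_one, Units.val_one]
      ring
    have h2 : ∀ y : 𝓀[F], φ (1 * upperTri ϖ (residueLift y : F) 1)
        = (χ₁ ϖ : ℂ) * ((Real.sqrt (resCard F))⁻¹ : ℂ) * φ 1 := by
      intro y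
      rw [one_mul, ← mul_one (upperTri ϖ _ 1), hφ.1]
      rw [Units.val_one, div_one, hϖ.absF_eq, Real.sqrt_inv]
      simp
    simp only [h2]
    rw [h1, Finset.sum_const, Finset.card_univ, card_residueField, heckeEigenvalue, nsmul_eq_mul]
    have h3 : (resCard F : ℂ) = (Real.sqrt (resCard F) : ℂ) * Real.sqrt (resCard F) := by
      rw [← Complex.ofReal_mul, Real.mul_self_sqrt hq.le]; simp
    have h4 : (Real.sqrt (resCard F) : ℂ) ≠ 0 := by
      rw [Complex.ofReal_ne_zero]; exact (Real.sqrt_pos.mpr hq).ne'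
    have h5 : (resCard F : ℂ) * ((Real.sqrt (resCard F))⁻¹ : ℂ) = Real.sqrt (resCard F) := by
      rw [h3, mul_assoc, mul_inv_cancel₀ h4, mul_one]
    linear_combination (χ₁ ϖ : ℂ) * φ 1 * h5
  obtain ⟨u, w, v, k, hk, rfl⟩ := exists_iwasawa g
  rw [heckeSum_mul hϖ hs _ hk, hs k hk]
  have h1 : heckeSum ϖ φ (upperTri u v w) = (χ₁ u : ℂ) * (χ₂ w : ℂ)
      * (Real.sqrt (absF ((u : F) / (w : F))) : ℂ) * heckeSum ϖ φ 1 := by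
    simp only [heckeSum, Finset.mul_sum]
    exact Finset.sum_congr rfl fun i _ => by rw [hφ.1, one_mul]
  rw [h1, hone]
  conv_rhs => rw [← mul_one (upperTri u v w), hφ.1]
  ring

end SphericalVector

/-! ### Transfer of spherical vectors to the Waldspurger model -/

section WaldspurgerModel

variable {F : Type*} [Field F] [ValuativeRel F] [TopologicalSpace F] [IsNonarchimedeanLocalField F]
  [CharZero F] {a b c : 𝒪[F]} {χ₁ χ₂ : Fˣ →* ℂˣ} {Ω : (QuadL a b c)ˣ →* ℂˣ}
  {W : Submodule ℂ (GL (Fin 2) F → ℂ)} {ϖ : Fˣ}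

theorem IsWaldspurgerModel.exists_spherical_ne_zero (hW : IsWaldspurgerModel χ₁ χ₂ Ω W)
    (hχ₁ : IsUnramified 𝒪[F] χ₁) (hχ₂ : IsUnramified 𝒪[F] χ₂) :
    ∃ B ∈ W, IsSpherical B ∧ B ≠ 0 := by
  obtain ⟨e, he⟩ := hW.exists_equiv
  let φ : principalSeries χ₁ χ₂ := ⟨_, sphericalVector_mem hχ₁ hχ₂⟩
  refine ⟨e φ, (e φ).2, fun k hk g => ?_, fun h0 => ?_⟩
  · have h1 := he φ k
    have h2 : (⟨translate k φ, translate_mem_principalSeries φ.2 k⟩ : principalSeries χ₁ χ₂) = φ :=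
      Subtype.ext (funext fun h => sphericalVector_isSpherical hχ₁ hχ₂ k hk h)
    rw [h2] at h1
    exact (congrFun h1 g).symm
  · have h1 : e φ = 0 := Subtype.ext h0
    rw [LinearEquiv.map_eq_zero_iff] at h1
    have h2 := congrFun (congrArg Subtype.val h1) 1
    rw [show (φ : GL (Fin 2) F → ℂ) 1 = 1 from sphericalVector_one] at h2
    exact one_ne_zero h2

/-- The Hecke operator is a finite sum of right translations, so it commutes with the intertwining
isomorphism, and the preimage of a spherical B is spherical. -/
theorem IsWaldspurgerModel.heckeSum_eq [Fintype 𝓀[F]] (hW : IsWaldspurgerModel χ₁ χ₂ Ω W)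
    (hϖ : IsUniformizer 𝒪[F] ϖ) {B : GL (Fin 2) F → ℂ} (hB : B ∈ W) (hs : IsSpherical B)
    (g : GL (Fin 2) F) : heckeSum ϖ B g = heckeEigenvalue χ₁ χ₂ ϖ * B g := by
  obtain ⟨e, he⟩ := hW.exists_equiv
  obtain ⟨φ, hφ⟩ := e.surjective ⟨B, hB⟩
  have hφB : (e φ : GL (Fin 2) F → ℂ) = B := congrArg Subtype.val hφ
  have hφs : IsSpherical (φ : GL (Fin 2) F → ℂ) := by
    intro k hk g
    have h1 : e ⟨translate k φ, translate_mem_principalSeries φ.2 k⟩ = e φ := by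
      apply Subtype.ext
      rw [he, hφB]
      exact funext fun h => hs k hk h
    exact congrFun (congrArg Subtype.val (e.injective h1)) g
  have h1 : ∑ i, (⟨translate (heckeRep ϖ i) φ, translate_mem_principalSeries φ.2 _⟩ :
      principalSeries χ₁ χ₂) = heckeEigenvalue χ₁ χ₂ ϖ • φ := by
    apply Subtype.ext
    funext g
    have := heckeSum_principalSeries hϖ φ.2 hφs g
    rw [heckeSum] at this
    simpa [translate, Finset.sum_apply] using this
  have h2 := congrArg (fun x => (e x : GL (Fin 2) F → ℂ) g) h1
  simp only [map_sum, map_smul, Submodule.coe_sum, Submodule.coe_smul, Finset.sum_apply, he,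
    hφB, Pi.smul_apply, smul_eq_mul] at h2
  exact h2

end WaldspurgerModel

/-! ### Recurrences, existence and uniqueness of the spherical function -/

section SphericalFunction

variable {F : Type*} [Field F] [ValuativeRel F] [TopologicalSpace F] [IsNonarchimedeanLocalField F]
  [CharZero F] {a b c : 𝒪[F]} {χ₁ χ₂ : Fˣ →* ℂˣ} {Ω : (QuadL a b c)ˣ →* ℂˣ}
  {W : Submodule ℂ (GL (Fin 2) F → ℂ)} {ϖ : Fˣ}

theorem IsWaldspurgerModel.unitInvariant (hW : IsWaldspurgerModel χ₁ χ₂ Ω W)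
    (hΩ : IsUnramified (intL a b c) Ω) {B : GL (Fin 2) F → ℂ} (hB : B ∈ W) :
    UnitInvariant a b c B := by
  intro t ht hn g
  rw [hW.equivariant B hB, map_eq_one_of_norm hΩ ht hn, Units.val_one, one_mul]

variable [Fintype 𝓀[F]]

theorem IsWaldspurgerModel.recurrence (hW : IsWaldspurgerModel χ₁ χ₂ Ω W)
    (habc : Admissible a b c) (hϖ : IsUniformizer 𝒪[F] ϖ) (hΩ : IsUnramified (intL a b c) Ω)
    {B : GL (Fin 2) F → ℂ} (hB : B ∈ W) (hs : IsSpherical B) (n : ℕ) :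
    (resCard F : ℂ) * B (diagPow ϖ (n + 2)) + Ω (scalarL a b c ϖ) * B (diagPow ϖ n)
      = heckeEigenvalue χ₁ χ₂ ϖ * B (diagPow ϖ (n + 1)) := by
  rw [← hW.heckeSum_eq hϖ hB hs,
    heckeSum_diagPow_succ habc hϖ hs (hW.unitInvariant hΩ hB), hW.equivariant B hB, nsmul_eq_mul]

theorem IsWaldspurgerModel.recurrence_zero (hW : IsWaldspurgerModel χ₁ χ₂ Ω W)
    (hϖ : IsUniformizer 𝒪[F] ϖ)
    {B : GL (Fin 2) F → ℂ} (hB : B ∈ W) (hs : IsSpherical B) {Ps : List (QuadL a b c)ˣ}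
    (hPs : heckeSum ϖ B 1 = (resCard F + 1 - Ps.length) • B (diagPow ϖ 1)
          + (Ps.map fun p => B (torusHom a b c p)).sum) :
    ((resCard F + 1 - Ps.length : ℕ) : ℂ) * B (diagPow ϖ 1)
      + (Ps.map fun p => (Ω p : ℂ)).sum * B 1 = heckeEigenvalue χ₁ χ₂ ϖ * B 1 := by
  have h1 : (Ps.map fun p => B (torusHom a b c p)).sum = (Ps.map fun p => (Ω p : ℂ)).sum * B 1 := by
    rw [← List.sum_map_mul_right]
    congr 1
    apply List.map_congr_left
    intro p _
    rw [← hW.equivariant B hB, mul_one]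
  rw [← hW.heckeSum_eq hϖ hB hs, hPs, h1, nsmul_eq_mul]

/-- The leading coefficients q and q + 1 - #Ps are nonzero, as q ≥ 2 and #Ps ≤ 2. So the recurrences
propagate zero to all levels, and the double coset decomposition to the whole group. -/
theorem IsWaldspurgerModel.eq_zero_of_apply_one (hW : IsWaldspurgerModel χ₁ χ₂ Ω W)
    (habc : Admissible a b c) (hϖ : IsUniformizer 𝒪[F] ϖ) (hΩ : IsUnramified (intL a b c) Ω)
    {B : GL (Fin 2) F → ℂ} (hB : B ∈ W) (hs : IsSpherical B) {Ps : List (QuadL a b c)ˣ}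
    (hlen : Ps.length ≤ 2)
    (hPs : heckeSum ϖ B 1 = (resCard F + 1 - Ps.length) • B (diagPow ϖ 1)
          + (Ps.map fun p => B (torusHom a b c p)).sum) (h1 : B 1 = 0) : B = 0 := by
  have hq : (resCard F : ℂ) ≠ 0 := by exact_mod_cast (resCard_pos (F := F)).ne'
  have hN : ((resCard F + 1 - Ps.length : ℕ) : ℂ) ≠ 0 := by
    have := one_lt_resCard (F := F)
    rw [Nat.cast_ne_zero]; omega
  have h2 : B (diagPow ϖ 1) = 0 := by
    have := hW.recurrence_zero hϖ hB hs hPs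
    rw [h1, mul_zero, mul_zero, add_zero] at this
    exact (mul_eq_zero.mp this).resolve_left hN
  have h3 : ∀ n, B (diagPow ϖ n) = 0 ∧ B (diagPow ϖ (n + 1)) = 0 := by
    intro n
    induction n with
    | zero => exact ⟨by rw [diagPow_zero, h1], h2⟩
    | succ n ih =>
      refine ⟨ih.2, ?_⟩
      have := hW.recurrence habc hϖ hΩ hB hs n
      rw [ih.1, ih.2, mul_zero, mul_zero, add_zero] at this
      exact (mul_eq_zero.mp this).resolve_left hq
  funext g
  obtain ⟨t, m, k, hk, rfl⟩ := exists_torus_mul_diagPow_mul habc hϖ g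
  rw [hs k hk, hW.equivariant B hB, (h3 m).1, mul_zero, Pi.zero_apply]

theorem IsWaldspurgerModel.existsUnique_spherical (hW : IsWaldspurgerModel χ₁ χ₂ Ω W)
    (hχ₁ : IsUnramified 𝒪[F] χ₁) (hχ₂ : IsUnramified 𝒪[F] χ₂)
    (habc : Admissible a b c) (hϖ : IsUniformizer 𝒪[F] ϖ) (hΩ : IsUnramified (intL a b c) Ω)
    {Ps : List (QuadL a b c)ˣ} (hlen : Ps.length ≤ 2)
    (hPs : ∀ B ∈ W, IsSpherical B →
      heckeSum ϖ B 1 = (resCard F + 1 - Ps.length) • B (diagPow ϖ 1)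
        + (Ps.map fun p => B (torusHom a b c p)).sum) :
    ∃! B₀ : GL (Fin 2) F → ℂ, B₀ ∈ W ∧ IsSpherical B₀ ∧ B₀ 1 = 1 := by
  obtain ⟨B, hB, hs, h0⟩ := hW.exists_spherical_ne_zero hχ₁ hχ₂
  have h1 : B 1 ≠ 0 := fun h =>
    h0 (hW.eq_zero_of_apply_one habc hϖ hΩ hB hs hlen (hPs B hB hs) h)
  have hsph : IsSpherical ((B 1)⁻¹ • B) := fun k hk g => by
    simp only [Pi.smul_apply, hs k hk]
  have hone : ((B 1)⁻¹ • B) 1 = 1 := by simp [h1]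
  refine ⟨(B 1)⁻¹ • B, ⟨W.smul_mem _ hB, hsph, hone⟩, ?_⟩
  rintro B' ⟨hB', hs', h1'⟩
  have hsub := W.sub_mem hB' (W.smul_mem (B 1)⁻¹ hB)
  have hssub : IsSpherical (B' - (B 1)⁻¹ • B) := fun k hk g => by
    rw [Pi.sub_apply, Pi.sub_apply, hs' k hk, hsph k hk]
  exact sub_eq_zero.mp (hW.eq_zero_of_apply_one habc hϖ hΩ hsub hssub hlen (hPs _ hsub hssub)
    (by rw [Pi.sub_apply, h1', hone, sub_self]))

end SphericalFunction

/-! ### The unramified section along η h -/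

section Section

variable {F : Type*} [Field F] [ValuativeRel F] [TopologicalSpace F] [IsNonarchimedeanLocalField F]
  {a b c : 𝒪[F]} {Ω₁ Ω₂ : (QuadL a b c)ˣ →* ℂˣ} {ϖ : Fˣ}

theorem absL_nonneg (z : QuadL a b c) : 0 ≤ absL z := absF_nonneg _

theorem borelChar_mul (s : ℂ) (u u' w w' : (QuadL a b c)ˣ) :
    borelChar Ω₁ Ω₂ s (u * u') (w * w') = borelChar Ω₁ Ω₂ s u w * borelChar Ω₁ Ω₂ s u' w' := by
  rw [borelChar, borelChar, borelChar, mul_div_mul_comm, Units.val_mul, absL_mul,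
    Complex.ofReal_mul, Complex.mul_cpow_ofReal_nonneg (absL_nonneg _) (absL_nonneg _),
    map_mul, map_mul, Units.val_mul, Units.val_mul]
  ring

theorem borelChar_one (s : ℂ) : borelChar Ω₁ Ω₂ s 1 1 = 1 := by
  have : absL ((1 : QuadL a b c)) = 1 := by rw [absL, map_one, absF_one]
  simp [borelChar, this]

theorem borelChar_pow (s : ℂ) (u : (QuadL a b c)ˣ) (m : ℕ) :
    borelChar Ω₁ Ω₂ s (u ^ m) 1 = borelChar Ω₁ Ω₂ s u 1 ^ m := by
  induction m with
  | zero => rw [pow_zero, pow_zero, borelChar_one]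
  | succ m ih => rw [pow_succ, pow_succ, ← ih, ← borelChar_mul, mul_one]

theorem upperTri_mul {R : Type*} [CommRing R] (u u' w w' : Rˣ) (v v' : R) :
    upperTri u v w * upperTri u' v' w' = upperTri (u * u') (u * v' + v * w') (w * w') := by
  apply GL_ext <;> simp [GL_mul_apply, upperTri_coe]

theorem upperTri_inv_mul {R : Type*} [CommRing R] (u w : Rˣ) (v : R) :
    upperTri u⁻¹ (-(u⁻¹ * v * w⁻¹ : R)) w⁻¹ * upperTri u v w = 1 := by
  rw [upperTri_mul]
  apply GL_ext <;> simp [upperTri_coe]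

/-- Having an Iwasawa decomposition is invariant under left translation by the Borel subgroup, so
the default value 0 is consistent with the formula, and existence of the decomposition over L is not
needed. -/
theorem sphericalSection_upperTri_mul (h₁ : IsUnramified (intL a b c) Ω₁)
    (h₂ : IsUnramified (intL a b c) Ω₂) (s : ℂ) (u w : (QuadL a b c)ˣ) (v : QuadL a b c)
    (g : GL (Fin 2) (QuadL a b c)) :
    sphericalSection Ω₁ Ω₂ s (upperTri u v w * g)
      = borelChar Ω₁ Ω₂ s u w * sphericalSection Ω₁ Ω₂ s g := by
  by_cases hg : ∃ p, IsIwasawa g p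
  · obtain ⟨⟨u', v', w'⟩, k, hk, rfl⟩ := hg
    rw [← mul_assoc, upperTri_mul, sphericalSection_apply h₁ h₂ s _ _ _ hk,
      sphericalSection_apply h₁ h₂ s _ _ _ hk, borelChar_mul]
  · have hg' : ¬ ∃ p, IsIwasawa (upperTri u v w * g) p := by
      rintro ⟨⟨u', v', w'⟩, k, hk, h⟩
      refine hg ⟨(u⁻¹ * u', u⁻¹ * v' + -(u⁻¹ * v * w⁻¹) * w', w⁻¹ * w'), k, hk, ?_⟩
      calc g = upperTri u⁻¹ (-(u⁻¹ * v * w⁻¹ : QuadL a b c)) w⁻¹ * upperTri u v w * g := by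
              rw [upperTri_inv_mul, one_mul]
        _ = _ := by rw [mul_assoc, h, ← mul_assoc, upperTri_mul]
    rw [sphericalSection, dif_neg hg', sphericalSection, dif_neg hg, mul_zero]

theorem sphericalSection_mul_integral (h₁ : IsUnramified (intL a b c) Ω₁)
    (h₂ : IsUnramified (intL a b c) Ω₂) (s : ℂ) (g : GL (Fin 2) (QuadL a b c))
    {k : GL (Fin 2) (QuadL a b c)} (hk : k ∈ integralGL (intL a b c) (QuadL a b c)) :
    sphericalSection Ω₁ Ω₂ s (g * k) = sphericalSection Ω₁ Ω₂ s g := by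
  by_cases hg : ∃ p, IsIwasawa g p
  · obtain ⟨⟨u', v', w'⟩, k', hk', rfl⟩ := hg
    rw [mul_assoc, sphericalSection_apply h₁ h₂ s _ _ _ hk',
      sphericalSection_apply h₁ h₂ s _ _ _ (mul_mem hk' hk)]
  · have hg' : ¬ ∃ p, IsIwasawa (g * k) p := by
      rintro ⟨p, k', hk', h⟩
      exact hg ⟨p, k' * k⁻¹, mul_mem hk' (inv_mem hk), by rw [← mul_assoc, ← h,
        mul_inv_cancel_right]⟩
    rw [sphericalSection, dif_neg hg', sphericalSection, dif_neg hg]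

theorem map_integralGL {k : GL (Fin 2) F} (hk : k ∈ integralGL 𝒪[F] F) :
    Matrix.GeneralLinearGroup.map (algebraMap F (QuadL a b c)) k
      ∈ integralGL (intL a b c) (QuadL a b c) := by
  obtain ⟨κ, rfl⟩ := hk
  refine ⟨Matrix.GeneralLinearGroup.map (algebraMap 𝒪[F] (intL a b c)) κ, ?_⟩
  exact GL_ext rfl rfl rfl rfl

theorem lowerUnip_mem {x : QuadL a b c} (hx : x ∈ intL a b c) :
    lowerUnip x ∈ integralGL (intL a b c) (QuadL a b c) := by
  refine ⟨lowerUnip ⟨x, hx⟩, ?_⟩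
  apply GL_ext <;> simp [lowerUnip]

theorem absL_scalarL (hϖ : IsUniformizer 𝒪[F] ϖ) :
    absL (algebraMap F (QuadL a b c) (ϖ : F)) = (resCard F : ℝ)⁻¹ * (resCard F : ℝ)⁻¹ := by
  rw [absL, QuadraticAlgebra.norm_algebraMap, sq, absF_mul, hϖ.absF_eq]

/-- Since N(ϖ) = ϖ², |ϖ|_L = q⁻², and the exponent s + 1/2 becomes 2s + 1. -/
theorem borelChar_scalarL (hϖ : IsUniformizer 𝒪[F] ϖ) (s : ℂ) :
    borelChar Ω₁ Ω₂ s (scalarL a b c ϖ) 1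
      = (restrictF Ω₁ ϖ : ℂ) * (resCard F : ℂ) ^ (-(2 * s + 1)) := by
  have hq : (resCard F : ℂ) ≠ 0 := by exact_mod_cast (resCard_pos (F := F)).ne'
  have hq' : (0 : ℝ) ≤ (resCard F : ℝ)⁻¹ := by positivity
  rw [borelChar, div_one]
  have e : ((scalarL a b c ϖ : (QuadL a b c)ˣ) : QuadL a b c) = algebraMap F _ (ϖ : F) := rfl
  rw [e, absL_scalarL hϖ, Complex.ofReal_mul, Complex.mul_cpow_ofReal_nonneg hq' hq']
  have h1 : (((resCard F : ℝ)⁻¹ : ℝ) : ℂ) ^ (s + 1 / 2) = (resCard F : ℂ) ^ (-(s + 1 / 2)) := by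
    rw [Complex.ofReal_inv, Complex.ofReal_natCast, Complex.inv_cpow, Complex.cpow_neg]
    rw [Complex.natCast_arg]
    exact Real.pi_pos.ne
  rw [h1, ← Complex.cpow_add _ _ hq, map_one, Units.val_one, mul_one]
  congr 2
  ring

variable [CharZero F]

theorem absL_star_div (z : (QuadL a b c)ˣ) :
    absL ((star z / z : (QuadL a b c)ˣ) : QuadL a b c) = 1 := by
  have h1 : absL ((star z / z : (QuadL a b c)ˣ) : QuadL a b c) * absL (z : QuadL a b c)
      = absL (z : QuadL a b c) := by
    rw [← absL_mul, ← Units.val_mul, div_mul_cancel, Units.coe_star, absL,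
      QuadraticAlgebra.norm_star, absL]
  have h2 : absL (z : QuadL a b c) ≠ 0 := (absF_pos (norm_unit_ne_zero z)).ne'
  exact mul_right_cancel₀ h2 (by rw [h1, one_mul])

/-- The row (β, 1) is a left eigenvector of the torus with eigenvalue z, so η conjugates the torus
into the Borel subgroup with diagonal (z̄, z). The section then transforms by Ω₁(z̄)Ω₂(z) = Ω(z)⁻¹,
because |z̄/z|_L = 1. -/
theorem lowerUnip_mul_torus (habc : Admissible a b c) (z : (QuadL a b c)ˣ) :
    lowerUnip (beta a b c) * Matrix.GeneralLinearGroup.map (algebraMap F (QuadL a b c))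
        (torusHom a b c z)
      = upperTri (star z) (algebraMap F _ (2 * (z : QuadL a b c).im * c)) z
        * lowerUnip (beta a b c) := by
  have hc := habc.c_ne_zero
  have hd := coe_disc a b c
  have l : (lowerUnip (beta a b c) : Matrix (Fin 2) (Fin 2) (QuadL a b c))
      = !![1, 0; beta a b c, 1] := rfl
  have m : ∀ i j, Matrix.GeneralLinearGroup.map (algebraMap F (QuadL a b c))
      (torusHom a b c z) i j = algebraMap F _ (torusHom a b c z i j) := fun i j => rfl
  apply GL_ext <;> simp only [GL_mul_apply, m, torusHom_val, upperTri_coe, l, matXi] <;>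
    apply QuadraticAlgebra.ext <;>
    simp [beta, -AddSubgroupClass.coe_sub] <;>
    field_simp <;>
    first | ring1 | linear_combination -(z : QuadL a b c).im * hd

theorem zetaFun_torus_mul (habc : Admissible a b c) (h₁ : IsUnramified (intL a b c) Ω₁)
    (h₂ : IsUnramified (intL a b c) Ω₂) {B : GL (Fin 2) F → ℂ}
    (hB : ∀ (z : (QuadL a b c)ˣ) (g : GL (Fin 2) F),
      B (torusHom a b c z * g) = (charOmega Ω₁ Ω₂ z : ℂ) * B g) (s : ℂ) (z : (QuadL a b c)ˣ)
    (h : GL (Fin 2) F) :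
    zetaFun Ω₁ Ω₂ B s (torusHom a b c z * h) = zetaFun Ω₁ Ω₂ B s h := by
  rw [zetaFun, zetaFun, hB, map_mul, ← mul_assoc (lowerUnip _), lowerUnip_mul_torus habc,
    mul_assoc (upperTri _ _ _),
    sphericalSection_upperTri_mul h₁ h₂, borelChar, absL_star_div]
  have e : Units.map (starRingEnd (QuadL a b c) : QuadL a b c →* QuadL a b c) z = star z :=
    Units.ext rfl
  have h1 : (Ω₁ (star z) : ℂ) * (Ω₂ z : ℂ) * (charOmega Ω₁ Ω₂ z : ℂ) = 1 := by
    rw [← Units.val_mul, ← Units.val_mul, charOmega, MonoidHom.mul_apply, MonoidHom.inv_apply,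
      MonoidHom.inv_apply, MonoidHom.comp_apply, e, ← Units.val_one]
    congr 1
    rw [← mul_inv, mul_inv_cancel]
  rw [Complex.ofReal_one, Complex.one_cpow, mul_one]
  linear_combination sphericalSection Ω₁ Ω₂ s (lowerUnip (beta a b c)
    * Matrix.GeneralLinearGroup.map (algebraMap F (QuadL a b c)) h) * B h * h1

theorem zetaFun_mul_integral (h₁ : IsUnramified (intL a b c) Ω₁)
    (h₂ : IsUnramified (intL a b c) Ω₂) {B : GL (Fin 2) F → ℂ} (hB : IsSpherical B) (s : ℂ)
    {k : GL (Fin 2) F} (hk : k ∈ integralGL 𝒪[F] F) (h : GL (Fin 2) F) :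
    zetaFun Ω₁ Ω₂ B s (h * k) = zetaFun Ω₁ Ω₂ B s h := by
  rw [zetaFun, zetaFun, hB k hk, map_mul, ← mul_assoc,
    sphericalSection_mul_integral h₁ h₂ s _ (map_integralGL hk)]

/-- Moving diag(ϖᵐ, 1) to the left of η replaces β by the integral element βϖᵐ, which gives an
Iwasawa decomposition. -/
theorem zetaFun_diagPow (habc : Admissible a b c) (hϖ : IsUniformizer 𝒪[F] ϖ)
    (h₁ : IsUnramified (intL a b c) Ω₁)
    (h₂ : IsUnramified (intL a b c) Ω₂) (B : GL (Fin 2) F → ℂ) (s : ℂ) (m : ℕ) :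
    zetaFun Ω₁ Ω₂ B s (diagPow ϖ m)
      = ((restrictF Ω₁ ϖ : ℂ) * (resCard F : ℂ) ^ (-(2 * s + 1))) ^ m * B (diagPow ϖ m) := by
  have e : lowerUnip (beta a b c) * Matrix.GeneralLinearGroup.map (algebraMap F (QuadL a b c))
      (diagPow ϖ m) = upperTri (scalarL a b c ϖ ^ m) 0 1
        * lowerUnip (beta a b c * algebraMap F _ (ϖ : F) ^ m) := by
    apply GL_ext <;> simp [GL_mul_apply, lowerUnip, diagPow, upperTri_coe]
  have hβ : beta a b c ∈ intL a b c := by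
    have : beta a b c = betaComb a b c 0 1 := by simp [betaComb_eq]
    rw [this]
    exact habc.betaComb_mem (by simp) (by simp)
  have hmem : beta a b c * algebraMap F _ (ϖ : F) ^ m ∈ intL a b c :=
    mul_mem hβ (pow_mem (algebraMap_mem_intL hϖ.val_lt_one.le) m)
  rw [zetaFun, e, sphericalSection_apply h₁ h₂ s _ _ _ (lowerUnip_mem hmem), borelChar_pow,
    borelChar_scalarL hϖ]

end Section

/-! ### The level on the quotient and the volumes of its fibres -/

section Level

variable {F : Type*} [Field F] [ValuativeRel F] [TopologicalSpace F] [IsNonarchimedeanLocalField F]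
  [CharZero F] {a b c : 𝒪[F]} {ϖ : Fˣ}

/-- The index `m` of the double coset of `diag(ϖ ^ m, 1)` that contains `g`. -/
def level (habc : Admissible a b c) (hϖ : IsUniformizer 𝒪[F] ϖ) (g : GL (Fin 2) F) : ℕ :=
  (exists_torus_mul_diagPow_mul habc hϖ g).choose_spec.choose

variable (habc : Admissible a b c) (hϖ : IsUniformizer 𝒪[F] ϖ)

theorem level_mul (t : (QuadL a b c)ˣ) (m : ℕ) {k : GL (Fin 2) F} (hk : k ∈ integralGL 𝒪[F] F) :
    level habc hϖ (torusHom a b c t * diagPow ϖ m * k) = m := by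
  obtain ⟨k', hk', h⟩ := (exists_torus_mul_diagPow_mul habc hϖ
    (torusHom a b c t * diagPow ϖ m * k)).choose_spec.choose_spec
  exact (diagPow_index_unique habc hϖ hk hk' h).symm

theorem level_diagPow (m : ℕ) : level habc hϖ (diagPow ϖ m) = m := by
  have := level_mul habc hϖ 1 m (one_mem _)
  rwa [map_one, one_mul, mul_one] at this

theorem level_torus_mul (t : (QuadL a b c)ˣ) (g : GL (Fin 2) F) :
    level habc hϖ (torusHom a b c t * g) = level habc hϖ g := by
  obtain ⟨t', m, k, hk, rfl⟩ := exists_torus_mul_diagPow_mul habc hϖ g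
  rw [level_mul habc hϖ _ _ hk, ← mul_assoc, ← mul_assoc, ← map_mul, level_mul habc hϖ _ _ hk]

theorem level_mul_integral (g : GL (Fin 2) F) {k : GL (Fin 2) F} (hk : k ∈ integralGL 𝒪[F] F) :
    level habc hϖ (g * k) = level habc hϖ g := by
  obtain ⟨t', m, k', hk', rfl⟩ := exists_torus_mul_diagPow_mul habc hϖ g
  rw [level_mul habc hϖ _ _ hk', mul_assoc, level_mul habc hϖ _ _ (mul_mem hk' hk)]

theorem level_one : level habc hϖ 1 = 0 := by
  rw [← diagPow_zero ϖ, level_diagPow]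

theorem exists_torusHom_eq (habc : Admissible a b c) {t : GL (Fin 2) F} (ht : t ∈ torus a b c) :
    ∃ z, torusHom a b c z = t := by
  rw [← range_torusHom a b c habc.isUnit_c] at ht
  exact ht

/-- The level as a function on `T(F) \ GL₂(F)`. -/
def quotLevel : TorusQuot a b c → ℕ :=
  Quotient.lift (level habc hϖ) fun x y hxy => by
    have h : y * x⁻¹ ∈ torus a b c := QuotientGroup.rightRel_apply.mp hxy
    obtain ⟨z, hz⟩ := exists_torusHom_eq habc h
    rw [← level_torus_mul habc hϖ z x, hz, inv_mul_cancel_right]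

theorem quotLevel_mk (g : GL (Fin 2) F) :
    quotLevel habc hϖ (Quotient.mk _ g : TorusQuot a b c) = level habc hϖ g := rfl

theorem level_out (x : TorusQuot a b c) : level habc hϖ x.out = quotLevel habc hϖ x := by
  rw [← quotLevel_mk, Quotient.out_eq]

theorem isOpen_of_integral_invariant {s : Set (GL (Fin 2) F)}
    (hs : ∀ g ∈ s, ∀ k ∈ integralGL 𝒪[F] F, g * k ∈ s) : IsOpen s := by
  rw [isOpen_iff_mem_nhds]
  intro g hg
  have h1 : IsOpen ((fun h => g⁻¹ * h) ⁻¹' (integralGL 𝒪[F] F : Set (GL (Fin 2) F))) :=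
    isOpen_integralGL.preimage (continuous_const_mul g⁻¹)
  refine Filter.mem_of_superset (h1.mem_nhds (by simp [one_mem])) fun h hh => ?_
  have := hs g hg _ hh
  rwa [mul_inv_cancel_left] at this

variable [MeasurableSpace (TorusQuot a b c)] [BorelSpace (TorusQuot a b c)]

theorem measurableSet_quot {s : Set (TorusQuot a b c)}
    (hs : ∀ g : GL (Fin 2) F, (Quotient.mk _ g : TorusQuot a b c) ∈ s →
      ∀ k ∈ integralGL 𝒪[F] F, (Quotient.mk _ (g * k) : TorusQuot a b c) ∈ s) :
    MeasurableSet s := by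
  apply IsOpen.measurableSet
  rw [← isQuotientMap_quotient_mk'.isOpen_preimage]
  exact isOpen_of_integral_invariant fun g hg k hk => hs g hg k hk

theorem measurable_quotLevel : Measurable (quotLevel habc hϖ) := by
  refine measurable_to_countable' fun m => measurableSet_quot fun g hg k hk => ?_
  change level habc hϖ (g * k) = m
  rw [level_mul_integral habc hϖ g hk]
  exact hg

variable {μ : Measure (TorusQuot a b c)} (hμ : IsNormalizedInvariant μ)

theorem measurableSet_level_pair (m n : ℕ) (d : GL (Fin 2) F)
    (hd : Measurable (quotTranslate a b c d)) :
    MeasurableSet {x : TorusQuot a b c |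
      quotLevel habc hϖ x = m ∧ quotLevel habc hϖ (quotTranslate a b c d x) = n} :=
  (measurable_quotLevel habc hϖ (measurableSet_singleton m)).inter
    (((measurable_quotLevel habc hϖ).comp hd) (measurableSet_singleton n))

include hμ in
theorem measure_quotLevel_zero : μ {x | quotLevel habc hϖ x = 0} = 1 := by
  rw [← hμ.measure_image_K]
  congr 1
  ext x
  induction x using Quotient.inductionOn with | _ g
  constructor
  · intro hg
    obtain ⟨t, m, k, hk, rfl⟩ := exists_torus_mul_diagPow_mul habc hϖ g
    have hm : m = 0 := by
      rw [← level_mul habc hϖ t m hk]; exact hg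
    subst hm
    refine ⟨k, hk, Quotient.sound ?_⟩
    refine QuotientGroup.rightRel_apply.mpr ?_
    rw [diagPow_zero, mul_one, mul_inv_cancel_right, ← range_torusHom a b c habc.isUnit_c]
    exact ⟨t, rfl⟩
  · rintro ⟨k, hk, h⟩
    change quotLevel habc hϖ (Quotient.mk _ g) = 0
    rw [← h, quotLevel_mk, ← one_mul k, level_mul_integral habc hϖ 1 hk, level_one]

include hμ in
-- The substitution x ↦ xk preserves both μ and the level, so all representatives of K diag(ϖ, 1) K
-- count equally.
theorem measure_pair_mul_left (m n : ℕ) {k : GL (Fin 2) F} (hk : k ∈ integralGL 𝒪[F] F)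
    (d : GL (Fin 2) F) :
    μ {x | quotLevel habc hϖ x = m ∧ quotLevel habc hϖ (quotTranslate a b c (k * d) x) = n}
      = μ {x | quotLevel habc hϖ x = m ∧ quotLevel habc hϖ (quotTranslate a b c d x) = n} := by
  rw [← (hμ.measurePreserving k).measure_preimage (measurableSet_level_pair habc hϖ m n d
    (hμ.measurePreserving d).measurable).nullMeasurableSet]
  congr 1
  ext x
  induction x using Quotient.inductionOn with | _ g
  change level habc hϖ g = m ∧ level habc hϖ (g * (k * d)) = n ↔
    level habc hϖ (g * k) = m ∧ level habc hϖ (g * k * d) = n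
  rw [level_mul_integral habc hϖ g hk, mul_assoc]

include hμ in
-- With w = [0, 1; 1, 0] one has diag(ϖ, 1) w diag(ϖ, 1) = ϖw. Hence the substitution x ↦ x diag(ϖ,
-- 1) exchanges the two points of a pair, the scalar ϖ being absorbed by the torus.
theorem measure_pair_symm (m n : ℕ) :
    μ {x | quotLevel habc hϖ x = m ∧
        quotLevel habc hϖ (quotTranslate a b c (diagPow ϖ 1) x) = n}
      = μ {x | quotLevel habc hϖ x = n ∧
        quotLevel habc hϖ (quotTranslate a b c (diagPow ϖ 1) x) = m} := by
  rw [← measure_pair_mul_left habc hϖ hμ n m weyl_mem (diagPow ϖ 1),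
    ← (hμ.measurePreserving (diagPow ϖ 1)).measure_preimage (measurableSet_level_pair habc hϖ n m
      (weyl F * diagPow ϖ 1) (hμ.measurePreserving _).measurable).nullMeasurableSet]
  congr 1
  ext x
  induction x using Quotient.inductionOn with | _ g
  change level habc hϖ g = m ∧ level habc hϖ (g * diagPow ϖ 1) = n ↔
    level habc hϖ (g * diagPow ϖ 1) = n ∧
      level habc hϖ (g * diagPow ϖ 1 * (weyl F * diagPow ϖ 1)) = m
  have e : g * diagPow ϖ 1 * (weyl F * diagPow ϖ 1)
      = torusHom a b c (scalarL a b c ϖ) * g * weyl F := by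
    rw [torusHom_scalarL]
    apply GL_ext <;> simp [GL_mul_apply, diagPow, weyl, mkGL_coe, upperTri_coe] <;> ring
  rw [e, level_mul_integral habc hϖ _ weyl_mem, level_torus_mul, and_comm]

variable [Fintype 𝓀[F]]

/-- The indicator function of the set of level `n`. -/
def levelIndicator (n : ℕ) (g : GL (Fin 2) F) : ENNReal :=
  if level habc hϖ g = n then 1 else 0

theorem levelIndicator_mul_integral (n : ℕ) :
    ∀ k ∈ integralGL 𝒪[F] F, ∀ g,
      levelIndicator habc hϖ n (g * k) = levelIndicator habc hϖ n g := by
  intro k hk g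
  rw [levelIndicator, level_mul_integral habc hϖ g hk, levelIndicator]

theorem levelIndicator_torus_mul (n : ℕ) (t : (QuadL a b c)ˣ) (g : GL (Fin 2) F) :
    levelIndicator habc hϖ n (torusHom a b c t * g) = levelIndicator habc hϖ n g := by
  rw [levelIndicator, level_torus_mul, levelIndicator]

theorem levelIndicator_unitInvariant (n : ℕ) :
    UnitInvariant a b c (levelIndicator habc hϖ n) :=
  fun t _ _ g => levelIndicator_torus_mul habc hϖ n t g

theorem levelIndicator_diagPow (n m : ℕ) :
    levelIndicator habc hϖ n (diagPow ϖ m) = if m = n then 1 else 0 := by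
  rw [levelIndicator, level_diagPow]

theorem heckeSum_levelIndicator (n : ℕ) (g : GL (Fin 2) F) :
    heckeSum ϖ (levelIndicator habc hϖ n) g
      = heckeSum ϖ (levelIndicator habc hϖ n) (diagPow ϖ (level habc hϖ g)) := by
  obtain ⟨t, m, k, hk, rfl⟩ := exists_torus_mul_diagPow_mul habc hϖ g
  rw [level_mul habc hϖ _ _ hk, heckeSum_mul hϖ (levelIndicator_mul_integral habc hϖ n) _ hk]
  simp only [heckeSum, mul_assoc, levelIndicator_torus_mul]

theorem heckeRep_eq_mul (i : Option 𝓀[F]) :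
    ∃ k ∈ integralGL 𝒪[F] F, heckeRep ϖ i = k * diagPow ϖ 1 := by
  cases i with
  | none => exact ⟨1, one_mem _, by simp [heckeRep, diagPow]⟩
  | some y =>
    refine ⟨mkGL 0 1 1 (residueLift y) (by simp), mkGL_mem_integralGL (by simp) (by simp)
      (by simp) (residueLift y).2 (by simp), ?_⟩
    apply GL_ext <;> simp [GL_mul_apply, heckeRep, diagPow, mkGL_coe, upperTri_coe]

include hμ in
/-- Counting the pairs of a point of level `m` and a neighbour of level `n`. -/
theorem heckeSum_mul_measure (m n : ℕ) :
    heckeSum ϖ (levelIndicator habc hϖ n) (diagPow ϖ m) * μ {x | quotLevel habc hϖ x = m}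
      = (resCard F + 1) * μ {x | quotLevel habc hϖ x = m ∧
        quotLevel habc hϖ (quotTranslate a b c (diagPow ϖ 1) x) = n} := by
  set S := {x : TorusQuot a b c | quotLevel habc hϖ x = m} with hS
  have hSm : MeasurableSet S := measurable_quotLevel habc hϖ (measurableSet_singleton m)
  let A : Option 𝓀[F] → Set (TorusQuot a b c) := fun i =>
    {x | quotLevel habc hϖ (quotTranslate a b c (heckeRep ϖ i) x) = n}
  have hA : ∀ i, MeasurableSet (A i) := fun i =>
    ((measurable_quotLevel habc hϖ).comp (hμ.measurePreserving _).measurable)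
      (measurableSet_singleton n)
  have h1 : ∀ i, μ (A i ∩ S) = μ {x | quotLevel habc hϖ x = m ∧
        quotLevel habc hϖ (quotTranslate a b c (diagPow ϖ 1) x) = n} := by
    intro i
    obtain ⟨k, hk, e⟩ := heckeRep_eq_mul (ϖ := ϖ) i
    rw [← measure_pair_mul_left habc hϖ hμ m n hk, ← e, Set.inter_comm]
    rfl
  -- Double counting: the number of neighbours of level n is integrated over level m, once neighbour
  -- by neighbour and once as a constant.
  have h2 : ∫⁻ x in S, ∑ i, (A i).indicator 1 x ∂μ
      = ∑ i, μ (A i ∩ S) := by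
    rw [lintegral_finsetSum _ fun i _ => measurable_one.indicator (hA i)]
    refine Finset.sum_congr rfl fun i _ => ?_
    rw [lintegral_indicator_one (hA i), Measure.restrict_apply (hA i)]
  have h3 : ∫⁻ x in S, ∑ i, (A i).indicator 1 x ∂μ
      = ∫⁻ _ in S, heckeSum ϖ (levelIndicator habc hϖ n) (diagPow ϖ m) ∂μ := by
    refine setLIntegral_congr_fun hSm fun x hx => ?_
    induction x using Quotient.inductionOn with | _ g
    have hg : level habc hϖ g = m := hx
    rw [← hg, ← heckeSum_levelIndicator, heckeSum]
    refine Finset.sum_congr rfl fun i _ => ?_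
    have hmem : (Quotient.mk _ g : TorusQuot a b c) ∈ A i ↔
        level habc hϖ (g * heckeRep ϖ i) = n := Iff.rfl
    rw [levelIndicator]
    split_ifs with hl
    · rw [Set.indicator_of_mem (hmem.mpr hl), Pi.one_apply]
    · rw [Set.indicator_of_notMem (mt hmem.mp hl)]
  rw [setLIntegral_const] at h3
  rw [← h3, h2, Finset.sum_congr rfl fun i _ => h1 i, Finset.sum_const, Finset.card_univ,
    Fintype.card_option, card_residueField, nsmul_eq_mul]
  push_cast
  rfl

include hμ in
theorem measure_balance (m n : ℕ) :
    heckeSum ϖ (levelIndicator habc hϖ n) (diagPow ϖ m) * μ {x | quotLevel habc hϖ x = m}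
      = heckeSum ϖ (levelIndicator habc hϖ m) (diagPow ϖ n) * μ {x | quotLevel habc hϖ x = n} := by
  rw [heckeSum_mul_measure habc hϖ hμ, heckeSum_mul_measure habc hϖ hμ,
    measure_pair_symm habc hϖ hμ]

include hμ in
-- A point of level m + 1 has q neighbours of level m + 2, and a point of level m + 2 has one of
-- level m + 1; the balance equation gives the ratio q.
theorem measure_quotLevel_succ (m : ℕ) :
    μ {x | quotLevel habc hϖ x = m + 2} = resCard F * μ {x | quotLevel habc hϖ x = m + 1} := by
  have h := measure_balance habc hϖ hμ (m + 1) (m + 2)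
  rw [heckeSum_diagPow_succ habc hϖ (levelIndicator_mul_integral habc hϖ _)
      (levelIndicator_unitInvariant habc hϖ _),
    heckeSum_diagPow_succ habc hϖ (levelIndicator_mul_integral habc hϖ _)
      (levelIndicator_unitInvariant habc hϖ _)] at h
  simp only [levelIndicator_torus_mul, levelIndicator_diagPow] at h
  simp at h
  exact h.symm

include hμ in
-- The neighbours represented by the torus elements p have level 0, so q + 1 - #Ps neighbours of
-- level 1 remain, against one neighbour in the opposite direction.
theorem measure_quotLevel_one {Ps : List (QuadL a b c)ˣ}
    (hPs : ∀ n, heckeSum ϖ (levelIndicator habc hϖ n) 1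
      = (resCard F + 1 - Ps.length) • levelIndicator habc hϖ n (diagPow ϖ 1)
          + (Ps.map fun p => levelIndicator habc hϖ n (torusHom a b c p)).sum) :
    μ {x | quotLevel habc hϖ x = 1} = (resCard F + 1 - Ps.length : ℕ) := by
  have h := measure_balance habc hϖ hμ 0 1
  rw [diagPow_zero, hPs, ← zero_add 1, heckeSum_diagPow_succ habc hϖ
    (levelIndicator_mul_integral habc hϖ _) (levelIndicator_unitInvariant habc hϖ _),
    measure_quotLevel_zero habc hϖ hμ] at h
  have h1 : ∀ p, levelIndicator habc hϖ (0 + 1) (torusHom a b c p) = 0 := by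
    intro p
    rw [← mul_one (torusHom a b c p), levelIndicator_torus_mul, levelIndicator, level_one]
    simp
  simp only [levelIndicator_torus_mul, levelIndicator_diagPow, h1] at h
  simp [-ENNReal.natCast_sub] at h
  exact h.symm

end Level

/-! ### Series satisfying a second order recurrence -/

section Series

/-- Summability of a sequence which satisfies a linear recurrence of order two whose characteristic
roots are of absolute value less than one. -/
theorem summable_of_recurrence {w : ℕ → ℂ} {γ₁ γ₂ : ℂ}
    (hw : ∀ m, w (m + 3) = (γ₁ + γ₂) * w (m + 2) - γ₁ * γ₂ * w (m + 1))
    (h₁ : ‖γ₁‖ < 1) (h₂ : ‖γ₂‖ < 1) : Summable fun m => ‖w m‖ := by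
  -- Splitting off the root γ₁ leaves a geometric sequence of ratio γ₂. The term w 0 is exempt from
  -- the recurrence and is never used.
  let y : ℕ → ℂ := fun m => w (m + 2) - γ₁ * w (m + 1)
  have hy : ∀ m, y m = γ₂ ^ m * y 0 := by
    intro m
    induction m with
    | zero => simp
    | succ m ih =>
      rw [pow_succ', mul_assoc, ← ih]
      simp only [y]
      rw [show m + 1 + 2 = m + 3 from rfl, hw]
      ring
  have hys : Summable fun m => ‖y m‖ := by
    have e : (fun m => ‖y m‖) = fun m => ‖γ₂‖ ^ m * ‖y 0‖ := by
      funext m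
      rw [hy m, norm_mul, norm_pow]
    rw [e]
    exact (summable_geometric_of_lt_one (norm_nonneg _) h₂).mul_right _
  rw [← summable_nat_add_iff 1]
  -- The bound solves S ≤ ‖w 1‖ + ‖γ₁‖ S + ∑ ‖y m‖ for a partial sum S of ‖w (m + 1)‖. No case
  -- distinction for γ₁ = γ₂ arises.
  refine summable_of_sum_range_le (c := (‖w 1‖ + ∑' m, ‖y m‖) / (1 - ‖γ₁‖))
    (fun m => norm_nonneg _) fun n => ?_
  have h3 : ∑ i ∈ Finset.range n, ‖w (i + 2)‖
      ≤ ‖γ₁‖ * ∑ i ∈ Finset.range n, ‖w (i + 1)‖ + ∑ i ∈ Finset.range n, ‖y i‖ := by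
    rw [Finset.mul_sum, ← Finset.sum_add_distrib]
    refine Finset.sum_le_sum fun i _ => ?_
    have : w (i + 2) = γ₁ * w (i + 1) + y i := by simp only [y]; ring
    rw [this, ← norm_mul]
    exact norm_add_le _ _
  have h4 : ∑ i ∈ Finset.range n, ‖y i‖ ≤ ∑' m, ‖y m‖ :=
    hys.sum_le_tsum _ fun _ _ => norm_nonneg _
  have h5 : ∑ i ∈ Finset.range n, ‖w (i + 1)‖ ≤ ‖w 1‖ + ∑ i ∈ Finset.range n, ‖w (i + 2)‖ := by
    have e := Finset.sum_range_succ' (fun i => ‖w (i + 1)‖) n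
    rw [Finset.sum_range_succ] at e
    have := norm_nonneg (w (n + 1))
    simp only [zero_add] at e
    linarith [e]
  rw [le_div_iff₀ (by linarith)]
  linarith

/-- Sum the recurrence over all m and restore the missing initial terms. Summability suffices, with
no bound on the characteristic roots. -/
theorem tsum_of_recurrence {w : ℕ → ℂ} {s p : ℂ}
    (hw : ∀ m, w (m + 3) = s * w (m + 2) - p * w (m + 1)) (hs : Summable w) :
    (1 - s + p) * ∑' m, w m = w 0 + w 1 + w 2 - s * (w 0 + w 1) + p * w 0 := by
  have h1 := hs.sum_add_tsum_nat_add 1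
  have h2 := hs.sum_add_tsum_nat_add 2
  have h3 := hs.sum_add_tsum_nat_add 3
  have s1 := (summable_nat_add_iff 1).mpr hs
  have s2 := (summable_nat_add_iff 2).mpr hs
  have e : ∑' m, w (m + 3) = s * ∑' m, w (m + 2) - p * ∑' m, w (m + 1) := by
    rw [← tsum_mul_left, ← tsum_mul_left, ← (s2.mul_left s).tsum_sub (s1.mul_left p)]
    exact tsum_congr hw
  simp only [Finset.sum_range_succ, Finset.sum_range_zero, zero_add] at h1 h2 h3
  linear_combination -h3 + e + s * h2 - p * h1

end Series

/-! ### Integration over the fibres of a map to the natural numbers -/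

/-- Pushing μ forward along l reduces the integral to a measure on ℕ whose point masses are the
volumes of the fibres. -/
theorem integrable_comp_nat_iff {α : Type*} [MeasurableSpace α] {μ : Measure α} {l : α → ℕ}
    (hl : Measurable l) (hfin : ∀ n, μ {x | l x = n} ≠ ⊤) (c : ℕ → ℂ) :
    Integrable (fun x => c (l x)) μ ↔ Summable fun n => ‖(μ.real {x | l x = n} : ℂ) * c n‖ := by
  have h1 : Integrable (fun x => c (l x)) μ ↔ Integrable c (μ.map l) :=
    (integrable_map_measure (measurable_of_countable c).aestronglyMeasurable hl.aemeasurable).symm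
  have h2 : ∀ n, μ.map l {n} = μ {x | l x = n} := fun n =>
    Measure.map_apply hl (measurableSet_singleton n)
  have h3 : ∀ n, ‖c n‖ₑ * μ {x | l x = n}
      = ENNReal.ofReal ‖(μ.real {x | l x = n} : ℂ) * c n‖ := by
    intro n
    rw [norm_mul, Complex.norm_real, Real.norm_of_nonneg measureReal_nonneg,
      ENNReal.ofReal_mul measureReal_nonneg, Measure.real, ENNReal.ofReal_toReal (hfin n),
      ofReal_norm, mul_comm]
  rw [h1, Integrable, hasFiniteIntegral_iff_enorm, lintegral_countable']
  simp only [h2, h3]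
  constructor
  · rintro ⟨-, h⟩
    have := ENNReal.summable_toReal h.ne
    simpa only [ENNReal.toReal_ofReal (norm_nonneg _)] using this
  · intro h
    exact ⟨(measurable_of_countable c).aestronglyMeasurable, h.tsum_ofReal_lt_top⟩

theorem integral_comp_nat {α : Type*} [MeasurableSpace α] {μ : Measure α} {l : α → ℕ}
    (hl : Measurable l) {c : ℕ → ℂ} (hc : Integrable (fun x => c (l x)) μ) :
    ∫ x, c (l x) ∂μ = ∑' n, (μ.real {x | l x = n} : ℂ) * c n := by
  have hm := (measurable_of_countable c).aestronglyMeasurable (μ := μ.map l)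
  have h1 : Integrable c (μ.map l) := (integrable_map_measure hm hl.aemeasurable).mpr hc
  rw [← integral_map hl.aemeasurable hm, integral_countable h1]
  refine tsum_congr fun n => ?_
  rw [Measure.real, Measure.map_apply hl (measurableSet_singleton n), Complex.real_smul]
  rfl

variable {F : Type*} [Field F] [ValuativeRel F] [TopologicalSpace F] [IsNonarchimedeanLocalField F]
variable {a b c : 𝒪[F]} {ϖ : Fˣ} {Ω₁ Ω₂ : (QuadL a b c)ˣ →* ℂˣ}

/-! ### Character identities and the L-factor of Ω₁/Ω₂ -/

section Characters

/-- The elements ϖ and N(p) = p p̄ of F differ by a unit, which Ω does not see. -/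
theorem restrictF_eq_mul_star {Ω : (QuadL a b c)ˣ →* ℂˣ} (hΩ : IsUnramified (intL a b c) Ω)
    {p : (QuadL a b c)ˣ}
    (hp : valuation F (QuadraticAlgebra.norm (p : QuadL a b c)) = valuation F (ϖ : F)) :
    restrictF Ω ϖ = Ω p * Ω (star p) := by
  rw [← map_eq_of_val_eq (restrictF_isUnramified hΩ)
    (x := Units.mk0 _ (norm_unit_ne_zero p)) (y := ϖ) hp, ← map_mul]
  change Ω _ = Ω _
  congr 1
  apply Units.ext
  rw [Units.val_mul, Units.coe_star]
  exact QuadraticAlgebra.algebraMap_norm_eq_mul_star _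

theorem charOmega_mul_star (z : (QuadL a b c)ˣ) :
    (charOmega Ω₁ Ω₂ z : ℂ) * Ω₁ (star z) = (Ω₂ z : ℂ)⁻¹ := by
  have : charOmega Ω₁ Ω₂ z * Ω₁ (star z) = (Ω₂ z)⁻¹ := by
    change (Ω₁ (star z))⁻¹ * (Ω₂ z)⁻¹ * Ω₁ (star z) = _
    rw [mul_comm, mul_inv_cancel_left]
  rw [← Units.val_mul, this, Units.val_inv_eq_inv_val]

theorem star_scalarL (x : Fˣ) : star (scalarL a b c x) = scalarL a b c x :=
  Units.ext (by
    rw [Units.coe_star]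
    exact QuadraticAlgebra.ext (by simp) (by simp))

theorem charOmega_scalarL_mul (x : Fˣ) :
    (charOmega Ω₁ Ω₂ (scalarL a b c x) : ℂ) * restrictF Ω₁ x * restrictF Ω₁ x
      = restrictF (Ω₁ / Ω₂) x := by
  have h := charOmega_mul_star (Ω₁ := Ω₁) (Ω₂ := Ω₂) (scalarL a b c x)
  rw [star_scalarL] at h
  change _ * (Ω₁ (scalarL a b c x) : ℂ) * (Ω₁ (scalarL a b c x) : ℂ)
    = ((Ω₁ (scalarL a b c x) / Ω₂ (scalarL a b c x) : ℂˣ) : ℂ)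
  rw [h, Units.val_div_eq_div_val, div_eq_inv_mul]

theorem charOmega_mul_restrictF (h₁ : IsUnramified (intL a b c) Ω₁) {p : (QuadL a b c)ˣ}
    (hp : valuation F (QuadraticAlgebra.norm (p : QuadL a b c)) = valuation F (ϖ : F)) :
    (charOmega Ω₁ Ω₂ p : ℂ) * restrictF Ω₁ ϖ = (Ω₁ / Ω₂) p := by
  rw [restrictF_eq_mul_star h₁ hp, Units.val_mul, mul_comm (Ω₁ p : ℂ), ← mul_assoc,
    charOmega_mul_star, MonoidHom.div_apply, Units.val_div_eq_div_val, div_eq_inv_mul]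

/-- With ω = Ω(ϖ), the right side is 1 - ωX² for inert, 1 - Ω(p)X for ramified and (1 - Ω(p)X)(1 -
Ω(p̄)X) for split L, the last because ω = Ω(p)Ω(p̄). The twist by Ω₁(ϖ) in X turns Ω into Ω₁/Ω₂. The
identity also holds at a pole of the L-factor, where the convention 0⁻¹ = 0 makes the left side 0.
-/
theorem inv_lFactorL_eq (h₁ : IsUnramified (intL a b c) Ω₁) (h₂ : IsUnramified (intL a b c) Ω₂)
    {ϖL : (QuadL a b c)ˣ} {Ps : List (QuadL a b c)ˣ}
    (hPs : splitSymbol a b c = -1 ∧ Ps = [] ∨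
        splitSymbol a b c = 0 ∧ Ps = [ϖL] ∧
          valuation F (QuadraticAlgebra.norm (ϖL : QuadL a b c)) = valuation F (ϖ : F) ∨
        splitSymbol a b c = 1 ∧ Ps = [ϖL, star ϖL] ∧
          valuation F (QuadraticAlgebra.norm (ϖL : QuadL a b c)) = valuation F (ϖ : F))
    (s : ℂ) {X : ℂ} (hX : X = (restrictF Ω₁ ϖ : ℂ) * (resCard F : ℂ) ^ (-s)) :
    (lFactorL ϖ ϖL (Ω₁ / Ω₂) s)⁻¹
      = 1 - (Ps.map fun p => (charOmega Ω₁ Ω₂ p : ℂ)).sum * X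
        + (Ps.length - 1) * charOmega Ω₁ Ω₂ (scalarL a b c ϖ) * X ^ 2 := by
  have hq : (resCard F : ℂ) ^ (-(2 * s)) = ((resCard F : ℂ) ^ (-s)) ^ 2 := by
    rw [← Complex.cpow_nat_mul]
    congr 1
    push_cast
    ring
  subst hX
  have hstar : ∀ p : (QuadL a b c)ˣ,
      valuation F (QuadraticAlgebra.norm (p : QuadL a b c)) = valuation F (ϖ : F) →
      valuation F (QuadraticAlgebra.norm ((star p : (QuadL a b c)ˣ) : QuadL a b c))
        = valuation F (ϖ : F) := by
    intro p hp
    rwa [Units.coe_star, QuadraticAlgebra.norm_star]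
  rcases hPs with ⟨hs, rfl⟩ | ⟨hs, rfl, hv⟩ | ⟨hs, rfl, hv⟩
  · rw [lFactorL, if_pos hs, inv_inv, hq, ← charOmega_scalarL_mul]
    simp only [List.map_nil, List.sum_nil, List.length_nil, Nat.cast_zero]
    ring
  · rw [lFactorL, hs, if_neg (by norm_num), if_pos rfl, inv_inv, ← charOmega_mul_restrictF h₁ hv]
    simp only [List.map_cons, List.map_nil, List.sum_cons, List.sum_nil, List.length_cons,
      List.length_nil, zero_add, Nat.cast_one]
    ring
  · have hω : (charOmega Ω₁ Ω₂ (scalarL a b c ϖ) : ℂ)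
        = charOmega Ω₁ Ω₂ ϖL * charOmega Ω₁ Ω₂ (star ϖL) := by
      rw [← Units.val_mul, ← restrictF_eq_mul_star (charOmega_isUnramified h₁ h₂) hv]
      rfl
    rw [lFactorL, hs, if_neg (by norm_num), if_neg (by norm_num), mul_inv, inv_inv, inv_inv,
      ← charOmega_mul_restrictF h₁ hv, ← charOmega_mul_restrictF h₁ (hstar _ hv), hω]
    simp only [List.map_cons, List.map_nil, List.sum_cons, List.sum_nil, List.length_cons,
      List.length_nil, zero_add]
    push_cast
    ring

end Characters

theorem resCard_cpow_half (s : ℂ) :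
    (resCard F : ℂ) ^ (-(2 * s + 1 / 2))
      = ((Real.sqrt (resCard F) : ℝ) : ℂ) * (resCard F : ℂ) ^ (-(2 * s + 1)) := by
  have hq : (resCard F : ℂ) ≠ 0 := by exact_mod_cast (resCard_pos (F := F)).ne'
  rw [Real.sqrt_eq_rpow, Complex.ofReal_cpow (Nat.cast_nonneg _), Complex.ofReal_natCast,
    ← Complex.cpow_add _ _ hq]
  congr 1
  push_cast
  ring

variable [CharZero F]

theorem zetaFun_eq_level (habc : Admissible a b c) (hϖ : IsUniformizer 𝒪[F] ϖ)
    (h₁ : IsUnramified (intL a b c) Ω₁) (h₂ : IsUnramified (intL a b c) Ω₂)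
    {B : GL (Fin 2) F → ℂ}
    (hB : ∀ (z : (QuadL a b c)ˣ) (g : GL (Fin 2) F),
      B (torusHom a b c z * g) = (charOmega Ω₁ Ω₂ z : ℂ) * B g)
    (hs : IsSpherical B) (s : ℂ) (g : GL (Fin 2) F) :
    zetaFun Ω₁ Ω₂ B s g = ((restrictF Ω₁ ϖ : ℂ) * (resCard F : ℂ) ^ (-(2 * s + 1)))
      ^ level habc hϖ g * B (diagPow ϖ (level habc hϖ g)) := by
  obtain ⟨t, m, k, hk, rfl⟩ := exists_torus_mul_diagPow_mul habc hϖ g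
  rw [level_mul habc hϖ _ _ hk, zetaFun_mul_integral h₁ h₂ hs s hk,
    zetaFun_torus_mul habc h₁ h₂ hB, zetaFun_diagPow habc hϖ h₁ h₂]

/-! ### Closed form of the volumes -/

section Volume

variable [MeasurableSpace (TorusQuot a b c)] [BorelSpace (TorusQuot a b c)]
  {μ : Measure (TorusQuot a b c)}

theorem measure_quotLevel_add_one (habc : Admissible a b c) (hϖ : IsUniformizer 𝒪[F] ϖ)
    (hμ : IsNormalizedInvariant μ) {N : ℕ} (hN : μ {x | quotLevel habc hϖ x = 1} = N) (m : ℕ) :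
    μ {x | quotLevel habc hϖ x = m + 1} = (N * resCard F ^ m : ℕ) := by
  have := Fintype.ofFinite 𝓀[F]
  induction m with
  | zero => simpa using hN
  | succ m ih =>
    rw [measure_quotLevel_succ habc hϖ hμ, ih]
    push_cast
    ring

end Volume

/-- The compatibility of central characters enters here; it makes the product of the two Satake
terms equal to qωX². -/
theorem charOmega_scalarL_eq {χ₁ χ₂ : Fˣ →* ℂˣ} (hcentral : restrictF (Ω₁ * Ω₂) = (χ₁ * χ₂)⁻¹)
    (x : Fˣ) : (charOmega Ω₁ Ω₂ (scalarL a b c x) : ℂ) = χ₁ x * χ₂ x := by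
  have h1 : charOmega Ω₁ Ω₂ (scalarL a b c x) = (restrictF (Ω₁ * Ω₂) x)⁻¹ := by
    change (Ω₁ (star (scalarL a b c x)))⁻¹ * (Ω₂ (scalarL a b c x))⁻¹
      = (Ω₁ (scalarL a b c x) * Ω₂ (scalarL a b c x))⁻¹
    rw [star_scalarL, mul_inv]
  rw [h1, hcentral, MonoidHom.inv_apply, inv_inv, MonoidHom.mul_apply, Units.val_mul]

/-- The contributions of the cosets of level `m` to the zeta integral satisfy a linear recurrence
whose characteristic roots are the Satake terms. -/
theorem recurrence_of_levels {q l σ ω X γ₁ γ₂ : ℂ} {N : ℂ} {b v w : ℕ → ℂ}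
    (hv0 : v 0 = 1) (hv : ∀ m, v (m + 1) = N * q ^ m) (hw : ∀ m, w m = v m * (X ^ m * b m))
    (hb0 : b 0 = 1) (hb1 : N * b 1 + σ = l) (hb : ∀ m, q * b (m + 2) + ω * b m = l * b (m + 1))
    (hs : γ₁ + γ₂ = l * X) (hp : γ₁ * γ₂ = q * ω * X ^ 2) :
    (∀ m, w (m + 3) = (γ₁ + γ₂) * w (m + 2) - γ₁ * γ₂ * w (m + 1)) ∧
      w 0 + w 1 + w 2 - (γ₁ + γ₂) * (w 0 + w 1) + γ₁ * γ₂ * w 0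
        = 1 - σ * X + (q - N) * ω * X ^ 2 := by
  constructor
  · intro m
    rw [hs, hp, hw, hw, hw, hv, hv, hv]
    linear_combination N * q ^ (m + 1) * X ^ (m + 3) * hb (m + 1)
  -- The value v 0 = 1 does not fit the pattern N q^(m-1) of the later volumes; this defect produces
  -- the numerator.
  · have h2 := hb 0
    rw [hb0] at h2
    rw [hs, hp, hw, hw, hw, hv0, hv, hv, hb0]
    simp only [zero_add] at h2 ⊢
    linear_combination N * X ^ 2 * h2 + X * hb1

end

end WaldspurgerZeta

/-! ### The main theorem -/

open WaldspurgerZeta in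
theorem theorem4p1 {F : Type*} [Field F] [ValuativeRel F] [TopologicalSpace F]
    [IsNonarchimedeanLocalField F] [CharZero F]
    (a b c : 𝒪[F]) (habc : Admissible a b c)
    (ϖ : Fˣ) (hϖ : IsUniformizer 𝒪[F] ϖ)
    (ϖL : (QuadL a b c)ˣ) (hϖL : IsUniformizerL ϖ ϖL)
    (χ₁ χ₂ : Fˣ →* ℂˣ) (hχ₁ : IsUnramified 𝒪[F] χ₁) (hχ₂ : IsUnramified 𝒪[F] χ₂)
    (hirr : ¬ ∀ x : Fˣ, ((χ₁ x / χ₂ x : ℂˣ) : ℂ) = (absF (x : F) : ℂ))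
    (hirr' : ¬ ∀ x : Fˣ, ((χ₁ x / χ₂ x : ℂˣ) : ℂ) = (absF (x : F) : ℂ)⁻¹)
    (Ω₁ Ω₂ : (QuadL a b c)ˣ →* ℂˣ)
    (hΩ₁ : IsUnramified (intL a b c) Ω₁) (hΩ₂ : IsUnramified (intL a b c) Ω₂)
    (hcentral : restrictF (Ω₁ * Ω₂) = (χ₁ * χ₂)⁻¹)
    (W : Submodule ℂ (GL (Fin 2) F → ℂ))
    (hW : IsWaldspurgerModel χ₁ χ₂ (charOmega Ω₁ Ω₂) W)
    [MeasurableSpace (TorusQuot a b c)] [BorelSpace (TorusQuot a b c)]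
    (μ : Measure (TorusQuot a b c)) (hμ : IsNormalizedInvariant μ) :
    (∃! B₀ : GL (Fin 2) F → ℂ, B₀ ∈ W ∧ IsSpherical B₀ ∧ B₀ 1 = 1) ∧
    ∀ B₀ : GL (Fin 2) F → ℂ, B₀ ∈ W → IsSpherical B₀ → B₀ 1 = 1 → ∀ s : ℂ,
      (∀ t ∈ torus a b c, ∀ h, zetaFun Ω₁ Ω₂ B₀ s (t * h) = zetaFun Ω₁ Ω₂ B₀ s h) ∧
      (‖satakeTerm ϖ χ₁ (restrictF Ω₁) (2 * s + 1 / 2)‖ < 1 →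
        ‖satakeTerm ϖ χ₂ (restrictF Ω₁) (2 * s + 1 / 2)‖ < 1 →
        Integrable (onTorusQuot (zetaFun Ω₁ Ω₂ B₀ s)) μ) ∧
      (Integrable (onTorusQuot (zetaFun Ω₁ Ω₂ B₀ s)) μ →
        satakeTerm ϖ χ₁ (restrictF Ω₁) (2 * s + 1 / 2) ≠ 1 →
        satakeTerm ϖ χ₂ (restrictF Ω₁) (2 * s + 1 / 2) ≠ 1 →
        zetaIntegral μ Ω₁ Ω₂ B₀ s
          = lFactorPi ϖ χ₁ χ₂ (restrictF Ω₁) (2 * s + 1 / 2)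
            / lFactorL ϖ ϖL (Ω₁ / Ω₂) (2 * s + 1)) := by
  have := Fintype.ofFinite 𝓀[F]
  obtain ⟨Ps, hPs, hcases⟩ := exists_heckeSum_one habc hϖ hϖL
  have hΩ := charOmega_isUnramified hΩ₁ hΩ₂
  have hlen : Ps.length ≤ 2 := by
    rcases hcases with ⟨-, rfl⟩ | ⟨-, rfl, -⟩ | ⟨-, rfl, -⟩ <;> simp
  have hq1 := one_lt_resCard (F := F)
  have hPsB : ∀ B ∈ W, IsSpherical B → heckeSum ϖ B 1
      = (resCard F + 1 - Ps.length) • B (diagPow ϖ 1)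
        + (Ps.map fun p => B (torusHom a b c p)).sum :=
    fun B hB hs => hPs B hs (hW.unitInvariant hΩ hB)
  refine ⟨hW.existsUnique_spherical hχ₁ hχ₂ habc hϖ hΩ hlen hPsB, fun B hB hs h1 s => ?_⟩
  set X : ℂ := (restrictF Ω₁ ϖ : ℂ) * (resCard F : ℂ) ^ (-(2 * s + 1)) with hX
  set N : ℕ := resCard F + 1 - Ps.length with hN
  -- The truncated subtraction in N is genuine because #Ps ≤ 2 ≤ q; this is the coefficient that
  -- occurs in the L-factor.
  have hNq : (resCard F : ℂ) - N = (Ps.length : ℂ) - 1 := by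
    rw [hN, Nat.cast_sub (by omega)]
    push_cast
    ring
  have hm1 : μ {x | quotLevel habc hϖ x = 1} = N :=
    measure_quotLevel_one habc hϖ hμ fun n =>
      hPs _ (levelIndicator_mul_integral habc hϖ n) (levelIndicator_unitInvariant habc hϖ n)
  have hm := measure_quotLevel_add_one habc hϖ hμ hm1
  have hm0 := measure_quotLevel_zero habc hϖ hμ
  have hfin : ∀ n, μ {x | quotLevel habc hϖ x = n} ≠ ⊤ := by
    rintro (_ | n)
    · rw [hm0]; exact ENNReal.one_ne_top
    · rw [hm]; exact ENNReal.natCast_ne_top _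
  have hlm := measurable_quotLevel (a := a) (b := b) (c := c) habc hϖ
  let coef : ℕ → ℂ := fun m => X ^ m * B (diagPow ϖ m)
  have hfun : onTorusQuot (zetaFun Ω₁ Ω₂ B s)
      = fun x => coef (quotLevel habc hϖ x) := by
    funext x
    rw [onTorusQuot, zetaFun_eq_level habc hϖ hΩ₁ hΩ₂ (hW.equivariant B hB) hs, level_out]
  have hγ : ∀ χ : Fˣ →* ℂˣ, satakeTerm ϖ χ (restrictF Ω₁) (2 * s + 1 / 2)
      = ((Real.sqrt (resCard F) : ℝ) : ℂ) * χ ϖ * X := by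
    intro χ
    rw [satakeTerm, resCard_cpow_half, hX]
    ring
  have hsq : ((Real.sqrt (resCard F) : ℝ) : ℂ) * ((Real.sqrt (resCard F) : ℝ) : ℂ)
      = resCard F := by
    rw [← Complex.ofReal_mul, Real.mul_self_sqrt (Nat.cast_nonneg _), Complex.ofReal_natCast]
  set γ₁ := satakeTerm ϖ χ₁ (restrictF Ω₁) (2 * s + 1 / 2) with hγ₁
  set γ₂ := satakeTerm ϖ χ₂ (restrictF Ω₁) (2 * s + 1 / 2) with hγ₂
  have hzero := hW.recurrence_zero hϖ hB hs (hPsB B hB hs)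
  rw [h1, mul_one, mul_one] at hzero
  obtain ⟨hrec, hinit⟩ := recurrence_of_levels (γ₁ := γ₁) (γ₂ := γ₂) (X := X)
    (b := fun m => B (diagPow ϖ m)) (v := fun m => (μ.real {x | quotLevel habc hϖ x = m} : ℂ))
    (by simp only [Measure.real, hm0, ENNReal.toReal_one, Complex.ofReal_one])
    (N := N) (q := resCard F)
    (fun m => by simp only [Measure.real, hm, ENNReal.toReal_natCast]; push_cast; rfl)
    (w := fun m => (μ.real {x | quotLevel habc hϖ x = m} : ℂ) * coef m)
    (fun m => rfl) (by rw [diagPow_zero, h1]) hzero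
    (hW.recurrence habc hϖ hΩ hB hs) (by rw [hγ₁, hγ₂, hγ, hγ, heckeEigenvalue]; ring)
    (by
      rw [hγ₁, hγ₂, hγ, hγ, charOmega_scalarL_eq hcentral, ← hsq]
      ring)
  refine ⟨fun t ht h => ?_, fun hn₁ hn₂ => ?_, fun hint hn₁ hn₂ => ?_⟩
  · obtain ⟨z, rfl⟩ := exists_torusHom_eq habc ht
    exact zetaFun_torus_mul habc hΩ₁ hΩ₂ (hW.equivariant B hB) s z h
  · rw [hfun]
    exact (integrable_comp_nat_iff hlm hfin coef).mpr (summable_of_recurrence hrec hn₁ hn₂)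
  · rw [hfun] at hint
    -- Only absolute convergence is used from here on, so the formula also covers convergence
    -- outside the region where both Satake terms are less than 1 in absolute value.
    have hsum := ((integrable_comp_nat_iff hlm hfin coef).mp hint).of_norm
    have hZ := tsum_of_recurrence hrec hsum
    rw [hinit, hNq, ← inv_lFactorL_eq hΩ₁ hΩ₂ hcases (2 * s + 1) hX] at hZ
    have e₁ : 1 - γ₁ ≠ 0 := sub_ne_zero.mpr hn₁.symm
    have e₂ : 1 - γ₂ ≠ 0 := sub_ne_zero.mpr hn₂.symm
    rw [zetaIntegral, hfun, integral_comp_nat hlm hint, lFactorPi, div_eq_mul_inv _ (lFactorL _ _ _ _),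
      ← hZ, ← hγ₁, ← hγ₂]
    field_simp
    ring
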